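/- **Proposition.** Let $(Y_t)_{t\ge 0}$ be an $\mathbb{R}^d$-valued Lévy process (with almost surely càdlàg paths) on a probability space $(\Omega,\mathcal F,\mathbb P)$ with Lévy triplet $(b,\sigma,\nu)$, where $b\in\mathbb{R}^d$, $\sigma\in\mathbb{R}^{d\times d}$ is symmetric positive semidefinite, and $\nu$ is a Lévy measure, i.e. $\nu(\{0\})=0$ and $\int 1\wedge|y|^2\,\nu(\mathrm dy)<\infty$. With $h(y):=y\,\mathbf 1_{\{|y|\le 1\}}$, this means that for all $t\ge 0$ and $\xi\in\mathbb{R}^d$ $$\mathbb{E}\big[e^{i\langle \xi,Y_t\rangle}\big]=\exp\Big(t\Big(i\langle b,\xi\rangle-\tfrac12\langle\xi,\sigma\xi\rangle+\int_{\mathbb{R}^d\setminus\{0\}}\big(e^{i\langle \xi,y\rangle}-1-i\langle \xi,h(y)\rangle\big)\,\nu(\mathrm dy)\Big)\Big).$$ Let $\omega\ge 0$, let $F\colon\mathbb{R}^d\to\mathbb{R}^d$ satisfy $|F(x_1)-F(x_2)|\le\omega|x_1-x_2|$ for all $x_1,x_2\in\mathbb{R}^d$, and, for every $x\in\mathbb{R}^d$,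 let $(X^x_t)_{t\ge 0}$ be the (unique) strong solution of $\mathrm dX^x_t=F(X^x_t)\,\mathrm dt+\mathrm dY_t$, $X^x_0=x$; that is, $X^x$ has almost surely càdlàg paths, is adapted to the completed filtration generated by $Y$, and almost surely $X^x_t=x+\int_0^tF(X^x_s)\,\mathrm ds+Y_t$ for all $t\ge 0$. A sequence $(f_n)\subset C_b(\mathbb{R}^d)$ converges to $f\in C_b(\mathbb{R}^d)$ *in the mixed topology* if $\sup_n\|f_n\|_\infty<\infty$ and $\sup_{|x|\le r}|f_n(x)-f(x)|\to 0$ for all $r\ge 0$; $\lim_{h\downarrow 0}f_h=f$ in the mixed topology means that $f_{h_n}\to f$ in the mixed topology for every sequence $(h_n)\subset(0,\infty)$ with $h_n\to 0$. Then $$(T_tf)(x):=\mathbb{E}[f(X^x_t)],\qquad t\ge 0,\ f\in C_b(\mathbb{R}^d),\ x\in\mathbb{R}^d,$$ defines a strongly continuous Feller semigroup on $C_b(\mathbb{R}^d)$, i.e. $(T_t)_{t\ge 0}$ is a family of positive linear operators $C_b(\mathbb{R}^d)\to C_b(\mathbb{R}^d)$ with $T_t1=1$, $T_0f=f$, $T_{s+t}=T_sT_t$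 for all $s,t\geq 0$, and $(T_{t_n}f_n)(x_n)\to(T_tf)(x)$ whenever $t_n\to t$ in $[0,\infty)$, $x_n\to x$ in $\mathbb{R}^d$, and $f_n\to f$ in the mixed topology. Moreover, let $B$ be the generator of $(T_t)_{t\ge 0}$, i.e. $Bf:=\lim_{h\downarrow 0}\frac{T_hf-f}{h}$ in the mixed topology, with domain $D(B)$ the set of all $f\in C_b(\mathbb{R}^d)$ for which this limit exists in $C_b(\mathbb{R}^d)$. Then, for every $f\in C_b^2(\mathbb{R}^d)$ (all partial derivatives up to order two exist and are bounded and continuous) with $\sup_{x\in\mathbb{R}^d}|\langle\nabla f(x),F(x)\rangle|<\infty$, it holds that $f\in D(B)$ and, for all $x\in\mathbb{R}^d$, $$(Bf)(x)=\langle\nabla f(x),F(x)\rangle+\langle b,\nabla f(x)\rangle+\tfrac12\operatorname{tr}\big(\sigma\nabla^2f(x)\big)+\int_{\mathbb{R}^d\setminus\{0\}}\big(f(x+y)-f(x)-\langle\nabla f(x),h(y)\rangle\big)\,\nu(\mathrm dy).$$ -/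

import Mathlib

open MeasureTheory ProbabilityTheory Filter Topology
open scoped NNReal BoundedContinuousFunction

noncomputable section

namespace LevyDrift

/-- `ℝᵈ` with the Euclidean norm, the standard inner product and the Borel σ-algebra. -/
abbrev Eucl (d : ℕ) : Type := EuclideanSpace ℝ (Fin d)

/-! ### Convergence in the mixed topology on `C_b(ℝᵈ)` -/

/-- Sequential convergence in the mixed topology: uniformly bounded in the supremum norm, and
uniformly convergent on every ball `{|x| ≤ r}`. -/
def MixedTendsto {d : ℕ} (f : ℕ → (Eucl d →ᵇ ℝ)) (g : Eucl d →ᵇ ℝ) : Prop :=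
  (∃ C : ℝ, ∀ n, ‖f n‖ ≤ C) ∧
    ∀ r : ℝ, 0 ≤ r →
      TendstoUniformlyOn (fun n x => f n x) (fun x => g x) atTop (Metric.closedBall 0 r)

/-- `lim_{h ↓ 0} f_h = g` in the mixed topology: convergence along every null sequence
in `(0, ∞)`. -/
def MixedTendstoZero {d : ℕ} (f : ℝ≥0 → (Eucl d →ᵇ ℝ)) (g : Eucl d →ᵇ ℝ) : Prop :=
  ∀ h : ℕ → ℝ≥0, (∀ n, 0 < h n) → Tendsto h atTop (𝓝 0) → MixedTendsto (fun n => f (h n)) g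

/-! ### Strongly continuous Feller semigroups and their generators -/

/-- Strongly continuous Feller semigroups on `C_b(ℝᵈ)` (with the mixed topology). -/
structure IsStronglyContinuousFellerSemigroup {d : ℕ}
    (S : ℝ≥0 → ((Eucl d →ᵇ ℝ) →ₗ[ℝ] (Eucl d →ᵇ ℝ))) : Prop where
  positive : ∀ t f, 0 ≤ f → 0 ≤ S t f
  map_one : ∀ t, S t 1 = 1
  zero_apply : ∀ f, S 0 f = f
  add_apply : ∀ s t f, S (s + t) f = S s (S t f)
  continuous : ∀ (t : ℕ → ℝ≥0) (t₀ : ℝ≥0) (x : ℕ → Eucl d) (x₀ : Eucl d)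
    (f : ℕ → (Eucl d →ᵇ ℝ)) (f₀ : Eucl d →ᵇ ℝ),
    Tendsto t atTop (𝓝 t₀) → Tendsto x atTop (𝓝 x₀) → MixedTendsto f f₀ →
      Tendsto (fun n => S (t n) (f n) (x n)) atTop (𝓝 (S t₀ f₀ x₀))

/-- The difference quotient `(S_h f - f) / h`. -/
def diffQuot {d : ℕ} (S : ℝ≥0 → ((Eucl d →ᵇ ℝ) →ₗ[ℝ] (Eucl d →ᵇ ℝ))) (f : Eucl d →ᵇ ℝ)
    (h : ℝ≥0) : Eucl d →ᵇ ℝ :=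
  (h : ℝ)⁻¹ • (S h f - f)

/-- The domain of the generator: those `f` for which `(S_h f - f) / h` converges in the mixed
topology as `h ↓ 0`. -/
def generatorDomain {d : ℕ} (S : ℝ≥0 → ((Eucl d →ᵇ ℝ) →ₗ[ℝ] (Eucl d →ᵇ ℝ))) :
    Set (Eucl d →ᵇ ℝ) :=
  {f | ∃ g, MixedTendstoZero (diffQuot S f) g}

open Classical in
/-- The generator: the limit of `(S_h f - f) / h` in the mixed topology as `h ↓ 0` for `f` in the
domain (and `0` outside the domain). -/
def generator {d : ℕ} (S : ℝ≥0 → ((Eucl d →ᵇ ℝ) →ₗ[ℝ] (Eucl d →ᵇ ℝ))) (f : Eucl d →ᵇ ℝ) :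
    Eucl d →ᵇ ℝ :=
  if hf : ∃ g, MixedTendstoZero (diffQuot S f) g then hf.choose else 0

/-- Mixed limits are unique. -/
theorem MixedTendsto.unique {d : ℕ} {f : ℕ → (Eucl d →ᵇ ℝ)} {g g' : Eucl d →ᵇ ℝ}
    (h : MixedTendsto f g) (h' : MixedTendsto f g') : g = g' := by
  ext x
  have hx : x ∈ Metric.closedBall (0 : Eucl d) ‖x‖ := by simp
  exact tendsto_nhds_unique ((h.2 ‖x‖ (norm_nonneg x)).tendsto_at hx)
    ((h'.2 ‖x‖ (norm_nonneg x)).tendsto_at hx)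

/-- The generator is well defined: its value is the unique mixed limit. -/
theorem generator_eq {d : ℕ} {S : ℝ≥0 → ((Eucl d →ᵇ ℝ) →ₗ[ℝ] (Eucl d →ᵇ ℝ))}
    {f g : Eucl d →ᵇ ℝ} (h : MixedTendstoZero (diffQuot S f) g) : generator S f = g := by
  have hf : ∃ g, MixedTendstoZero (diffQuot S f) g := ⟨g, h⟩
  have hgen : generator S f = hf.choose := dif_pos hf
  have hpos : ∀ n : ℕ, (0 : ℝ≥0) < 1 / ((n : ℝ≥0) + 1) := fun n => by positivity
  have hlim : Tendsto (fun n : ℕ => 1 / ((n : ℝ≥0) + 1)) atTop (𝓝 0) :=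
    tendsto_one_div_add_atTop_nhds_zero_nat
  rw [hgen]
  exact (hf.choose_spec _ hpos hlim).unique (h _ hpos hlim)

/-! ### Lévy triplets and the operator `⟨∇f, F⟩ + L_{(b,σ,ν)} f` -/

/-- A Lévy triplet: `b ∈ ℝᵈ`, a symmetric positive semidefinite `d × d` matrix `σ`, and a Lévy
measure `ν`. -/
structure LevyTriplet (d : ℕ) where
  b : Eucl d
  σ : Matrix (Fin d) (Fin d) ℝ
  posSemidef : σ.PosSemidef
  ν : Measure (Eucl d)
  levy_zero : ν {0} = 0
  levy_integrable : ∫⁻ y, ENNReal.ofReal (min 1 (‖y‖ ^ 2)) ∂ν < ⊤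

open Classical in
/-- The truncation function `h(y) = y 1_{[0,1]}(|y|)`. -/
def trunc {d : ℕ} (y : Eucl d) : Eucl d := if ‖y‖ ≤ 1 then y else 0

/-- The Lévy–Khintchine exponent of a Lévy triplet, w.r.t. the truncation function `trunc`. -/
def LevyTriplet.exponent {d : ℕ} (τ : LevyTriplet d) (ξ : Eucl d) : ℂ :=
  Complex.I * ((inner ℝ τ.b ξ : ℝ) : ℂ)
    - (1 / 2) * ((∑ i, ∑ j, ξ i * τ.σ i j * ξ j : ℝ) : ℂ)
    + ∫ y in {0}ᶜ, (Complex.exp (Complex.I * ((inner ℝ y ξ : ℝ) : ℂ)) - 1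
        - Complex.I * ((inner ℝ (trunc y) ξ : ℝ) : ℂ)) ∂τ.ν

/-- `f ∈ C_b^k(ℝᵈ)`: `f` is `k` times continuously differentiable and all its derivatives of order
at most `k` (including `f` itself) are bounded. -/
def MemCb {d : ℕ} (k : ℕ) (f : Eucl d → ℝ) : Prop :=
  ContDiff ℝ k f ∧ ∀ m ≤ k, ∃ C : ℝ, ∀ x, ‖iteratedFDeriv ℝ m f x‖ ≤ C

/-- The Hessian matrix `∇²f(x)`. -/
def hessian {d : ℕ} (f : Eucl d → ℝ) (x : Eucl d) : Matrix (Fin d) (Fin d) ℝ :=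
  Matrix.of fun i j =>
    fderiv ℝ (fderiv ℝ f) x (EuclideanSpace.single i 1) (EuclideanSpace.single j 1)

/-- The operator `L_{(b,σ,ν)}`. -/
def LevyTriplet.op {d : ℕ} (τ : LevyTriplet d) (f : Eucl d → ℝ) (x : Eucl d) : ℝ :=
  inner ℝ τ.b (gradient f x) + (1 / 2) * (τ.σ * hessian f x).trace
    + ∫ y in {0}ᶜ, (f (x + y) - f x - inner ℝ (gradient f x) (trunc y)) ∂τ.ν

/-- The operator `A_{F,(b,σ,ν)} f = ⟨∇f, F⟩ + L_{(b,σ,ν)} f`. -/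
def LevyTriplet.driftOp {d : ℕ} (τ : LevyTriplet d) (F : Eucl d → Eucl d) (f : Eucl d → ℝ)
    (x : Eucl d) : ℝ :=
  inner ℝ (gradient f x) (F x) + τ.op f x

/-! ### Lévy processes and the SDE `dX = F(X) dt + dY` -/

/-- Càdlàg paths: right-continuous on `[0, ∞)` with left limits in `(0, ∞)`
(the left-limit condition at `t = 0` is void). -/
def IsCadlag {d : ℕ} (y : ℝ≥0 → Eucl d) : Prop :=
  ∀ t, ContinuousWithinAt y (Set.Ici t) t ∧ ∃ l, Tendsto y (𝓝[<] t) (𝓝 l)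

/-- Lévy processes, with almost surely càdlàg paths. -/
structure IsLevyProcess {d : ℕ} {Ω : Type*} [MeasurableSpace Ω] (P : Measure Ω)
    (Y : ℝ≥0 → Ω → Eucl d) : Prop where
  measurable : ∀ t, Measurable (Y t)
  start_zero : ∀ᵐ ω ∂P, Y 0 ω = 0
  indep_increments : HasIndepIncrements Y P
  stationary_increments : ∀ s t,
    IdentDistrib (fun ω => Y (s + t) ω - Y s ω) (fun ω => Y t ω - Y 0 ω) P P
  stoch_continuous : ∀ t, TendstoInMeasure P Y (𝓝 t) (Y t)
  cadlag : ∀ᵐ ω ∂P, IsCadlag (fun t => Y t ω)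

/-- The process `Y` has Lévy triplet `τ` (Lévy–Khintchine):
`E[exp(i⟨Y_t, ξ⟩)] = exp(t ψ(ξ))`, where `ψ` is the exponent of `τ`. -/
def HasLevyTriplet {d : ℕ} {Ω : Type*} [MeasurableSpace Ω] (P : Measure Ω)
    (Y : ℝ≥0 → Ω → Eucl d) (τ : LevyTriplet d) : Prop :=
  ∀ (t : ℝ≥0) (ξ : Eucl d), charFun (P.map (Y t)) ξ = Complex.exp ((t : ℂ) * τ.exponent ξ)

/-- The σ-algebra `σ(Y_s : s ≤ t)`. -/
@[reducible]
def pastSigma {d : ℕ} {Ω : Type*} (Y : ℝ≥0 → Ω → Eucl d) (t : ℝ≥0) : MeasurableSpace Ω :=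
  ⨆ s : Set.Iic t, MeasurableSpace.comap (Y s) inferInstance

/-- `X` is a strong solution to `dX_t = F(X_t) dt + dY_t`, `X_0 = x`: it is adapted to the
`P`-completed filtration generated by `Y`, has almost surely càdlàg paths, and almost surely
`X_t = x + ∫_0^t F(X_s) ds + Y_t` for all `t ≥ 0`. -/
structure IsStrongSolution {d : ℕ} {Ω : Type*} [MeasurableSpace Ω] (P : Measure Ω)
    (Y : ℝ≥0 → Ω → Eucl d) (F : Eucl d → Eucl d) (x : Eucl d) (X : ℝ≥0 → Ω → Eucl d) : Prop where
  adapted : ∀ t, AEStronglyMeasurable[pastSigma Y t] (X t) P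
  cadlag : ∀ᵐ ω ∂P, IsCadlag (fun t => X t ω)
  equation : ∀ᵐ ω ∂P, ∀ t : ℝ≥0,
    X t ω = x + (∫ s in (0 : ℝ)..t, F (X s.toNNReal ω)) + Y t ω

end LevyDrift

end

noncomputable section

namespace LevyDrift

/-! ### Càdlàg paths -/

/-! The probabilistic input is a splitting scheme with step h: add the increment of Y, then make an
explicit Euler step for the drift. The noise enters through independent stationary increments only,
so the law of the scheme is given by iterates of one operator R_h (`stepOp`), and a Gronwall
argument shows pathwise convergence to X (`IsPathSolution.tendsto_scheme`). Hence E[g(X_{s+t})] is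
the limit of E[(R_{t/n}^n g)(X_s)]. This single limit gives the semigroup law (`transOp_add`)
without any joint measurability of the solution in time, path and starting point. Continuity of the
semigroup combines Lipschitz dependence on the starting point with stochastic continuity of Y.

No Itô formula is used for the generator. Once (R_h f - f)/h converges to Af boundedly and along
convergent points, telescoping over the steps gives T_t f - f = ∫_0^t T_s Af ds
(`transOp_sub_eq_integral`), and strong continuity differentiates this at 0. The quotient splits
into a drift part and a Lévy part. The drift part is the reason for taming F: a plain Euler step has
an error of order h|F|², unbounded in space. The tamed field F_h satisfies h|F_h|² ≤ 1 and is F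
times a factor in (0,1], so boundedness of ⟨∇f, F⟩ suffices (`exists_bound_driftQuot`).

The Lévy part, the convergence of E[f(x+Y_t) - f(x)]/t, uses characteristic functions alone
(`LevyTriplet.tendsto_op`). Write f(x+y) - f(x) = Df(x)[sin y] + ½ D²f(x)[sin y, sin y] + r(x,y),
with the sine taken componentwise. The integrals of sin y_i and sin y_i sin y_j are read off the
exponent. With w(y) = 1 - exp(-|y|²/2), the quotient r/w is bounded, jointly continuous and zero at
y = 0. Since w(y) is the standard Gaussian average of 1 - cos⟨y,ξ⟩, the characteristic function of
t⁻¹ w dP_{Y_t} is a Gaussian average of second differences of (φ_t - 1)/t, and this converges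
(`LevyTriplet.tendsto_charFun_rescaled`). The limit measure is wν plus an atom at 0, which r/w does
not see. -/

theorem IsCadlag.tendsto_of_le {d : ℕ} {y : ℝ≥0 → Eucl d} (hy : IsCadlag y) {ι : Type*}
    {l : Filter ι} {u : ι → ℝ≥0} {t : ℝ≥0} (hu : Tendsto u l (𝓝 t)) (hle : ∀ᶠ i in l, t ≤ u i) :
    Tendsto (fun i => y (u i)) l (𝓝 (y t)) :=
  (hy t).1.tendsto.comp (tendsto_nhdsWithin_iff.2 ⟨hu, hle⟩)

theorem le_ceil_div_mul (h : ℝ≥0) (hh : 0 < h) (t : ℝ≥0) : t ≤ (⌈t / h⌉₊ : ℝ≥0) * h := by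
  have := Nat.le_ceil (t / h)
  rwa [div_le_iff₀ hh] at this

theorem ceil_div_mul_le (h : ℝ≥0) (hh : 0 < h) (t : ℝ≥0) : (⌈t / h⌉₊ : ℝ≥0) * h ≤ t + h := by
  have h1 : (⌈t / h⌉₊ : ℝ≥0) ≤ t / h + 1 := (Nat.ceil_lt_add_one (zero_le (a := t / h))).le
  calc (⌈t / h⌉₊ : ℝ≥0) * h ≤ (t / h + 1) * h := by gcongr
    _ = t + h := by field_simp

theorem tendsto_ceil_div_mul {ι : Type*} {l : Filter ι} {h : ι → ℝ≥0} (hpos : ∀ᶠ i in l, 0 < h i)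
    (hh : Tendsto h l (𝓝 0)) (t : ℝ≥0) :
    Tendsto (fun i => (⌈t / h i⌉₊ : ℝ≥0) * h i) l (𝓝 t) := by
  refine tendsto_of_tendsto_of_tendsto_of_le_of_le' tendsto_const_nhds
    (h := fun i => t + h i) (by simpa using hh.const_add t) ?_ ?_
  · filter_upwards [hpos] with i hi using le_ceil_div_mul _ hi t
  · filter_upwards [hpos] with i hi using ceil_div_mul_le _ hi t

/-- Right continuity makes the path a pointwise limit of step functions that sample it at the next
grid point to the right. -/
theorem IsCadlag.measurable {d : ℕ} {y : ℝ≥0 → Eucl d} (hy : IsCadlag y) : Measurable y := by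
  have hpos : ∀ n : ℕ, (0 : ℝ≥0) < 1 / ((n : ℝ≥0) + 1) := fun n => by positivity
  have hlim : Tendsto (fun n : ℕ => 1 / ((n : ℝ≥0) + 1)) atTop (𝓝 0) :=
    tendsto_one_div_add_atTop_nhds_zero_nat
  refine measurable_of_tendsto_metrizable
    (f := fun (n : ℕ) (t : ℝ≥0) => y ((⌈t / (1 / ((n : ℝ≥0) + 1))⌉₊ : ℝ≥0) * (1 / ((n : ℝ≥0) + 1))))
    (fun n => ?_) (tendsto_pi_nhds.2 fun t => ?_)
  · have h1 : Measurable fun t : ℝ≥0 => ⌈t / (1 / ((n : ℝ≥0) + 1))⌉₊ := by fun_prop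
    exact (measurable_of_countable
      (fun k : ℕ => y ((k : ℝ≥0) * (1 / ((n : ℝ≥0) + 1))))).comp h1
  · exact hy.tendsto_of_le (tendsto_ceil_div_mul (.of_forall hpos) hlim t)
      (.of_forall fun n => le_ceil_div_mul _ (hpos n) t)

/-- One-sided limits bound the path near each point, and compactness of [0,T] makes the bound
global. -/
theorem IsCadlag.exists_bound {d : ℕ} {y : ℝ≥0 → Eucl d} (hy : IsCadlag y) (T : ℝ≥0) :
    ∃ M : ℝ, 0 ≤ M ∧ ∀ t ≤ T, ‖y t‖ ≤ M := by
  have key : ∃ M : ℝ, ∀ t ∈ Set.Icc 0 T, ‖y t‖ ≤ M := by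
    refine (isCompact_Icc (a := (0 : ℝ≥0)) (b := T)).induction_on
      (p := fun s => ∃ M : ℝ, ∀ t ∈ s, ‖y t‖ ≤ M) ⟨0, by simp⟩ ?_ ?_ ?_
    · rintro s t hst ⟨M, hM⟩
      exact ⟨M, fun u hu => hM u (hst hu)⟩
    · rintro s t ⟨M, hM⟩ ⟨M', hM'⟩
      refine ⟨max M M', ?_⟩
      rintro u (hu | hu)
      · exact (hM u hu).trans (le_max_left _ _)
      · exact (hM' u hu).trans (le_max_right _ _)
    · intro t _
      obtain ⟨hr, l, hl⟩ := hy t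
      have h1 : ∀ᶠ u in 𝓝[≥] t, ‖y u‖ ≤ ‖y t‖ + 1 :=
        hr.norm.eventually_le_const (by linarith)
      have h2 : ∀ᶠ u in 𝓝[<] t, ‖y u‖ ≤ ‖l‖ + 1 :=
        hl.norm.eventually_le_const (by linarith)
      refine ⟨{u | ‖y u‖ ≤ max (‖y t‖ + 1) (‖l‖ + 1)}, mem_nhdsWithin_of_mem_nhds ?_, _,
        fun u hu => hu⟩
      rw [← nhdsLT_sup_nhdsGE]
      refine mem_sup.2 ⟨?_, ?_⟩
      · filter_upwards [h2] with u hu using hu.trans (le_max_right _ _)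
      · filter_upwards [h1] with u hu using hu.trans (le_max_left _ _)
  obtain ⟨M, hM⟩ := key
  exact ⟨M, (norm_nonneg _).trans (hM 0 (by simp)), fun t ht => hM t ⟨zero_le, ht⟩⟩

theorem IsCadlag.intervalIntegrable_comp {d : ℕ} {y : ℝ≥0 → Eucl d} (hy : IsCadlag y)
    {G : Type*} [NormedAddCommGroup G] {F : Eucl d → G} (hF : Continuous F) (a b : ℝ) :
    IntervalIntegrable (fun s : ℝ => F (y s.toNNReal)) volume a b := by
  have hm : StronglyMeasurable (fun s : ℝ => F (y s.toNNReal)) :=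
    hF.comp_stronglyMeasurable (hy.measurable.comp measurable_real_toNNReal).stronglyMeasurable
  obtain ⟨M, -, hM⟩ := hy.exists_bound (max a b).toNNReal
  obtain ⟨C, hC⟩ := (isCompact_closedBall (0 : Eucl d) M).exists_bound_of_continuousOn
    hF.continuousOn
  refine intervalIntegrable_const (c := C) |>.mono_fun hm.aestronglyMeasurable ?_
  refine (ae_restrict_iff' measurableSet_uIoc).2 (.of_forall fun s hs => ?_)
  have h1 : s ≤ max a b := hs.2
  have := hC (y s.toNNReal) (by simpa using hM _ (Real.toNNReal_mono h1))
  exact this.trans (le_abs_self C)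

theorem IsCadlag.add_time {d : ℕ} {y : ℝ≥0 → Eucl d} (hy : IsCadlag y) (s : ℝ≥0) :
    IsCadlag (fun t => y (s + t)) := by
  intro t
  refine ⟨?_, ?_⟩
  · refine (hy (s + t)).1.comp (t := Set.Ici (s + t)) (by fun_prop) fun u hu => ?_
    simpa using hu
  · obtain ⟨l, hl⟩ := (hy (s + t)).2
    refine ⟨l, hl.comp (tendsto_nhdsWithin_iff.2 ⟨?_, ?_⟩)⟩
    · exact (Continuous.tendsto (by fun_prop) t).mono_left nhdsWithin_le_nhds
    · filter_upwards [self_mem_nhdsWithin] with u hu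
      simpa using hu

/-! ### Pathwise solutions -/

/-- `X` is a càdlàg solution to `X_t = x + ∫_0^t F(X_s) ds + y_t`. -/
structure IsPathSolution {d : ℕ} (F : Eucl d → Eucl d) (x : Eucl d) (y X : ℝ≥0 → Eucl d) :
    Prop where
  cadlag : IsCadlag X
  equation : ∀ t : ℝ≥0, X t = x + (∫ s in (0 : ℝ)..t, F (X s.toNNReal)) + y t

theorem IsPathSolution.sub_eq {d : ℕ} {F : Eucl d → Eucl d} (hF : Continuous F) {x : Eucl d}
    {y X : ℝ≥0 → Eucl d} (h : IsPathSolution F x y X) (s t : ℝ≥0) :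
    X t - X s = (∫ u in (s : ℝ)..t, F (X u.toNNReal)) + (y t - y s) := by
  have hi := fun a b => h.cadlag.intervalIntegrable_comp hF a b
  rw [h.equation t, h.equation s, ← intervalIntegral.integral_add_adjacent_intervals
    (hi 0 s) (hi s t)]
  abel

/-- The pathwise half of the Markov property: after time s only the state at s and later increments
of the noise matter. -/
theorem IsPathSolution.add_time {d : ℕ} {F : Eucl d → Eucl d} (hF : Continuous F) {x : Eucl d}
    {y X : ℝ≥0 → Eucl d} (h : IsPathSolution F x y X) (s : ℝ≥0) :
    IsPathSolution F (X s) (fun t => y (s + t) - y s) (fun t => X (s + t)) where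
  cadlag := h.cadlag.add_time s
  equation t := by
    have h1 := h.sub_eq hF s (s + t)
    have h2 : (∫ u in (s : ℝ)..(s + t : ℝ≥0), F (X u.toNNReal)) =
        ∫ u in (0 : ℝ)..t, F (X (s + u.toNNReal)) := by
      have := intervalIntegral.integral_comp_add_left
        (fun u : ℝ => F (X u.toNNReal)) (s : ℝ) (a := 0) (b := t)
      rw [add_zero] at this
      rw [NNReal.coe_add, ← this]
      refine intervalIntegral.integral_congr fun u hu => ?_
      have hu0 : 0 ≤ u := by simpa using hu.1
      rw [Real.toNNReal_add s.coe_nonneg hu0, Real.toNNReal_coe]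
    rw [h2] at h1
    rw [sub_eq_iff_eq_add.1 h1]
    abel

/-- The noise cancels in the difference, leaving a continuous integral `D`. Its integrand is only
right-continuous, so Gronwall's inequality is used in its right-derivative form. -/
theorem IsPathSolution.norm_sub_le {d : ℕ} {ω₀ : ℝ≥0} {F : Eucl d → Eucl d}
    (hF : LipschitzWith ω₀ F) {x x' : Eucl d} {y X X' : ℝ≥0 → Eucl d}
    (h : IsPathSolution F x y X) (h' : IsPathSolution F x' y X') (t : ℝ≥0) :
    ‖X t - X' t‖ ≤ ‖x - x'‖ * Real.exp (ω₀ * t) := by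
  have hi := fun a b => h.cadlag.intervalIntegrable_comp hF.continuous a b
  have hi' := fun a b => h'.cadlag.intervalIntegrable_comp hF.continuous a b
  have hii := fun a b => (hi a b).sub (hi' a b)
  set D : ℝ → Eucl d := fun t => (x - x') +
    ∫ s in (0 : ℝ)..t, (F (X s.toNNReal) - F (X' s.toNNReal)) with hD
  have hDX : ∀ r : ℝ, 0 ≤ r → D r = X r.toNNReal - X' r.toNNReal := by
    intro r hr
    rw [h.equation, h'.equation, hD]
    simp only
    rw [Real.coe_toNNReal r hr, intervalIntegral.integral_sub (hi 0 r) (hi' 0 r)]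
    abel
  have hcont : ContinuousOn D (Set.Icc 0 t) := by
    refine continuousOn_const.add ?_
    have := intervalIntegral.continuousOn_primitive_interval' (hii 0 t) (a := 0) (by simp)
    rwa [Set.uIcc_of_le t.coe_nonneg] at this
  have hright : ∀ {Z : ℝ≥0 → Eucl d}, IsCadlag Z → ∀ r : ℝ, 0 ≤ r →
      ContinuousWithinAt (fun s : ℝ => F (Z s.toNNReal)) (Set.Ici r) r := by
    intro Z hZ r hr
    refine hF.continuous.continuousAt.comp_continuousWithinAt ?_
    refine (hZ r.toNNReal).1.comp (t := Set.Ici r.toNNReal)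
      continuous_real_toNNReal.continuousWithinAt fun u hu => Real.toNNReal_mono hu
  have hderiv : ∀ r ∈ Set.Ico (0 : ℝ) t,
      HasDerivWithinAt D (F (X r.toNNReal) - F (X' r.toNNReal)) (Set.Ici r) r := by
    intro r hr
    refine HasDerivWithinAt.const_add _ ?_
    refine intervalIntegral.integral_hasDerivWithinAt_right (hii 0 r) (t := Set.Ioi r) ?_ ?_
    · refine StronglyMeasurable.stronglyMeasurableAtFilter ?_
      refine StronglyMeasurable.sub ?_ ?_
      · exact hF.continuous.comp_stronglyMeasurable
          (h.cadlag.measurable.comp measurable_real_toNNReal).stronglyMeasurable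
      · exact hF.continuous.comp_stronglyMeasurable
          (h'.cadlag.measurable.comp measurable_real_toNNReal).stronglyMeasurable
    · exact ((hright h.cadlag r hr.1).sub (hright h'.cadlag r hr.1)).mono Set.Ioi_subset_Ici_self
  have := norm_le_gronwallBound_of_norm_deriv_right_le (K := ω₀) (ε := 0) (δ := ‖x - x'‖)
    hcont hderiv (by simp [hD]) (fun r hr => by
      rw [hDX r hr.1, add_zero]
      exact hF.norm_sub_le _ _) t ⟨t.2, le_rfl⟩
  rwa [hDX t t.2, Real.toNNReal_coe, gronwallBound_ε0, sub_zero] at this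

/-! ### The tamed splitting scheme -/

/-- The vector field `F`, shortened so that its norm is at most `1 / √h`. -/
def tamed {d : ℕ} (h : ℝ≥0) (F : Eucl d → Eucl d) (v : Eucl d) : Eucl d :=
  (1 + √(h : ℝ) * ‖F v‖)⁻¹ • F v

/-- The purpose of the damping factor: the second-order error of an Euler step, of size h times the
squared norm of the field, stays bounded uniformly in space although F may grow linearly. -/
theorem sqrt_mul_norm_tamed_le {d : ℕ} (h : ℝ≥0) (F : Eucl d → Eucl d) (v : Eucl d) :
    √(h : ℝ) * ‖tamed h F v‖ ≤ 1 := by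
  rw [tamed, norm_smul, norm_inv, Real.norm_of_nonneg (by positivity), mul_left_comm,
    inv_mul_le_one₀ (by positivity)]
  linarith

theorem norm_sub_tamed_le {d : ℕ} (h : ℝ≥0) (F : Eucl d → Eucl d) (v : Eucl d) :
    ‖F v - tamed h F v‖ ≤ √(h : ℝ) * ‖F v‖ ^ 2 := by
  have hp : 0 < 1 + √(h : ℝ) * ‖F v‖ := by positivity
  have h1 : F v - tamed h F v =
      ((1 + √(h : ℝ) * ‖F v‖)⁻¹ * (√(h : ℝ) * ‖F v‖)) • F v := by
    have : (1 + √(h : ℝ) * ‖F v‖)⁻¹ * (√(h : ℝ) * ‖F v‖) = 1 - (1 + √(h : ℝ) * ‖F v‖)⁻¹ := by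
      field_simp; ring
    rw [this, tamed]
    module
  have h2 : (1 + √(h : ℝ) * ‖F v‖)⁻¹ ≤ 1 :=
    inv_le_one_of_one_le₀ (le_add_of_nonneg_right (by positivity))
  rw [h1, norm_smul, Real.norm_of_nonneg (by positivity)]
  calc (1 + √(h : ℝ) * ‖F v‖)⁻¹ * (√(h : ℝ) * ‖F v‖) * ‖F v‖
      ≤ 1 * (√(h : ℝ) * ‖F v‖) * ‖F v‖ := by gcongr
    _ = √(h : ℝ) * ‖F v‖ ^ 2 := by ring

/-- The Lipschitz constant must not depend on h. One ω₀ comes from the difference of the vectors,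
the other from the difference of the damping factors, where s‖b‖/(1 + s‖b‖) ≤ 1 absorbs the growth
of F. -/
theorem norm_tamed_sub_tamed_le {d : ℕ} {ω₀ : ℝ≥0} {F : Eucl d → Eucl d}
    (hF : LipschitzWith ω₀ F) (h : ℝ≥0) (v w : Eucl d) :
    ‖tamed h F v - tamed h F w‖ ≤ 2 * ω₀ * ‖v - w‖ := by
  set s := √(h : ℝ)
  have hs : 0 ≤ s := Real.sqrt_nonneg _
  set a := F v
  set b := F w
  have hp : 0 < 1 + s * ‖a‖ := by positivity
  have hq : 0 < 1 + s * ‖b‖ := by positivity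
  have hp1 : (1 + s * ‖a‖)⁻¹ ≤ 1 := inv_le_one_of_one_le₀ (le_add_of_nonneg_right (by positivity))
  have h1 : tamed h F v - tamed h F w = (1 + s * ‖a‖)⁻¹ • (a - b) +
      ((1 + s * ‖a‖)⁻¹ * (s * (‖b‖ - ‖a‖)) * (1 + s * ‖b‖)⁻¹) • b := by
    have : (1 + s * ‖a‖)⁻¹ * (s * (‖b‖ - ‖a‖)) * (1 + s * ‖b‖)⁻¹ =
      (1 + s * ‖a‖)⁻¹ - (1 + s * ‖b‖)⁻¹ := by
      field_simp; ring
    rw [this, tamed, tamed]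
    module
  have h2 : ‖a - b‖ ≤ ω₀ * ‖v - w‖ := hF.norm_sub_le v w
  have h3 : (1 + s * ‖b‖)⁻¹ * (s * ‖b‖) ≤ 1 := by
    rw [inv_mul_le_one₀ hq]; linarith
  have h4 : |‖b‖ - ‖a‖| ≤ ‖a - b‖ := by
    rw [← norm_sub_rev]; exact abs_norm_sub_norm_le b a
  calc ‖tamed h F v - tamed h F w‖
      ≤ (1 + s * ‖a‖)⁻¹ * ‖a - b‖ +
        ((1 + s * ‖a‖)⁻¹ * (s * |‖b‖ - ‖a‖|) * (1 + s * ‖b‖)⁻¹) * ‖b‖ := by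
        rw [h1]
        refine (norm_add_le _ _).trans (le_of_eq ?_)
        simp only [norm_smul, norm_mul, norm_inv, Real.norm_eq_abs, abs_of_pos hp, abs_of_pos hq,
          abs_of_nonneg hs]
    _ = (1 + s * ‖a‖)⁻¹ * ‖a - b‖ +
        (1 + s * ‖a‖)⁻¹ * (|‖b‖ - ‖a‖| * ((1 + s * ‖b‖)⁻¹ * (s * ‖b‖))) := by ring
    _ ≤ 1 * ‖a - b‖ + 1 * (‖a - b‖ * 1) := by gcongr
    _ ≤ 2 * ω₀ * ‖v - w‖ := by linarith

theorem continuous_tamed {d : ℕ} {F : Eucl d → Eucl d} (hF : Continuous F) (h : ℝ≥0) :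
    Continuous (tamed h F) := by
  unfold tamed
  refine Continuous.smul (f := fun v => (1 + √(h : ℝ) * ‖F v‖)⁻¹)
    (Continuous.inv₀ (by fun_prop) fun v => ?_) hF
  positivity

/-- One drift step of the scheme. -/
def driftStep {d : ℕ} (h : ℝ≥0) (F : Eucl d → Eucl d) (v : Eucl d) : Eucl d :=
  v + (h : ℝ) • tamed h F v

theorem continuous_driftStep {d : ℕ} {F : Eucl d → Eucl d} (hF : Continuous F) (h : ℝ≥0) :
    Continuous (driftStep h F) :=
  continuous_id.add ((continuous_tamed hF h).const_smul (h : ℝ))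

/-- The splitting scheme with step size `h` for the equation driven by `y`, started in `v`. -/
def scheme {d : ℕ} (h : ℝ≥0) (F : Eucl d → Eucl d) (y : ℝ≥0 → Eucl d) (v : Eucl d) : ℕ → Eucl d
  | 0 => v
  | k + 1 => driftStep h F (scheme h F y v k + (y (↑(k + 1) * h) - y (k * h)))

theorem IsCadlag.intervalIntegrable_norm_sub_ceil {d : ℕ} {X : ℝ≥0 → Eucl d} (hX : IsCadlag X)
    (h : ℝ≥0) (hh : 0 < h) (a b : ℝ) :
    IntervalIntegrable (fun s : ℝ => ‖X s.toNNReal - X (⌈s.toNNReal / h⌉₊ * h)‖) volume a b := by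
  have hm : Measurable (fun s : ℝ => ‖X s.toNNReal - X (⌈s.toNNReal / h⌉₊ * h)‖) := by
    have h1 := hX.measurable
    have h2 : Measurable fun s : ℝ => X (⌈s.toNNReal / h⌉₊ * h) := by
      have : Measurable fun s : ℝ => ⌈s.toNNReal / h⌉₊ := by fun_prop
      exact (measurable_of_countable (fun k : ℕ => X (k * h))).comp this
    fun_prop
  obtain ⟨M, hM0, hM⟩ := hX.exists_bound ((max a b).toNNReal + h)
  refine intervalIntegrable_const (c := M + M) |>.mono_fun hm.aestronglyMeasurable ?_
  refine (ae_restrict_iff' measurableSet_uIoc).2 (.of_forall fun s hs => ?_)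
  have h1 : s.toNNReal ≤ (max a b).toNNReal := Real.toNNReal_mono hs.2
  simp only
  rw [norm_norm, Real.norm_of_nonneg (by positivity)]
  refine (norm_sub_le _ _).trans (add_le_add (hM _ (h1.trans le_self_add)) (hM _ ?_))
  exact (ceil_div_mul_le h hh _).trans (by gcongr)

/-- Grid points are rounded up, so right continuity gives pointwise convergence at every s, jump
times included; local boundedness gives domination. -/
theorem IsCadlag.tendsto_integral_norm_sub_ceil {d : ℕ} {X : ℝ≥0 → Eucl d} (hX : IsCadlag X)
    {h : ℕ → ℝ≥0} (hpos : ∀ n, 0 < h n) (hh : Tendsto h atTop (𝓝 0)) (T : ℝ≥0) :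
    Tendsto (fun n => ∫ s in (0 : ℝ)..T, ‖X s.toNNReal - X (⌈s.toNNReal / h n⌉₊ * h n)‖)
      atTop (𝓝 0) := by
  -- Rounding up may overshoot T by one step, which is eventually at most 1.
  obtain ⟨M, hM0, hM⟩ := hX.exists_bound (T + 1)
  have h1 := intervalIntegral.tendsto_integral_filter_of_dominated_convergence
    (μ := volume) (a := 0) (b := T) (l := atTop) (f := fun _ => (0 : ℝ))
    (F := fun n (s : ℝ) => ‖X s.toNNReal - X (⌈s.toNNReal / h n⌉₊ * h n)‖) (fun _ => M + M)
    (.of_forall fun n => ((hX.intervalIntegrable_norm_sub_ceil (h n) (hpos n) 0 T).def'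
      ).aestronglyMeasurable) ?_ intervalIntegrable_const ?_
  · simpa using h1
  · filter_upwards [hh.eventually_le_const (by norm_num : (0 : ℝ≥0) < 1)] with n hn
    refine .of_forall fun s hs => ?_
    rw [Set.uIoc_of_le T.coe_nonneg] at hs
    have h1 : s.toNNReal ≤ T := by simpa using Real.toNNReal_mono hs.2
    rw [norm_norm]
    refine (norm_sub_le _ _).trans (add_le_add (hM _ (h1.trans le_self_add)) (hM _ ?_))
    exact (ceil_div_mul_le _ (hpos n) _).trans (by gcongr)
  · refine .of_forall fun s _ => ?_
    have := (hX.tendsto_of_le (tendsto_ceil_div_mul (.of_forall hpos) hh s.toNNReal)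
      (.of_forall fun n => le_ceil_div_mul _ (hpos n) _)).const_sub (X s.toNNReal)
    simpa using this.norm

/-- The one-step error has three sources: propagation of the old error, taming, and freezing the
drift at the right endpoint of the step. The last is measured by the distance of the path to its
value at the next grid point. -/
theorem IsPathSolution.norm_sub_scheme_succ_le {d : ℕ} {ω₀ : ℝ≥0} {F : Eucl d → Eucl d}
    (hF : LipschitzWith ω₀ F) {x : Eucl d} {y X : ℝ≥0 → Eucl d} (hX : IsPathSolution F x y X)
    {h : ℝ≥0} (hh : 0 < h) {M : ℝ} (v : Eucl d) (k : ℕ)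
    (hM : ∀ t ≤ ↑(k + 1) * h, ‖F (X t)‖ ≤ M) :
    ‖X (↑(k + 1) * h) - scheme h F y v (k + 1)‖ ≤
      (1 + 2 * ω₀ * h) * ‖X (k * h) - scheme h F y v k‖ +
        (h * (√(h : ℝ) * M ^ 2 + 2 * ω₀ * h * M) +
        2 * ω₀ * ∫ s in ((k * h : ℝ≥0) : ℝ)..(↑(k + 1) * h : ℝ≥0),
          ‖X s.toNNReal - X (⌈s.toNNReal / h⌉₊ * h)‖) := by
  set a : ℝ≥0 := k * h with ha
  set b : ℝ≥0 := ↑(k + 1) * h with hb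
  have hba : b = a + h := by rw [ha, hb]; push_cast; ring
  have hab : (a : ℝ) ≤ b := by rw [hba]; push_cast; linarith [h.coe_nonneg]
  have hlen : (b : ℝ) - a = h := by rw [hba]; push_cast; ring
  set e := X a - scheme h F y v k with he
  -- The drift is evaluated at `w`, after the noise of the step has been added. It is therefore
  -- comparable with `X b` rather than `X a`, even if `y` jumps inside the step.
  set w := scheme h F y v k + (y b - y a) with hw
  have hi := fun a b => hX.cadlag.intervalIntegrable_comp hF.continuous a b
  have hic := fun a b => hX.cadlag.intervalIntegrable_norm_sub_ceil h hh a b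
  have hXba := hX.sub_eq hF.continuous a b
  have hIM : ‖∫ u in (a : ℝ)..b, F (X u.toNNReal)‖ ≤ M * h := by
    have := intervalIntegral.norm_integral_le_of_norm_le_const (a := (a : ℝ)) (b := b) (C := M)
      (f := fun u => F (X u.toNNReal)) fun u hu => by
        rw [Set.uIoc_of_le hab] at hu
        exact hM _ (by simpa using Real.toNNReal_mono hu.2)
    rwa [hlen, abs_of_nonneg h.coe_nonneg] at this
  have hXw : ‖X b - w‖ ≤ ‖e‖ + M * h := by
    have : X b - w = e + ∫ u in (a : ℝ)..b, F (X u.toNNReal) := by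
      rw [hw, he, sub_eq_iff_eq_add.1 hXba]; abel
    rw [this]
    exact (norm_add_le _ _).trans (by gcongr)
  have hmain : X b - scheme h F y v (k + 1) =
      e + ∫ s in (a : ℝ)..b, (F (X s.toNNReal) - tamed h F w) := by
    rw [intervalIntegral.integral_sub (hi a b) intervalIntegrable_const,
      intervalIntegral.integral_const, hlen, scheme, driftStep, ← hw]
    rw [hw, he, sub_eq_iff_eq_add.1 hXba]; abel
  rw [hmain]
  have hint : ‖∫ s in (a : ℝ)..b, (F (X s.toNNReal) - tamed h F w)‖ ≤
      ∫ s in (a : ℝ)..b, (√(h : ℝ) * M ^ 2 + 2 * ω₀ * (‖e‖ + M * h) +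
        2 * ω₀ * ‖X s.toNNReal - X (⌈s.toNNReal / h⌉₊ * h)‖) := by
    refine intervalIntegral.norm_integral_le_of_norm_le hab (.of_forall fun s hs => ?_)
      (intervalIntegrable_const.add ((hic a b).const_mul _))
    have hs1 : s.toNNReal ≤ b := by simpa using Real.toNNReal_mono hs.2
    have hs2 : a < s.toNNReal := by rw [Real.lt_toNNReal_iff_coe_lt]; exact hs.1
    have hceil : ⌈s.toNNReal / h⌉₊ = k + 1 := by
      rw [Nat.ceil_eq_iff (by omega)]
      constructor
      · rw [lt_div_iff₀ hh]; simpa using hs2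
      · rw [div_le_iff₀ hh]; exact hs1
    rw [hceil, ← hb]
    have h1 := norm_sub_tamed_le h F (X s.toNNReal)
    have h2 := norm_tamed_sub_tamed_le hF h (X s.toNNReal) w
    have h3 : √(h : ℝ) * ‖F (X s.toNNReal)‖ ^ 2 ≤ √(h : ℝ) * M ^ 2 := by
      gcongr; exact hM _ hs1
    have h4 : ‖X s.toNNReal - w‖ ≤ ‖X s.toNNReal - X b‖ + (‖e‖ + M * h) :=
      (norm_sub_le_norm_sub_add_norm_sub _ (X b) _).trans (by gcongr)
    calc ‖F (X s.toNNReal) - tamed h F w‖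
        ≤ ‖F (X s.toNNReal) - tamed h F (X s.toNNReal)‖ +
          ‖tamed h F (X s.toNNReal) - tamed h F w‖ := norm_sub_le_norm_sub_add_norm_sub _ _ _
      _ ≤ √(h : ℝ) * M ^ 2 + 2 * ω₀ * (‖X s.toNNReal - X b‖ + (‖e‖ + M * h)) := by
          refine add_le_add (h1.trans h3) (h2.trans ?_); gcongr
      _ = _ := by ring
  rw [intervalIntegral.integral_add intervalIntegrable_const ((hic a b).const_mul _),
    intervalIntegral.integral_const, intervalIntegral.integral_const_mul, hlen, smul_eq_mul] at hint
  refine (norm_add_le _ _).trans ((add_le_add_right hint _).trans (le_of_eq ?_))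
  ring

/-- Discrete Gronwall: the factor 1 + c of one step is at most exp c, and the local errors add up to
a single integral. The equation alone gives X 0 = x + y 0, hence the separate assumption `hX0`. -/
theorem IsPathSolution.norm_sub_scheme_le {d : ℕ} {ω₀ : ℝ≥0} {F : Eucl d → Eucl d}
    (hF : LipschitzWith ω₀ F) {x : Eucl d} {y X : ℝ≥0 → Eucl d} (hX : IsPathSolution F x y X)
    (hX0 : X 0 = x) {h : ℝ≥0} (hh : 0 < h) {M : ℝ} (hM0 : 0 ≤ M) (k : ℕ)
    (hM : ∀ t ≤ k * h, ‖F (X t)‖ ≤ M) :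
    ‖X (k * h) - scheme h F y x k‖ ≤
      (k * h * (√(h : ℝ) * M ^ 2 + 2 * ω₀ * h * M) +
        2 * ω₀ * ∫ s in (0 : ℝ)..(k * h : ℝ≥0),
          ‖X s.toNNReal - X (⌈s.toNNReal / h⌉₊ * h)‖) * Real.exp (2 * ω₀ * h * k) := by
  have hic := fun a b => hX.cadlag.intervalIntegrable_norm_sub_ceil h hh a b
  induction k with
  | zero => simp [scheme, hX0]
  | succ k ih =>
    have hle : (k : ℝ≥0) * h ≤ ↑(k + 1) * h := by gcongr; simp
    have hab : ((k * h : ℝ≥0) : ℝ) ≤ (↑(k + 1) * h : ℝ≥0) := by exact_mod_cast hle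
    have h1 := hX.norm_sub_scheme_succ_le hF hh x k hM
    have h2 := ih fun t ht => hM t (ht.trans hle)
    rw [← intervalIntegral.integral_add_adjacent_intervals (hic 0 (k * h : ℝ≥0)) (hic _ _)]
    set I := ∫ s in ((k * h : ℝ≥0) : ℝ)..(↑(k + 1) * h : ℝ≥0),
          ‖X s.toNNReal - X (⌈s.toNNReal / h⌉₊ * h)‖ with hI
    set J := ∫ s in (0 : ℝ)..(k * h : ℝ≥0), ‖X s.toNNReal - X (⌈s.toNNReal / h⌉₊ * h)‖ with hJ
    have hI0 : 0 ≤ I := intervalIntegral.integral_nonneg hab fun _ _ => norm_nonneg _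
    have hJ0 : 0 ≤ J := intervalIntegral.integral_nonneg NNReal.zero_le_coe
      fun _ _ => norm_nonneg _
    set c : ℝ := 2 * ω₀ * h
    have hc : 0 ≤ c := by positivity
    have hexp : Real.exp (c * ↑(k + 1)) = Real.exp c * Real.exp (c * k) := by
      rw [← Real.exp_add]; push_cast; ring_nf
    have h3 : 1 + c ≤ Real.exp c := by linarith [Real.add_one_le_exp c]
    have h4 : 1 ≤ Real.exp (c * ↑(k + 1)) := Real.one_le_exp (by positivity)
    set q : ℝ := √(h : ℝ) * M ^ 2 + c * M
    have hq : 0 ≤ q := by positivity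
    calc _ ≤ (1 + c) * ‖X (k * h) - scheme h F y x k‖ + (h * q + 2 * ω₀ * I) := h1
      _ ≤ Real.exp c * ((k * h * q + 2 * ω₀ * J) * Real.exp (c * k)) +
          (h * q + 2 * ω₀ * I) * Real.exp (c * ↑(k + 1)) := by
        refine add_le_add (mul_le_mul h3 h2 (norm_nonneg _) (Real.exp_nonneg _)) ?_
        exact le_mul_of_one_le_right (by positivity) h4
      _ = _ := by rw [hexp]; push_cast; ring

/-- Any number of steps `k n ≤ n + 1` is allowed: the semigroup law needs only the terminal time,
but Dynkin's formula needs all intermediate ones. -/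
theorem IsPathSolution.tendsto_scheme {d : ℕ} {ω₀ : ℝ≥0} {F : Eucl d → Eucl d}
    (hF : LipschitzWith ω₀ F) {x : Eucl d} {y X : ℝ≥0 → Eucl d} (hX : IsPathSolution F x y X)
    (hX0 : X 0 = x) {T : ℝ≥0} (hT : 0 < T) {k : ℕ → ℕ} (hk : ∀ n, k n ≤ n + 1) :
    Tendsto (fun n : ℕ => X (k n * (T / ↑(n + 1))) - scheme (T / ↑(n + 1)) F y x (k n)) atTop
      (𝓝 0) := by
  set h : ℕ → ℝ≥0 := fun n => T / ↑(n + 1) with hh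
  have hpos : ∀ n, 0 < h n := fun n => by simp only [hh]; positivity
  have hlim : Tendsto h atTop (𝓝 0) := by
    have h1 : Tendsto (fun n : ℕ => 1 / ((n : ℝ≥0) + 1)) atTop (𝓝 0) :=
      tendsto_one_div_add_atTop_nhds_zero_nat
    have := h1.const_mul T
    simpa [hh, div_eq_mul_inv] using this
  have hkT : ∀ n, k n * h n ≤ T := fun n => by
    calc k n * h n ≤ ↑(n + 1) * h n := by gcongr; exact hk n
      _ = T := by simp only [hh]; field_simp
  obtain ⟨M', hM0', hM'⟩ := hX.cadlag.exists_bound T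
  obtain ⟨C, hC⟩ := (isCompact_closedBall (0 : Eucl d) M').exists_bound_of_continuousOn
    hF.continuous.continuousOn
  set M := |C|
  have hM : ∀ t ≤ T, ‖F (X t)‖ ≤ M := fun t ht =>
    (hC _ (by simpa using hM' t ht)).trans (le_abs_self C)
  have hM0 : 0 ≤ M := abs_nonneg C
  have hbound : ∀ n, ‖X (k n * h n) - scheme (h n) F y x (k n)‖ ≤
      (T * (√(h n : ℝ) * M ^ 2 + 2 * ω₀ * h n * M) +
        2 * ω₀ * ∫ s in (0 : ℝ)..T, ‖X s.toNNReal - X (⌈s.toNNReal / h n⌉₊ * h n)‖) *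
        Real.exp (2 * ω₀ * T) := by
    intro n
    refine (hX.norm_sub_scheme_le hF hX0 (hpos n) hM0 (k n)
      fun t ht => hM t (ht.trans (hkT n))).trans ?_
    have hk' : (k n : ℝ) * h n ≤ T := by exact_mod_cast hkT n
    have hexp : 2 * (ω₀ : ℝ) * h n * k n ≤ 2 * ω₀ * T := by
      rw [mul_assoc (2 * (ω₀ : ℝ)), mul_comm (h n : ℝ)]; gcongr
    have hicc := fun a b => hX.cadlag.intervalIntegrable_norm_sub_ceil (h n) (hpos n) a b
    have hint : ∫ s in (0 : ℝ)..(k n * h n : ℝ≥0),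
        ‖X s.toNNReal - X (⌈s.toNNReal / h n⌉₊ * h n)‖ ≤
        ∫ s in (0 : ℝ)..T, ‖X s.toNNReal - X (⌈s.toNNReal / h n⌉₊ * h n)‖ := by
      refine intervalIntegral.integral_mono_interval le_rfl NNReal.zero_le_coe
        (by exact_mod_cast hkT n) (.of_forall fun _ => norm_nonneg _) (hicc _ _)
    have hJ0 : 0 ≤ ∫ s in (0 : ℝ)..(k n * h n : ℝ≥0),
        ‖X s.toNNReal - X (⌈s.toNNReal / h n⌉₊ * h n)‖ :=
      intervalIntegral.integral_nonneg NNReal.zero_le_coe fun _ _ => norm_nonneg _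
    refine mul_le_mul (add_le_add ?_ ?_) (Real.exp_le_exp.2 hexp) (Real.exp_nonneg _) ?_
    · exact mul_le_mul_of_nonneg_right hk' (by positivity)
    · exact mul_le_mul_of_nonneg_left hint (by positivity)
    · exact add_nonneg (by positivity) (mul_nonneg (by positivity) (hJ0.trans hint))
  refine squeeze_zero_norm hbound ?_
  have h1 : Tendsto (fun n => (h n : ℝ)) atTop (𝓝 0) := by
    simpa using (NNReal.tendsto_coe.2 hlim)
  have h2 : Tendsto (fun n => √(h n : ℝ)) atTop (𝓝 0) := by
    simpa [Function.comp_def] using (Real.continuous_sqrt.tendsto 0).comp h1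
  have h3 := hX.cadlag.tendsto_integral_norm_sub_ceil hpos hlim T
  have := ((((h2.mul_const (M ^ 2)).add ((h1.const_mul (2 * (ω₀ : ℝ))).mul_const M)).const_mul
    (T : ℝ)).add (h3.const_mul (2 * (ω₀ : ℝ)))).mul_const (Real.exp (2 * ω₀ * T))
  simpa using this

/-! ### Independence of increments from the past -/

theorem pastSigma_eq_comap {d : ℕ} {Ω : Type*} (Y : ℝ≥0 → Ω → Eucl d) (t : ℝ≥0) :
    pastSigma Y t = MeasurableSpace.comap (fun ω (s : Set.Iic t) => Y s ω) MeasurableSpace.pi := by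
  simp only [pastSigma, MeasurableSpace.pi, MeasurableSpace.comap_iSup,
    MeasurableSpace.comap_comp, Function.comp_def]

theorem pastSigma_mono {d : ℕ} {Ω : Type*} (Y : ℝ≥0 → Ω → Eucl d) {s t : ℝ≥0} (hst : s ≤ t) :
    pastSigma Y s ≤ pastSigma Y t :=
  iSup_le fun u => le_iSup (fun v : Set.Iic t => MeasurableSpace.comap (Y v) inferInstance)
    ⟨u, u.2.trans hst⟩

theorem measurable_pastSigma {d : ℕ} {Ω : Type*} (Y : ℝ≥0 → Ω → Eucl d) {s t : ℝ≥0} (hst : s ≤ t) :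
    Measurable[pastSigma Y t] (Y s) :=
  Measurable.of_comap_le
    (le_iSup (fun v : Set.Iic t => MeasurableSpace.comap (Y v) inferInstance) ⟨s, hst⟩)

section LevyIncrements

variable {d : ℕ} {Ω : Type*} [MeasurableSpace Ω] {P : Measure Ω} {Y : ℝ≥0 → Ω → Eucl d}

theorem IsLevyProcess.pastSigma_le (hY : IsLevyProcess P Y) (t : ℝ≥0) :
    pastSigma Y t ≤ ‹MeasurableSpace Ω› :=
  iSup_le fun s => (hY.measurable s).comap_le

/-- After sorting the times, each Y_i is a sum of consecutive increments starting from Y_0 = 0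
almost surely, and all of these increments precede r. -/
theorem IsLevyProcess.indepFun_finset_increment [IsProbabilityMeasure P]
    (hY : IsLevyProcess P Y) {r t : ℝ≥0} (hrt : r ≤ t) (I : Finset (Set.Iic r)) :
    IndepFun (fun ω (i : I) => Y i ω) (fun ω => Y t ω - Y r ω) P := by
  classical
  set N := I.card with hN
  set e : Fin N ↪o Set.Iic r := I.orderEmbOfFin rfl with he
  -- The grid is 0, then the N sorted times, then r, then t for ever. Increments 0 to N lie before
  -- r, and increment N + 1 is Y_t - Y_r.
  set τ : ℕ → ℝ≥0 := fun k => if k = 0 then 0 else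
    if h : k - 1 < N then e ⟨k - 1, h⟩ else if k = N + 1 then r else t with hτ
  have hτr : τ (N + 1) = r := by simp [hτ]
  have hτt : τ (N + 2) = t := by simp [hτ]
  have hτe : ∀ i : Fin N, τ (i + 1) = e i := fun i => by simp [hτ]
  have hmono : Monotone τ := by
    refine monotone_nat_of_le_succ fun k => ?_
    rcases Nat.eq_zero_or_pos k with rfl | hk
    · simp [hτ]
    · by_cases h1 : k < N
      · have h2 : k - 1 < N := by omega
        simp only [hτ, hk.ne', if_false, Nat.add_one_ne_zero, Nat.add_sub_cancel, dif_pos h1,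
          dif_pos h2]
        exact e.monotone (Fin.mk_le_mk.2 (by omega))
      · rcases eq_or_ne k N with rfl | h3
        · rw [hτr]
          have h2 : N - 1 < N := by omega
          simp only [hτ, hk.ne', if_false, dif_pos h2]
          exact (e ⟨N - 1, h2⟩).2
        · rcases eq_or_ne k (N + 1) with rfl | h4
          · rw [hτr, hτt]; exact hrt
          · have h5 : ¬ (k - 1 < N) := by omega
            simp [hτ, hk.ne', h5, h4, h1, h3]
  have hind := (hY.indep_increments.nat hmono).indepFun_finset (Finset.range (N + 1)) {N + 1}
    (by simp) (fun i => (hY.measurable _).sub (hY.measurable _))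
  have hidx : ∀ i : I, ∃ k : Fin N, e k = i := fun i => by
    have : (i : Set.Iic r) ∈ Set.range e := by rw [he, Finset.range_orderEmbOfFin]; exact i.2
    exact this
  choose κ hκ using hidx
  have hψ : Measurable fun z : ({N + 1} : Finset ℕ) → Eucl d => z ⟨N + 1, by simp⟩ :=
    measurable_pi_apply _
  have hcomp := hind.comp
    (φ := fun (z : Finset.range (N + 1) → Eucl d) (i : I) =>
      ∑ j : Fin (κ i + 1), z ⟨j, Finset.mem_range.2 (by have := (κ i).2; have := j.2; omega)⟩)
    (by fun_prop) hψ
  refine hcomp.congr ?_ (.of_forall fun ω => ?_)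
  · filter_upwards [hY.start_zero] with ω hω
    funext i
    simp only [Function.comp_apply]
    rw [Fin.sum_univ_eq_sum_range (fun j => Y (τ (j + 1)) ω - Y (τ j) ω) (κ i + 1),
      Finset.sum_range_sub (fun j => Y (τ j) ω), hτe, hκ]
    simp [hτ, hω]
  · simp only [Function.comp_apply]
    rw [hτr, hτt]

/-- Finite-dimensional independence extends to the whole past. The completion costs nothing, because
independence is unaffected by changes on null sets. -/
theorem IsLevyProcess.indep_pastSigma [IsProbabilityMeasure P] (hY : IsLevyProcess P Y)
    {r t : ℝ≥0} (hrt : r ≤ t) {V : Ω → Eucl d} (hV : AEStronglyMeasurable[pastSigma Y r] V P) :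
    IndepFun V (fun ω => Y t ω - Y r ω) P := by
  have h1 : IndepFun (fun ω (s : Set.Iic r) => Y s ω) (fun ω => Y t ω - Y r ω) P :=
    IndepFun.process_indepFun (fun i => hY.measurable i)
      ((hY.measurable t).sub (hY.measurable r)) (hY.indepFun_finset_increment hrt)
  rw [IndepFun_iff_Indep, ← pastSigma_eq_comap] at h1
  obtain ⟨V', hV', hVV'⟩ := hV
  refine IndepFun.congr ?_ hVV'.symm (ae_eq_refl _)
  rw [IndepFun_iff_Indep]
  exact indep_of_indep_of_le_left h1 hV'.measurable.comap_le

theorem IsLevyProcess.map_increment (hY : IsLevyProcess P Y) (s h : ℝ≥0) :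
    P.map (fun ω => Y (s + h) ω - Y s ω) = P.map (Y h) := by
  rw [(hY.stationary_increments s h).map_eq]
  refine Measure.map_congr ?_
  filter_upwards [hY.start_zero] with ω hω
  simp [hω]

theorem IsLevyProcess.integral_add_increment [IsProbabilityMeasure P] (hY : IsLevyProcess P Y)
    (r h : ℝ≥0) {V : Ω → Eucl d} (hV : AEStronglyMeasurable[pastSigma Y r] V P)
    (g : Eucl d →ᵇ ℝ) :
    ∫ ω, g (V ω + (Y (r + h) ω - Y r ω)) ∂P = ∫ ω, ∫ ω', g (V ω + Y h ω') ∂P ∂P := by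
  have hV0 : AEMeasurable V P := (hV.mono (hY.pastSigma_le r)).aemeasurable
  have hD : Measurable fun ω => Y (r + h) ω - Y r ω :=
    (hY.measurable (r + h)).sub (hY.measurable r)
  have hind := hY.indep_pastSigma (le_self_add : r ≤ r + h) hV
  have hprod := (indepFun_iff_map_prod_eq_prod_map_map hV0 hD.aemeasurable).1 hind
  have hp1 : IsProbabilityMeasure (P.map V) := Measure.isProbabilityMeasure_map hV0
  have hp2 : IsProbabilityMeasure (P.map (Y h)) :=
    Measure.isProbabilityMeasure_map (hY.measurable h).aemeasurable
  have hg : Continuous fun p : Eucl d × Eucl d => g (p.1 + p.2) := by fun_prop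
  have h1 : ∫ ω, g (V ω + (Y (r + h) ω - Y r ω)) ∂P =
      ∫ p, g (p.1 + p.2) ∂(P.map fun ω => (V ω, Y (r + h) ω - Y r ω)) := by
    rw [integral_map (hV0.prodMk hD.aemeasurable) hg.aestronglyMeasurable]
  rw [h1, hprod, hY.map_increment, integral_prod]
  · rw [integral_map hV0]
    · refine integral_congr_ae (.of_forall fun ω => ?_)
      simp only
      rw [integral_map (hY.measurable h).aemeasurable]
      exact (Continuous.aestronglyMeasurable (by fun_prop))
    · exact (hg.stronglyMeasurable.integral_prod_right' (ν := P.map (Y h))).aestronglyMeasurable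
  · refine Integrable.of_bound hg.aestronglyMeasurable ‖g‖ (.of_forall fun p => g.norm_coe_le_norm _)

theorem aestronglyMeasurable_scheme {F : Eucl d → Eucl d} (hF : Continuous F) (h s : ℝ≥0)
    {V : Ω → Eucl d} (hV : AEStronglyMeasurable[pastSigma Y s] V P) (k : ℕ) :
    AEStronglyMeasurable[pastSigma Y (s + k * h)]
      (fun ω => scheme h F (fun t => Y (s + t) ω - Y s ω) (V ω) k) P := by
  induction k with
  | zero =>
    rw [Nat.cast_zero, zero_mul, add_zero]
    exact hV
  | succ k ih =>
    have hle : s + k * h ≤ s + ↑(k + 1) * h := by gcongr; simp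
    have hms : ∀ u ≤ s + ↑(k + 1) * h,
        AEStronglyMeasurable[pastSigma Y (s + ↑(k + 1) * h)] (Y u) P := fun u hu =>
      (Measurable.stronglyMeasurable (measurable_pastSigma Y hu)).aestronglyMeasurable
    have h1 := hms (s + ↑(k + 1) * h) le_rfl
    have h2 := hms (s + k * h) hle
    have h3 := hms s le_self_add
    exact (continuous_driftStep hF h).comp_aestronglyMeasurable
      ((ih.mono (pastSigma_mono Y hle)).add ((h1.sub h3).sub (h2.sub h3)))

end LevyIncrements

/-! ### Averaging operators -/

/-- The operator `f ↦ E[f(Φ_x)]` for a random field `Φ` that is sequentially continuous in `x`. -/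
def averageOp {d : ℕ} {Ω : Type*} [MeasurableSpace Ω] (P : Measure Ω) [IsProbabilityMeasure P]
    (Φ : Eucl d → Ω → Eucl d) (hm : ∀ x, AEStronglyMeasurable (Φ x) P)
    (hc : ∀ (x : ℕ → Eucl d) (x₀ : Eucl d), Tendsto x atTop (𝓝 x₀) →
      ∀ᵐ ω ∂P, Tendsto (fun n => Φ (x n) ω) atTop (𝓝 (Φ x₀ ω))) :
    (Eucl d →ᵇ ℝ) →ₗ[ℝ] (Eucl d →ᵇ ℝ) where
  toFun f := BoundedContinuousFunction.ofNormedAddCommGroup (fun x => ∫ ω, f (Φ x ω) ∂P)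
    -- Sequential continuity lets the exceptional null set depend on the sequence; solutions with
    -- different starting points come with different null sets.
    (continuous_iff_seqContinuous.2 fun x x₀ hx => by
      refine tendsto_integral_of_dominated_convergence (fun _ => ‖f‖)
        (fun n => f.continuous.comp_aestronglyMeasurable (hm (x n))) (integrable_const _)
        (fun n => .of_forall fun ω => f.norm_coe_le_norm _) ?_
      filter_upwards [hc x x₀ hx] with ω hω using (f.continuous.tendsto _).comp hω)
    ‖f‖ (fun x => by
      refine (norm_integral_le_of_norm_le_const (.of_forall fun ω => f.norm_coe_le_norm _)).trans ?_
      simp)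
  map_add' f g := by
    ext x
    exact integral_add (Integrable.of_bound (f.continuous.comp_aestronglyMeasurable (hm x)) ‖f‖
      (.of_forall fun ω => f.norm_coe_le_norm _))
      (Integrable.of_bound (g.continuous.comp_aestronglyMeasurable (hm x)) ‖g‖
      (.of_forall fun ω => g.norm_coe_le_norm _))
  map_smul' c f := by
    ext x
    exact integral_const_mul c _

theorem norm_averageOp_le {d : ℕ} {Ω : Type*} [MeasurableSpace Ω] (P : Measure Ω)
    [IsProbabilityMeasure P] (Φ : Eucl d → Ω → Eucl d) (hm) (hc) (f : Eucl d →ᵇ ℝ) :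
    ‖averageOp P Φ hm hc f‖ ≤ ‖f‖ :=
  (BoundedContinuousFunction.norm_le (norm_nonneg f)).2 fun x => by
    refine (norm_integral_le_of_norm_le_const (.of_forall fun ω => f.norm_coe_le_norm _)).trans ?_
    simp

/-! ### Markov property of the splitting scheme -/

section Scheme

variable {d : ℕ} {Ω : Type*} [MeasurableSpace Ω] {P : Measure Ω} [IsProbabilityMeasure P]
  {Y : ℝ≥0 → Ω → Eucl d} {F : Eucl d → Eucl d}

/-- The one-step transition operator of the scheme. -/
def stepOp (hY : IsLevyProcess P Y) (hF : Continuous F) (h : ℝ≥0) :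
    (Eucl d →ᵇ ℝ) →ₗ[ℝ] (Eucl d →ᵇ ℝ) :=
  averageOp P (fun x ω => driftStep h F (x + Y h ω))
    (fun x => (continuous_driftStep hF h).comp_aestronglyMeasurable
      ((hY.measurable h).const_add x).aestronglyMeasurable)
    (fun _ _ hx => .of_forall fun ω =>
      ((continuous_driftStep hF h).tendsto _).comp (hx.add_const (Y h ω)))

theorem stepOp_apply (hY : IsLevyProcess P Y) (hF : Continuous F) (h : ℝ≥0) (f : Eucl d →ᵇ ℝ)
    (x : Eucl d) : stepOp hY hF h f x = ∫ ω, f (driftStep h F (x + Y h ω)) ∂P := rfl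

/-- The last increment is independent of all that precedes it and distributed as Y_h, so integrating
it out replaces f by `stepOp` f. A random start `V` is allowed so that the scheme can be restarted
from the solution at time s. -/
theorem IsLevyProcess.integral_scheme (hY : IsLevyProcess P Y) (hF : Continuous F) (h s : ℝ≥0)
    {V : Ω → Eucl d} (hV : AEStronglyMeasurable[pastSigma Y s] V P) (k : ℕ) (f : Eucl d →ᵇ ℝ) :
    ∫ ω, f (scheme h F (fun t => Y (s + t) ω - Y s ω) (V ω) (k + 1)) ∂P =
      ∫ ω, stepOp hY hF h f (scheme h F (fun t => Y (s + t) ω - Y s ω) (V ω) k) ∂P := by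
  have h1 := hY.integral_add_increment (s + k * h) h (aestronglyMeasurable_scheme hF h s hV k)
    (f.compContinuous ⟨driftStep h F, continuous_driftStep hF h⟩)
  simp only [BoundedContinuousFunction.compContinuous_apply, ContinuousMap.coe_mk] at h1
  simp only [stepOp_apply]
  rw [← h1]
  refine integral_congr_ae (.of_forall fun ω => ?_)
  have : s + (k : ℝ≥0) * h + h = s + ↑(k + 1) * h := by push_cast; ring
  simp only [scheme, this, sub_sub_sub_cancel_right]

theorem IsLevyProcess.integral_scheme_eq_iterate (hY : IsLevyProcess P Y) (hF : Continuous F)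
    (h s : ℝ≥0) {V : Ω → Eucl d} (hV : AEStronglyMeasurable[pastSigma Y s] V P) (k : ℕ)
    (f : Eucl d →ᵇ ℝ) :
    ∫ ω, f (scheme h F (fun t => Y (s + t) ω - Y s ω) (V ω) k) ∂P =
      ∫ ω, (stepOp hY hF h)^[k] f (V ω) ∂P := by
  induction k generalizing f with
  | zero => rfl
  | succ k ih => rw [hY.integral_scheme hF h s hV, ih, Function.iterate_succ_apply]

end Scheme

/-! ### Convergence in probability and continuous convergence -/

/-- Transfers convergence in probability from the noise to the solution when their increments differ
by an almost surely vanishing term; the proof is the subsequence criterion. -/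
theorem tendstoInMeasure_of_sub_ae {d : ℕ} {Ω : Type*} [MeasurableSpace Ω] {P : Measure Ω}
    [IsFiniteMeasure P] {Z W : ℕ → Ω → Eucl d} {Z₀ W₀ : Ω → Eucl d}
    (hW : ∀ n, AEStronglyMeasurable (W n) P)
    (hZ : TendstoInMeasure P Z atTop Z₀)
    (h : ∀ᵐ ω ∂P, Tendsto (fun n => (W n ω - W₀ ω) - (Z n ω - Z₀ ω)) atTop (𝓝 0)) :
    TendstoInMeasure P W atTop W₀ := by
  rw [exists_seq_tendstoInMeasure_atTop_iff hW]
  intro ns hns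
  have hsub : TendstoInMeasure P (fun n => Z (ns n)) atTop Z₀ := hZ.comp hns.tendsto_atTop
  obtain ⟨ms, hms, hms'⟩ := hsub.exists_seq_tendsto_ae
  refine ⟨ms, hms, ?_⟩
  filter_upwards [h, hms'] with ω h1 h2
  have h3 := (h1.comp (hns.tendsto_atTop.comp hms.tendsto_atTop)).add
    ((h2.sub_const (Z₀ ω)).add_const (W₀ ω))
  rw [sub_self, zero_add, zero_add] at h3
  refine h3.congr fun i => ?_
  simp only [Function.comp_apply]
  abel

/-- The hypothesis `hlim` is continuous convergence: g_n(z_n) → g₀(z) whenever z_n → z. Along an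
almost surely convergent subsequence it is what dominated convergence needs. -/
theorem tendsto_integral_of_tendstoInMeasure {d : ℕ} {Ω : Type*} [MeasurableSpace Ω]
    {P : Measure Ω} [IsFiniteMeasure P] {Z : ℕ → Ω → Eucl d} {Z₀ : Ω → Eucl d}
    (hZm : ∀ n, AEStronglyMeasurable (Z n) P) (hZ : TendstoInMeasure P Z atTop Z₀)
    {g : ℕ → Eucl d → ℝ} {g₀ : Eucl d → ℝ} {C : ℝ} (hg : ∀ n, Continuous (g n))
    (hC : ∀ n z, ‖g n z‖ ≤ C)
    (hlim : ∀ z, Tendsto (fun p : ℕ × Eucl d => g p.1 p.2) (atTop ×ˢ 𝓝 z) (𝓝 (g₀ z))) :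
    Tendsto (fun n => ∫ ω, g n (Z n ω) ∂P) atTop (𝓝 (∫ ω, g₀ (Z₀ ω) ∂P)) := by
  refine tendsto_of_subseq_tendsto fun ns hns => ?_
  have hsub : TendstoInMeasure P (fun n => Z (ns n)) atTop Z₀ := hZ.comp hns
  obtain ⟨ms, hms, hms'⟩ := hsub.exists_seq_tendsto_ae
  refine ⟨ms, ?_⟩
  refine tendsto_integral_of_dominated_convergence (fun _ => C)
    (fun n => (hg _).comp_aestronglyMeasurable (hZm _)) (integrable_const _)
    (fun n => .of_forall fun ω => hC _ _) ?_
  filter_upwards [hms'] with ω hω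
  exact (hlim (Z₀ ω)).comp ((hns.comp hms.tendsto_atTop).prodMk hω)

/-- For a continuous limit, locally uniform and continuous convergence coincide; with the converse
below, mixed convergence can be handled pointwise along sequences. -/
theorem MixedTendsto.tendsto_prod {d : ℕ} {f : ℕ → (Eucl d →ᵇ ℝ)} {g : Eucl d →ᵇ ℝ}
    (h : MixedTendsto f g) (z : Eucl d) :
    Tendsto (fun p : ℕ × Eucl d => f p.1 p.2) (atTop ×ˢ 𝓝 z) (𝓝 (g z)) := by
  -- The extra 1 makes the ball a neighbourhood of `z`.
  have h1 := h.2 (‖z‖ + 1) (by positivity)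
  have hz : Metric.closedBall (0 : Eucl d) (‖z‖ + 1) ∈ 𝓝 z := by
    refine Filter.mem_of_superset (Metric.closedBall_mem_nhds z one_pos) fun y hy => ?_
    rw [mem_closedBall_zero_iff]
    rw [mem_closedBall_iff_norm] at hy
    linarith [norm_le_norm_add_norm_sub' y z]
  have h2 : TendstoLocallyUniformlyOn (fun n x => f n x) (fun x => g x) atTop
    (Metric.closedBall 0 (‖z‖ + 1)) := h1.tendstoLocallyUniformlyOn
  have h3 := tendstoLocallyUniformlyOn_iff_forall_tendsto.1 h2 z (mem_of_mem_nhds hz)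
  rw [nhdsWithin_eq_nhds.2 hz] at h3
  have h4 : Tendsto (fun p : ℕ × Eucl d => g p.2) (atTop ×ˢ 𝓝 z) (𝓝 (g z)) :=
    (g.continuous.tendsto z).comp tendsto_snd
  exact (Uniform.tendsto_congr h3).1 h4

theorem mixedTendsto_of_tendsto_prod {d : ℕ} {f : ℕ → (Eucl d →ᵇ ℝ)} {g : Eucl d →ᵇ ℝ} {C : ℝ}
    (hC : ∀ n, ‖f n‖ ≤ C)
    (h : ∀ z, Tendsto (fun p : ℕ × Eucl d => f p.1 p.2) (atTop ×ˢ 𝓝 z) (𝓝 (g z))) :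
    MixedTendsto f g := by
  refine ⟨⟨C, hC⟩, fun r _ => ?_⟩
  rw [← tendstoLocallyUniformlyOn_iff_tendstoUniformlyOn_of_compact (isCompact_closedBall _ _),
    tendstoLocallyUniformlyOn_iff_forall_tendsto]
  intro z _
  have h1 : Tendsto (fun p : ℕ × Eucl d => g p.2) (atTop ×ˢ 𝓝 z) (𝓝 (g z)) :=
    (g.continuous.tendsto z).comp tendsto_snd
  have h2 : Tendsto (fun p : ℕ × Eucl d => (g p.2, f p.1 p.2)) (atTop ×ˢ 𝓝 z) (uniformity ℝ) :=
    (h1.prodMk_nhds (h z)).mono_right (nhds_prod_eq.le.trans (by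
      rw [← nhds_prod_eq]; exact nhds_le_uniformity (g z)))
  exact h2.mono_left (prod_mono le_rfl nhdsWithin_le_nhds)

/-! ### The transition semigroup -/

section Semigroup

variable {d : ℕ} {Ω : Type*} [MeasurableSpace Ω] {P : Measure Ω}
  {Y : ℝ≥0 → Ω → Eucl d} {ω₀ : ℝ≥0} {F : Eucl d → Eucl d} {X : Eucl d → ℝ≥0 → Ω → Eucl d}

theorem IsStrongSolution.ae_isPathSolution {x : Eucl d} {Z : ℝ≥0 → Ω → Eucl d}
    (hZ : IsStrongSolution P Y F x Z) :
    ∀ᵐ ω ∂P, IsPathSolution F x (fun t => Y t ω) (fun t => Z t ω) := by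
  filter_upwards [hZ.cadlag, hZ.equation] with ω h1 h2 using ⟨h1, h2⟩

theorem IsStrongSolution.ae_start {x : Eucl d} {Z : ℝ≥0 → Ω → Eucl d}
    (hZ : IsStrongSolution P Y F x Z) (hY : IsLevyProcess P Y) : ∀ᵐ ω ∂P, Z 0 ω = x := by
  filter_upwards [hZ.equation, hY.start_zero] with ω h1 h2
  rw [h1, h2, NNReal.coe_zero, intervalIntegral.integral_same, add_zero, add_zero]

theorem IsStrongSolution.aestronglyMeasurable {x : Eucl d} {Z : ℝ≥0 → Ω → Eucl d}
    (hZ : IsStrongSolution P Y F x Z) (hY : IsLevyProcess P Y) (t : ℝ≥0) :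
    AEStronglyMeasurable (Z t) P :=
  (hZ.adapted t).mono (hY.pastSigma_le t)

theorem ae_norm_sub_le (hF : LipschitzWith ω₀ F)
    (hX : ∀ x, IsStrongSolution P Y F x (X x)) (x x' : Eucl d) :
    ∀ᵐ ω ∂P, ∀ t, ‖X x t ω - X x' t ω‖ ≤ ‖x - x'‖ * Real.exp (ω₀ * t) := by
  filter_upwards [(hX x).ae_isPathSolution, (hX x').ae_isPathSolution] with ω h h' t
  exact h.norm_sub_le hF h' t

theorem ae_tendsto_flow (hF : LipschitzWith ω₀ F) (hX : ∀ x, IsStrongSolution P Y F x (X x))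
    {t : ℕ → ℝ≥0} {t₀ : ℝ≥0} (ht : Tendsto t atTop (𝓝 t₀)) {x : ℕ → Eucl d} {x₀ : Eucl d}
    (hx : Tendsto x atTop (𝓝 x₀)) :
    ∀ᵐ ω ∂P, Tendsto (fun n => X (x n) (t n) ω - X x₀ (t n) ω) atTop (𝓝 0) := by
  filter_upwards [ae_all_iff.2 fun n => ae_norm_sub_le hF hX (x n) x₀] with ω hω
  refine squeeze_zero_norm (fun n => hω n (t n)) ?_
  have h1 : Tendsto (fun n => ‖x n - x₀‖) atTop (𝓝 0) := by
    simpa using (hx.sub_const x₀).norm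
  have h2 : Tendsto (fun n => Real.exp (ω₀ * t n)) atTop (𝓝 (Real.exp (ω₀ * t₀))) :=
    (Real.continuous_exp.tendsto _).comp ((NNReal.tendsto_coe.2 ht).const_mul _)
  simpa using h1.mul h2

theorem ae_tendsto_flow_start (hF : LipschitzWith ω₀ F)
    (hX : ∀ x, IsStrongSolution P Y F x (X x)) (t : ℝ≥0) (x : ℕ → Eucl d) (x₀ : Eucl d)
    (hx : Tendsto x atTop (𝓝 x₀)) :
    ∀ᵐ ω ∂P, Tendsto (fun n => X (x n) t ω) atTop (𝓝 (X x₀ t ω)) := by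
  filter_upwards [ae_tendsto_flow hF hX (tendsto_const_nhds (x := t)) hx] with ω hω
  exact tendsto_sub_nhds_zero_iff.1 hω

theorem IsStrongSolution.ae_tendsto_scheme {x : Eucl d} {Z : ℝ≥0 → Ω → Eucl d}
    (hZ : IsStrongSolution P Y F x Z) (hF : LipschitzWith ω₀ F) (s : ℝ≥0) {T : ℝ≥0} (hT : 0 < T)
    {k : ℕ → ℕ} (hk : ∀ n, k n ≤ n + 1) :
    ∀ᵐ ω ∂P, Tendsto (fun n : ℕ => Z (s + k n * (T / ↑(n + 1))) ω -
      scheme (T / ↑(n + 1)) F (fun t => Y (s + t) ω - Y s ω) (Z s ω) (k n)) atTop (𝓝 0) := by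
  filter_upwards [hZ.ae_isPathSolution] with ω hω
  have h1 := hω.add_time hF.continuous s
  have h2 := h1.tendsto_scheme hF (by simp) hT hk
  exact h2

variable [IsProbabilityMeasure P]

/-- The increment of the solution consists of a change of starting point, a drift integral over a
shrinking interval, and an increment of Y. The first two vanish almost surely, the third in
probability by stochastic continuity. -/
theorem tendstoInMeasure_flow (hY : IsLevyProcess P Y) (hF : LipschitzWith ω₀ F)
    (hX : ∀ x, IsStrongSolution P Y F x (X x))
    {t : ℕ → ℝ≥0} {t₀ : ℝ≥0} (ht : Tendsto t atTop (𝓝 t₀)) {x : ℕ → Eucl d} {x₀ : Eucl d}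
    (hx : Tendsto x atTop (𝓝 x₀)) :
    TendstoInMeasure P (fun n => X (x n) (t n)) atTop (X x₀ t₀) := by
  have hYt : TendstoInMeasure P (fun n => Y (t n)) atTop (Y t₀) := (hY.stoch_continuous t₀).comp ht
  refine tendstoInMeasure_of_sub_ae (fun n => (hX _).aestronglyMeasurable hY _) hYt ?_
  filter_upwards [ae_tendsto_flow hF hX ht hx, (hX x₀).ae_isPathSolution] with ω h1 h2
  have hi := fun a b => h2.cadlag.intervalIntegrable_comp hF.continuous a b
  have h3 : Tendsto (fun n => ∫ u in (t₀ : ℝ)..t n, F (X x₀ u.toNNReal ω)) atTop (𝓝 0) := by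
    have hcont := intervalIntegral.continuous_primitive hi (t₀ : ℝ)
    have := (hcont.tendsto t₀).comp (NNReal.tendsto_coe.2 ht)
    simpa [Function.comp_def] using this
  have h4 := h1.add h3
  rw [add_zero] at h4
  refine h4.congr fun n => ?_
  rw [← sub_eq_iff_eq_add.2 (h2.sub_eq hF.continuous t₀ (t n))]
  abel

/-- The transition operators `(T_t f)(x) = E[f(X^x_t)]`. -/
def transOp (hY : IsLevyProcess P Y) (hF : LipschitzWith ω₀ F)
    (hX : ∀ x, IsStrongSolution P Y F x (X x)) (t : ℝ≥0) :
    (Eucl d →ᵇ ℝ) →ₗ[ℝ] (Eucl d →ᵇ ℝ) :=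
  averageOp P (fun x => X x t) (fun x => (hX x).aestronglyMeasurable hY t)
    (ae_tendsto_flow_start hF hX t)

theorem transOp_apply (hY : IsLevyProcess P Y) (hF : LipschitzWith ω₀ F)
    (hX : ∀ x, IsStrongSolution P Y F x (X x)) (t : ℝ≥0) (f : Eucl d →ᵇ ℝ) (x : Eucl d) :
    transOp hY hF hX t f x = ∫ ω, f (X x t ω) ∂P := rfl

theorem tendsto_transOp (hY : IsLevyProcess P Y) (hF : LipschitzWith ω₀ F)
    (hX : ∀ x, IsStrongSolution P Y F x (X x)) (t : ℕ → ℝ≥0) (t₀ : ℝ≥0) (x : ℕ → Eucl d)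
    (x₀ : Eucl d) (f : ℕ → (Eucl d →ᵇ ℝ)) (f₀ : Eucl d →ᵇ ℝ) (ht : Tendsto t atTop (𝓝 t₀))
    (hx : Tendsto x atTop (𝓝 x₀)) (hf : MixedTendsto f f₀) :
    Tendsto (fun n => transOp hY hF hX (t n) (f n) (x n)) atTop
      (𝓝 (transOp hY hF hX t₀ f₀ x₀)) := by
  obtain ⟨C, hC⟩ := hf.1
  exact tendsto_integral_of_tendstoInMeasure
    (fun n => (hX _).aestronglyMeasurable hY _) (tendstoInMeasure_flow hY hF hX ht hx)
    (fun n => (f n).continuous) (fun n z => ((f n).norm_coe_le_norm z).trans (hC n)) hf.tendsto_prod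

theorem norm_iterate_stepOp_le (hY : IsLevyProcess P Y) (hF : Continuous F) (h : ℝ≥0) (k : ℕ)
    (f : Eucl d →ᵇ ℝ) : ‖(stepOp hY hF h)^[k] f‖ ≤ ‖f‖ := by
  induction k generalizing f with
  | zero => rfl
  | succ k ih =>
    rw [Function.iterate_succ_apply]
    exact (ih _).trans (norm_averageOp_le _ _ _ _ _)

/-- The scheme is restarted at time s from the solution itself. Its expectation is that of a
deterministic function of `Z s`, while its paths converge to the solution at time s + t. -/
theorem tendsto_integral_iterate_stepOp (hY : IsLevyProcess P Y) (hF : LipschitzWith ω₀ F)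
    {x : Eucl d} {Z : ℝ≥0 → Ω → Eucl d} (hZ : IsStrongSolution P Y F x Z) (s : ℝ≥0) {t : ℝ≥0}
    (ht : 0 < t) (f : Eucl d →ᵇ ℝ) :
    Tendsto (fun n : ℕ => ∫ ω, (stepOp hY hF.continuous (t / ↑(n + 1)))^[n + 1] f (Z s ω) ∂P) atTop
      (𝓝 (∫ ω, f (Z (s + t) ω) ∂P)) := by
  have h1 : ∀ n : ℕ, ∫ ω, (stepOp hY hF.continuous (t / ↑(n + 1)))^[n + 1] f (Z s ω) ∂P =
      ∫ ω, f (scheme (t / ↑(n + 1)) F (fun t => Y (s + t) ω - Y s ω) (Z s ω) (n + 1)) ∂P :=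
    fun n => (hY.integral_scheme_eq_iterate hF.continuous _ s (hZ.adapted s) (n + 1) f).symm
  simp only [h1]
  refine tendsto_integral_of_dominated_convergence (fun _ => ‖f‖) (fun n => ?_)
    (integrable_const _) (fun n => .of_forall fun ω => f.norm_coe_le_norm _) ?_
  · exact f.continuous.comp_aestronglyMeasurable
      ((aestronglyMeasurable_scheme hF.continuous _ s (hZ.adapted s) (n + 1)).mono
        (hY.pastSigma_le _))
  · filter_upwards [hZ.ae_tendsto_scheme hF s ht (k := fun n => n + 1) fun _ => le_rfl] with ω hω
    refine (f.continuous.tendsto _).comp ?_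
    have h2 : ∀ n : ℕ, s + (↑(n + 1) : ℝ≥0) * (t / ↑(n + 1)) = s + t := fun n => by
      rw [mul_div_cancel₀]; positivity
    simp only [h2] at hω
    simpa only [sub_sub_cancel, sub_zero] using hω.const_sub (Z (s + t) ω)

theorem transOp_zero (hY : IsLevyProcess P Y) (hF : LipschitzWith ω₀ F)
    (hX : ∀ x, IsStrongSolution P Y F x (X x)) (f : Eucl d →ᵇ ℝ) :
    transOp hY hF hX 0 f = f := by
  ext x
  rw [transOp_apply, integral_congr_ae (g := fun _ => f x)]
  · simp
  · filter_upwards [(hX x).ae_start hY] with ω hω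
    rw [hω]

theorem tendsto_iterate_stepOp (hY : IsLevyProcess P Y) (hF : LipschitzWith ω₀ F)
    (hX : ∀ x, IsStrongSolution P Y F x (X x)) {t : ℝ≥0} (ht : 0 < t) (f : Eucl d →ᵇ ℝ)
    (x : Eucl d) :
    Tendsto (fun n : ℕ => (stepOp hY hF.continuous (t / ↑(n + 1)))^[n + 1] f x) atTop
      (𝓝 (transOp hY hF hX t f x)) := by
  have h1 := tendsto_integral_iterate_stepOp hY hF (hX x) 0 ht f
  rw [zero_add] at h1
  refine h1.congr fun n => ?_
  exact congrArg (fun g : Eucl d →ᵇ ℝ => g x) (transOp_zero hY hF hX _)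

/-- Both sides are limits of the same sequence, the expectations of iterates of `stepOp` at X_s:
once by restarting the scheme at s, once by dominated convergence of the iterates at each point. The
case t = 0 is separate because the step size must be positive. -/
theorem transOp_add (hY : IsLevyProcess P Y) (hF : LipschitzWith ω₀ F)
    (hX : ∀ x, IsStrongSolution P Y F x (X x)) (s t : ℝ≥0) (f : Eucl d →ᵇ ℝ) :
    transOp hY hF hX (s + t) f = transOp hY hF hX s (transOp hY hF hX t f) := by
  rcases eq_zero_or_pos t with rfl | ht
  · rw [add_zero, transOp_zero]
  ext x
  refine tendsto_nhds_unique (tendsto_integral_iterate_stepOp hY hF (hX x) s ht f) ?_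
  refine tendsto_integral_of_dominated_convergence (fun _ => ‖f‖) (fun n => ?_)
    (integrable_const _) (fun n => .of_forall fun ω =>
      (BoundedContinuousFunction.norm_coe_le_norm _ _).trans (norm_iterate_stepOp_le _ _ _ _ _)) ?_
  · exact (BoundedContinuousFunction.continuous _).comp_aestronglyMeasurable
      ((hX x).aestronglyMeasurable hY s)
  · exact .of_forall fun ω => tendsto_iterate_stepOp hY hF hX ht f _

theorem isStronglyContinuousFellerSemigroup_transOp (hY : IsLevyProcess P Y)
    (hF : LipschitzWith ω₀ F) (hX : ∀ x, IsStrongSolution P Y F x (X x)) :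
    IsStronglyContinuousFellerSemigroup (transOp hY hF hX) where
  positive t f hf x := integral_nonneg fun ω => hf _
  map_one t := by
    ext x
    simp [transOp_apply]
  zero_apply := transOp_zero hY hF hX
  add_apply := transOp_add hY hF hX
  continuous := tendsto_transOp hY hF hX

end Semigroup

/-! ### The Lévy–Khintchine exponent -/

/-- Mean value inequality on the left half-plane, which is convex and on which |exp| ≤ 1. -/
theorem norm_exp_sub_one_le_of_re_nonpos {z : ℂ} (hz : z.re ≤ 0) : ‖Complex.exp z - 1‖ ≤ ‖z‖ := by
  have hconv : Convex ℝ {w : ℂ | w.re ≤ 0} := convex_halfSpace_re_le 0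
  have := hconv.norm_image_sub_le_of_norm_hasDerivWithin_le (𝕜 := ℂ) (f := Complex.exp)
    (f' := Complex.exp) (C := 1) (x := 0) (y := z)
    (fun w _ => (Complex.hasDerivAt_exp w).hasDerivWithinAt)
    (fun w hw => by rw [Complex.norm_exp]; exact Real.exp_le_one_iff.2 hw) (by simp) hz
  simpa using this

theorem norm_exp_I_mul_sub_one_sub_le (u : ℝ) :
    ‖Complex.exp (Complex.I * u) - 1 - Complex.I * u‖ ≤ 2 * u ^ 2 := by
  have hn : ‖Complex.I * (u : ℂ)‖ = |u| := by simp
  rcases le_or_gt |u| 1 with h | h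
  · have := Complex.norm_exp_sub_one_sub_id_le (x := Complex.I * u) (by rwa [hn])
    rw [hn, sq_abs] at this
    nlinarith [sq_nonneg u]
  · have h1 : ‖Complex.exp (Complex.I * u) - 1‖ ≤ |u| := Real.norm_exp_I_mul_ofReal_sub_one_le
    have h2 := norm_sub_le (Complex.exp (Complex.I * u) - 1) (Complex.I * u)
    rw [hn] at h2
    have h3 : |u| ≤ u ^ 2 := by rw [← sq_abs]; nlinarith
    linarith

/-- The integrand of the Lévy–Khintchine exponent. -/
def levyKernel {d : ℕ} (ξ y : Eucl d) : ℂ :=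
  Complex.exp (Complex.I * ((inner ℝ y ξ : ℝ) : ℂ)) - 1 - Complex.I * ((inner ℝ (trunc y) ξ : ℝ) : ℂ)

theorem measurable_trunc {d : ℕ} : Measurable (trunc : Eucl d → Eucl d) := by
  unfold trunc
  exact Measurable.ite (measurableSet_le measurable_norm measurable_const) measurable_id
    measurable_const

theorem trunc_of_le {d : ℕ} {y : Eucl d} (h : ‖y‖ ≤ 1) : trunc y = y := if_pos h

theorem trunc_of_lt {d : ℕ} {y : Eucl d} (h : 1 < ‖y‖) : trunc y = 0 := if_neg h.not_ge

theorem sq_inner_le {d : ℕ} (y ξ : Eucl d) : (inner ℝ y ξ) ^ 2 ≤ ‖y‖ ^ 2 * ‖ξ‖ ^ 2 := by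
  rw [← sq_abs, ← mul_pow]
  gcongr
  exact abs_real_inner_le_norm y ξ

theorem measurable_levyKernel {d : ℕ} (ξ : Eucl d) : Measurable (levyKernel ξ) := by
  have := measurable_trunc (d := d)
  unfold levyKernel
  fun_prop

theorem norm_levyKernel_le {d : ℕ} (ξ y : Eucl d) :
    ‖levyKernel ξ y‖ ≤ 2 * (1 + ‖ξ‖ ^ 2) * min 1 (‖y‖ ^ 2) := by
  rcases le_or_gt ‖y‖ 1 with h | h
  · rw [levyKernel, trunc_of_le h, min_eq_right (pow_le_one₀ (norm_nonneg _) h)]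
    refine (norm_exp_I_mul_sub_one_sub_le _).trans ?_
    nlinarith [sq_inner_le y ξ, sq_nonneg ‖y‖]
  · rw [levyKernel, trunc_of_lt h, min_eq_left (one_le_pow₀ h.le)]
    simp only [inner_zero_left, Complex.ofReal_zero, mul_zero, sub_zero, mul_one]
    refine (norm_sub_le _ _).trans ?_
    rw [Complex.norm_exp_I_mul_ofReal, norm_one]
    nlinarith [sq_nonneg ‖ξ‖]

/-! ### Integrability and growth bounds for a Lévy triplet -/

section Triplet

variable {d : ℕ} (τ : LevyTriplet d)

theorem LevyTriplet.integrable_min : Integrable (fun y : Eucl d => min 1 (‖y‖ ^ 2)) τ.ν := by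
  refine ⟨Continuous.aestronglyMeasurable (by fun_prop), ?_⟩
  rw [hasFiniteIntegral_iff_ofReal (.of_forall fun y => by positivity)]
  exact τ.levy_integrable

theorem LevyTriplet.ae_ne_zero : ∀ᵐ y ∂τ.ν, y ≠ 0 := by
  rw [ae_iff]
  simpa using τ.levy_zero

theorem LevyTriplet.restrict_compl_zero : τ.ν.restrict {0}ᶜ = τ.ν :=
  Measure.restrict_eq_self_of_ae_mem τ.ae_ne_zero

/-- Needed for Fubini with ν, which may be infinite near 0. Multiplying by the density 1 ∧ |y|²,
positive off the null set {0}, gives a finite measure, and the density can be inverted. -/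
theorem LevyTriplet.sFinite : SFinite τ.ν := by
  set f : Eucl d → ENNReal := fun y => ENNReal.ofReal (min 1 (‖y‖ ^ 2)) with hf
  have hfm : Measurable f := Measurable.ennreal_ofReal (Continuous.measurable (by fun_prop))
  have h1 : IsFiniteMeasure (τ.ν.withDensity f) :=
    isFiniteMeasure_withDensity τ.levy_integrable.ne
  have h2 : (τ.ν.withDensity f).withDensity (fun y => (f y)⁻¹) = τ.ν := by
    refine withDensity_inv_same hfm ?_ (.of_forall fun y => ENNReal.ofReal_ne_top)
    filter_upwards [τ.ae_ne_zero] with y hy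
    have : 0 < min 1 (‖y‖ ^ 2) := by positivity
    simpa [hf] using hy
  rw [← h2]
  infer_instance

theorem LevyTriplet.integrable_of_norm_le {G : Type*} [NormedAddCommGroup G] {g : Eucl d → G}
    (hg : AEStronglyMeasurable g τ.ν) {C : ℝ} (h : ∀ y, ‖g y‖ ≤ C * min 1 (‖y‖ ^ 2)) :
    Integrable g τ.ν :=
  (τ.integrable_min.const_mul C).mono' hg (.of_forall h)

theorem LevyTriplet.integrable_levyKernel (ξ : Eucl d) : Integrable (levyKernel ξ) τ.ν :=
  τ.integrable_of_norm_le (measurable_levyKernel ξ).aestronglyMeasurable (norm_levyKernel_le ξ)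

/-- The quadratic form of the Gaussian covariance matrix. -/
def LevyTriplet.quad (ξ : Eucl d) : ℝ := ∑ i, ∑ j, ξ i * τ.σ i j * ξ j

theorem LevyTriplet.exponent_eq (ξ : Eucl d) :
    τ.exponent ξ = Complex.I * ((inner ℝ τ.b ξ : ℝ) : ℂ) - (1 / 2) * (τ.quad ξ : ℂ) +
      ∫ y, levyKernel ξ y ∂τ.ν := by
  rw [LevyTriplet.exponent, τ.restrict_compl_zero]
  rfl

theorem LevyTriplet.quad_nonneg (ξ : Eucl d) : 0 ≤ τ.quad ξ := by
  have h := τ.posSemidef.dotProduct_mulVec_nonneg (fun i => ξ i)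
  simpa [LevyTriplet.quad, dotProduct, Matrix.mulVec, Finset.mul_sum, mul_assoc] using h

theorem LevyTriplet.continuous_quad : Continuous τ.quad := by
  unfold LevyTriplet.quad
  fun_prop

theorem LevyTriplet.quad_le : ∃ C : ℝ, 0 ≤ C ∧ ∀ ξ, τ.quad ξ ≤ C * ‖ξ‖ ^ 2 := by
  refine ⟨∑ i, ∑ j, |τ.σ i j|, by positivity, fun ξ => ?_⟩
  rw [LevyTriplet.quad, Finset.sum_mul]
  refine Finset.sum_le_sum fun i _ => ?_
  rw [Finset.sum_mul]
  refine Finset.sum_le_sum fun j _ => (le_abs_self _).trans ?_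
  rw [abs_mul, abs_mul, mul_comm |ξ i|, mul_assoc, sq]
  gcongr
  · exact PiLp.norm_apply_le ξ i
  · exact PiLp.norm_apply_le ξ j

/-- Quadratic growth makes the exponent integrable against a Gaussian, which later provides the
dominating function. -/
theorem LevyTriplet.norm_exponent_le :
    ∃ C : ℝ, 0 ≤ C ∧ ∀ ξ, ‖τ.exponent ξ‖ ≤ C * (1 + ‖ξ‖ ^ 2) := by
  obtain ⟨C, hC0, hC⟩ := τ.quad_le
  set J := ∫ y, min 1 (‖y‖ ^ 2) ∂τ.ν
  have hJ : 0 ≤ J := integral_nonneg fun y => by positivity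
  refine ⟨‖τ.b‖ + C + 2 * J, by positivity, fun ξ => ?_⟩
  rw [τ.exponent_eq]
  have h1 : ‖Complex.I * ((inner ℝ τ.b ξ : ℝ) : ℂ)‖ ≤ ‖τ.b‖ * (1 + ‖ξ‖ ^ 2) := by
    simp only [norm_mul, Complex.norm_I, one_mul, Complex.norm_real, Real.norm_eq_abs]
    refine (abs_real_inner_le_norm _ _).trans ?_
    gcongr
    nlinarith [sq_nonneg (‖ξ‖ - 1)]
  have h2 : ‖(1 / 2 : ℂ) * (τ.quad ξ : ℂ)‖ ≤ C * (1 + ‖ξ‖ ^ 2) := by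
    rw [norm_mul, Complex.norm_real, Real.norm_of_nonneg (τ.quad_nonneg ξ)]
    have := hC ξ
    have h3 := τ.quad_nonneg ξ
    norm_num
    nlinarith
  have h3 : ‖∫ y, levyKernel ξ y ∂τ.ν‖ ≤ 2 * J * (1 + ‖ξ‖ ^ 2) := by
    refine (norm_integral_le_of_norm_le (τ.integrable_min.const_mul (2 * (1 + ‖ξ‖ ^ 2)))
      (.of_forall fun y => norm_levyKernel_le ξ y)).trans (le_of_eq ?_)
    rw [integral_const_mul]; ring
  refine (norm_add_le _ _).trans ((add_le_add_left (norm_sub_le _ _) _).trans ?_)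
  linarith

/-- A characteristic function has modulus at most 1, which forces tψ into the left half-plane; the
quotient is then bounded by |ψ| uniformly in t. -/
theorem norm_exp_sub_one_div_le {ψ : ℂ} {t : ℝ} (ht : 0 < t)
    (h : ‖Complex.exp (t * ψ)‖ ≤ 1) :
    ‖((t⁻¹ : ℝ) : ℂ) * (Complex.exp (t * ψ) - 1)‖ ≤ ‖ψ‖ := by
  have hre : ((t : ℂ) * ψ).re ≤ 0 := by
    rw [Complex.norm_exp] at h
    exact Real.exp_le_one_iff.1 h
  have h1 := norm_exp_sub_one_le_of_re_nonpos hre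
  rw [norm_mul, Complex.norm_real, Real.norm_of_nonneg ht.le] at h1
  rw [norm_mul, Complex.norm_real, Real.norm_of_nonneg (by positivity), inv_mul_le_iff₀ ht]
  exact h1

theorem tendsto_exp_sub_one_div (ψ : ℂ) {t : ℕ → ℝ} (ht : ∀ n, 0 < t n)
    (ht0 : Tendsto t atTop (𝓝 0)) :
    Tendsto (fun n => (((t n)⁻¹ : ℝ) : ℂ) * (Complex.exp (t n * ψ) - 1)) atTop (𝓝 ψ) := by
  have h1 : HasDerivAt (fun s : ℝ => Complex.exp (s * ψ)) ψ 0 := by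
    have h2 : HasDerivAt (fun s : ℝ => (s : ℂ) * ψ) ψ 0 := by
      simpa using (Complex.ofRealCLM.hasDerivAt (x := (0 : ℝ))).mul_const ψ
    simpa using h2.cexp
  have h3 := h1.tendsto_slope_zero.comp (tendsto_nhdsWithin_iff.2
    ⟨ht0, .of_forall fun n => (ht n).ne'⟩)
  refine h3.congr fun n => ?_
  simp

end Triplet

/-! ### Weak convergence tested against convergent integrands -/

/-- Lévy's continuity theorem handles the fixed integrand `f₀`. Tightness handles `f n - f₀`, which
is uniformly small on a compact set and bounded by 2C off it. -/
theorem tendsto_integral_of_tendsto_charFun_probability {d : ℕ}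
    {N : ℕ → ProbabilityMeasure (Eucl d)} {N₀ : ProbabilityMeasure (Eucl d)}
    (h : ∀ ξ, Tendsto (fun n => charFun (N n : Measure (Eucl d)) ξ) atTop
      (𝓝 (charFun (N₀ : Measure (Eucl d)) ξ)))
    {f : ℕ → Eucl d → ℝ} {f₀ : Eucl d → ℝ} {C : ℝ} (hf : ∀ n, Continuous (f n))
    (hf₀ : Continuous f₀) (hC : ∀ n z, ‖f n z‖ ≤ C) (hC₀ : ∀ z, ‖f₀ z‖ ≤ C)
    (hlim : ∀ z, Tendsto (fun p : ℕ × Eucl d => f p.1 p.2) (atTop ×ˢ 𝓝 z) (𝓝 (f₀ z))) :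
    Tendsto (fun n => ∫ y, f n y ∂(N n : Measure (Eucl d))) atTop
      (𝓝 (∫ y, f₀ y ∂(N₀ : Measure (Eucl d)))) := by
  have hC0 : 0 ≤ C := (norm_nonneg _).trans (hC₀ 0)
  have hweak := ProbabilityMeasure.tendsto_of_tendsto_charFun h
  have h1 : Tendsto (fun n => ∫ y, f₀ y ∂(N n : Measure (Eucl d))) atTop
      (𝓝 (∫ y, f₀ y ∂(N₀ : Measure (Eucl d)))) :=
    ProbabilityMeasure.tendsto_iff_forall_integral_tendsto.1 hweak
      (BoundedContinuousFunction.ofNormedAddCommGroup f₀ hf₀ C hC₀)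
  have htight := isTightMeasureSet_of_tendsto_charFun
    (μ := fun n => (N n : Measure (Eucl d))) (f := charFun (N₀ : Measure (Eucl d)))
    continuous_charFun.continuousAt h
  rw [isTightMeasureSet_iff_exists_isCompact_measure_compl_le] at htight
  have hint : ∀ n, Integrable (f n) (N n : Measure (Eucl d)) := fun n =>
    Integrable.of_bound (hf n).aestronglyMeasurable C (.of_forall (hC n))
  have hint₀ : ∀ n, Integrable f₀ (N n : Measure (Eucl d)) := fun n =>
    Integrable.of_bound hf₀.aestronglyMeasurable C (.of_forall hC₀)
  have h2 : Tendsto (fun n => ∫ y, (f n y - f₀ y) ∂(N n : Measure (Eucl d))) atTop (𝓝 0) := by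
    rw [Metric.tendsto_atTop']
    intro ε hε
    obtain ⟨K, hK, hKc⟩ := htight (ENNReal.ofReal (ε / 2 / (2 * C + 1))) (by
      rw [ENNReal.ofReal_pos]; positivity)
    have hunif : TendstoUniformlyOn f f₀ atTop K := by
      rw [← tendstoLocallyUniformlyOn_iff_tendstoUniformlyOn_of_compact hK,
        tendstoLocallyUniformlyOn_iff_forall_tendsto]
      intro z _
      have h3 : Tendsto (fun p : ℕ × Eucl d => f₀ p.2) (atTop ×ˢ 𝓝 z) (𝓝 (f₀ z)) :=
        (hf₀.tendsto z).comp tendsto_snd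
      exact ((h3.prodMk_nhds (hlim z)).mono_right (nhds_le_uniformity (f₀ z))).mono_left
        (prod_mono le_rfl nhdsWithin_le_nhds)
    rw [Metric.tendstoUniformlyOn_iff] at hunif
    obtain ⟨n₀, hn₀⟩ := eventually_atTop.1 (hunif (ε / 2) (by positivity))
    refine ⟨n₀, fun n hn => ?_⟩
    have hKm : MeasurableSet Kᶜ := hK.measurableSet.compl
    have hreal : (N n : Measure (Eucl d)).real Kᶜ ≤ ε / 2 / (2 * C + 1) :=
      ENNReal.toReal_le_of_le_ofReal (by positivity) (hKc _ ⟨n, rfl⟩)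
    have hbd : ∀ y, ‖f n y - f₀ y‖ ≤ Set.indicator K (fun _ => ε / 2) y +
        Set.indicator Kᶜ (fun _ => 2 * C) y := by
      intro y
      by_cases hy : y ∈ K
      · have := hn₀ n hn.le y hy
        rw [dist_comm, dist_eq_norm] at this
        simpa [hy] using this.le
      · have : ‖f n y - f₀ y‖ ≤ C + C := (norm_sub_le _ _).trans (add_le_add (hC n y) (hC₀ y))
        simpa [hy, two_mul] using this
    have hi1 : Integrable (Set.indicator K fun _ => ε / 2) (N n : Measure (Eucl d)) :=
      (integrable_const _).indicator hK.measurableSet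
    have hi2 : Integrable (Set.indicator Kᶜ fun _ => 2 * C) (N n : Measure (Eucl d)) :=
      (integrable_const _).indicator hKm
    have h4 := norm_integral_le_of_norm_le (hi1.add hi2) (.of_forall hbd)
    rw [integral_add' hi1 hi2, integral_indicator_const _ hK.measurableSet,
      integral_indicator_const _ hKm, smul_eq_mul, smul_eq_mul] at h4
    have h5 : (N n : Measure (Eucl d)).real K * (ε / 2) ≤ 1 * (ε / 2) := by
      gcongr
      exact measureReal_le_one
    have h6 : (N n : Measure (Eucl d)).real Kᶜ * (2 * C) < ε / 2 := by
      calc (N n : Measure (Eucl d)).real Kᶜ * (2 * C)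
          ≤ ε / 2 / (2 * C + 1) * (2 * C) := by gcongr
        _ < ε / 2 / (2 * C + 1) * (2 * C + 1) := by
            refine mul_lt_mul_of_pos_left (by linarith) (by positivity)
        _ = ε / 2 := by field_simp
    rw [dist_zero_right]
    linarith
  have h3 := h2.add h1
  rw [zero_add] at h3
  refine h3.congr fun n => ?_
  rw [integral_sub (hint n) (hint₀ n), sub_add_cancel]

/-- A finite measure turned into a probability measure by adding a unit mass at `0`. -/
def addDirac {d : ℕ} (m : Measure (Eucl d)) : Measure (Eucl d) :=
  (m Set.univ + 1)⁻¹ • (m + Measure.dirac 0)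

instance isProbabilityMeasure_addDirac {d : ℕ} (m : Measure (Eucl d)) [IsFiniteMeasure m] :
    IsProbabilityMeasure (addDirac m) where
  measure_univ := by
    rw [addDirac, Measure.smul_apply, Measure.add_apply,
      Measure.dirac_apply_of_mem (Set.mem_univ _), smul_eq_mul]
    exact ENNReal.inv_mul_cancel (by simp) (by finiteness)

theorem integral_addDirac {d : ℕ} (m : Measure (Eucl d)) [IsFiniteMeasure m]
    {G : Type*} [NormedAddCommGroup G] [NormedSpace ℝ G] [CompleteSpace G] {f : Eucl d → G}
    (hf : Integrable f m) :
    ∫ y, f y ∂(addDirac m) = (m.real Set.univ + 1)⁻¹ • (∫ y, f y ∂m + f 0) := by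
  rw [addDirac, integral_smul_measure, integral_add_measure hf (integrable_dirac (by simp)),
    integral_dirac, ENNReal.toReal_inv, ENNReal.toReal_add (measure_ne_top _ _) ENNReal.one_ne_top]
  rfl

/-- The total masses vary and may be zero or tend to zero, so the measures cannot simply be
normalised. Adding a unit mass at 0 first makes this harmless; masses converge by evaluating at ξ =
0, and the added term `f n 0` is subtracted at the end. -/
theorem tendsto_integral_of_tendsto_charFun {d : ℕ}
    {m : ℕ → Measure (Eucl d)} {m₀ : Measure (Eucl d)} [∀ n, IsFiniteMeasure (m n)]
    [IsFiniteMeasure m₀]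
    (h : ∀ ξ, Tendsto (fun n => charFun (m n) ξ) atTop (𝓝 (charFun m₀ ξ)))
    {f : ℕ → Eucl d → ℝ} {f₀ : Eucl d → ℝ} {C : ℝ} (hf : ∀ n, Continuous (f n))
    (hf₀ : Continuous f₀) (hC : ∀ n z, ‖f n z‖ ≤ C) (hC₀ : ∀ z, ‖f₀ z‖ ≤ C)
    (hlim : ∀ z, Tendsto (fun p : ℕ × Eucl d => f p.1 p.2) (atTop ×ˢ 𝓝 z) (𝓝 (f₀ z))) :
    Tendsto (fun n => ∫ y, f n y ∂(m n)) atTop (𝓝 (∫ y, f₀ y ∂m₀)) := by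
  have hmass : Tendsto (fun n => (m n).real Set.univ) atTop (𝓝 (m₀.real Set.univ)) := by
    have h0 := h 0
    simp only [charFun_zero] at h0
    exact_mod_cast (Complex.continuous_re.tendsto _).comp h0
  have hpos : ∀ m : Measure (Eucl d), m.real Set.univ + 1 ≠ 0 := fun m => by positivity
  have hinv : Tendsto (fun n => ((m n).real Set.univ + 1)⁻¹) atTop
      (𝓝 (m₀.real Set.univ + 1)⁻¹) := (hmass.add_const 1).inv₀ (hpos m₀)
  have hchar : ∀ (m : Measure (Eucl d)) [IsFiniteMeasure m] (ξ : Eucl d),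
      charFun (addDirac m) ξ = (m.real Set.univ + 1)⁻¹ • (charFun m ξ + 1) := by
    intro m _ ξ
    rw [charFun_apply, integral_addDirac, charFun_apply]
    · simp
    · refine Integrable.of_bound (Continuous.aestronglyMeasurable (by fun_prop)) 1
        (.of_forall fun y => ?_)
      rw [Complex.norm_exp_ofReal_mul_I]
  have hc : ∀ ξ, Tendsto (fun n => charFun (addDirac (m n)) ξ) atTop
      (𝓝 (charFun (addDirac m₀) ξ)) := by
    intro ξ
    simp only [hchar]
    exact hinv.smul ((h ξ).add_const 1)
  have key := tendsto_integral_of_tendsto_charFun_probability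
    (N := fun n => ⟨addDirac (m n), inferInstance⟩) (N₀ := ⟨addDirac m₀, inferInstance⟩)
    hc hf hf₀ hC hC₀ hlim
  simp only [ProbabilityMeasure.coe_mk] at key
  have hi : ∀ n, Integrable (f n) (m n) := fun n =>
    Integrable.of_bound (hf n).aestronglyMeasurable C (.of_forall (hC n))
  have hi₀ : Integrable f₀ m₀ := Integrable.of_bound hf₀.aestronglyMeasurable C (.of_forall hC₀)
  rw [integral_addDirac m₀ hi₀] at key
  simp only [fun n => integral_addDirac (m n) (hi n)] at key
  have h0 : Tendsto (fun n => f n 0) atTop (𝓝 (f₀ 0)) :=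
    (hlim 0).comp (tendsto_id.prodMk tendsto_const_nhds)
  have h1 := ((hmass.add_const 1).smul key).sub h0
  simp only [smul_smul, mul_inv_cancel₀ (hpos _), one_smul, add_sub_cancel_right] at h1
  exact h1

/-! ### Small-time behaviour of convolution semigroups -/

/-- The weight `1 - exp(-|y|²/2)`, comparable to `1 ∧ |y|²`. -/
def weight {d : ℕ} (y : Eucl d) : ℝ := 1 - Real.exp (-‖y‖ ^ 2 / 2)

theorem continuous_weight {d : ℕ} : Continuous (weight : Eucl d → ℝ) := by
  unfold weight
  fun_prop

theorem weight_zero {d : ℕ} : weight (0 : Eucl d) = 0 := by simp [weight]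

theorem weight_nonneg {d : ℕ} (y : Eucl d) : 0 ≤ weight y := by
  have : Real.exp (-‖y‖ ^ 2 / 2) ≤ 1 :=
    Real.exp_le_one_iff.2 (by have := sq_nonneg ‖y‖; linarith)
  rw [weight]; linarith

theorem weight_le {d : ℕ} (y : Eucl d) : weight y ≤ min 1 (‖y‖ ^ 2) := by
  rw [weight]
  refine le_min (by linarith [Real.exp_pos (-‖y‖ ^ 2 / 2)]) ?_
  have := Real.add_one_le_exp (-‖y‖ ^ 2 / 2)
  nlinarith [sq_nonneg ‖y‖]

theorem min_le_weight {d : ℕ} (y : Eucl d) : min 1 (‖y‖ ^ 2) ≤ 3 * weight y := by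
  have hu := sq_nonneg ‖y‖
  have h1 : Real.exp (-‖y‖ ^ 2 / 2) ≤ (1 + ‖y‖ ^ 2 / 2)⁻¹ := by
    rw [show -‖y‖ ^ 2 / 2 = -(‖y‖ ^ 2 / 2) by ring, Real.exp_neg]
    gcongr
    linarith [Real.add_one_le_exp (‖y‖ ^ 2 / 2)]
  -- With u = |y|² the right side is u/(2+u), which is at least u/3 for u ≤ 1 and at least 1/3 for u
  -- ≥ 1.
  have h2 : min 1 (‖y‖ ^ 2) / 3 ≤ 1 - (1 + ‖y‖ ^ 2 / 2)⁻¹ := by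
    have h3 : 1 - (1 + ‖y‖ ^ 2 / 2)⁻¹ = ‖y‖ ^ 2 / (2 + ‖y‖ ^ 2) := by
      field_simp; ring
    rw [h3, div_le_div_iff₀ (by norm_num) (by positivity)]
    rcases le_total (‖y‖ ^ 2) 1 with h | h
    · rw [min_eq_right h]; nlinarith
    · rw [min_eq_left h]; nlinarith
  rw [weight]; linarith

/-- The measure with density `weight`. -/
def weighted {d : ℕ} (κ : Measure (Eucl d)) : Measure (Eucl d) :=
  κ.withDensity fun y => ENNReal.ofReal (weight y)

theorem integrable_weight {d : ℕ} {κ : Measure (Eucl d)}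
    (h : Integrable (fun y : Eucl d => min 1 (‖y‖ ^ 2)) κ) : Integrable weight κ :=
  h.mono' continuous_weight.aestronglyMeasurable (.of_forall fun y => by
    rw [Real.norm_of_nonneg (weight_nonneg y)]; exact weight_le y)

theorem isFiniteMeasure_weighted {d : ℕ} {κ : Measure (Eucl d)}
    (h : Integrable (fun y : Eucl d => min 1 (‖y‖ ^ 2)) κ) : IsFiniteMeasure (weighted κ) :=
  isFiniteMeasure_withDensity_ofReal (integrable_weight h).2

theorem integral_weighted {d : ℕ} (κ : Measure (Eucl d)) {G : Type*} [NormedAddCommGroup G]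
    [NormedSpace ℝ G] (g : Eucl d → G) : ∫ y, g y ∂(weighted κ) = ∫ y, weight y • g y ∂κ := by
  rw [weighted, integral_withDensity_eq_integral_toReal_smul
    (continuous_weight.measurable.ennreal_ofReal) (.of_forall fun y => ENNReal.ofReal_lt_top)]
  simp only [ENNReal.toReal_ofReal (weight_nonneg _)]

theorem one_sub_cos_le {d : ℕ} (y ξ : Eucl d) :
    1 - Real.cos (inner ℝ y ξ) ≤ 2 * (1 + ‖ξ‖ ^ 2) * min 1 (‖y‖ ^ 2) := by
  rcases le_or_gt ‖y‖ 1 with h | h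
  · rw [min_eq_right (pow_le_one₀ (norm_nonneg _) h)]
    have := Real.one_sub_sq_div_two_le_cos (x := inner ℝ y ξ)
    nlinarith [sq_inner_le y ξ, sq_nonneg ‖y‖, mul_nonneg (sq_nonneg ‖y‖) (sq_nonneg ‖ξ‖)]
  · rw [min_eq_left (one_le_pow₀ h.le)]
    nlinarith [Real.neg_one_le_cos (inner ℝ y ξ), sq_nonneg ‖ξ‖]

theorem integrable_one_add_sq_stdGaussian {d : ℕ} :
    Integrable (fun ξ : Eucl d => 1 + ‖ξ‖ ^ 2) (stdGaussian (Eucl d)) := by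
  refine (integrable_const 1).add ?_
  have := (IsGaussian.memLp_two_id (μ := stdGaussian (Eucl d))).integrable_norm_pow (by norm_num)
  simpa using this

/-- The real part of the Gaussian characteristic function. This identity dictates the choice of
`weight`. -/
theorem integral_one_sub_cos_stdGaussian {d : ℕ} (y : Eucl d) :
    ∫ ξ, (1 - Real.cos (inner ℝ y ξ)) ∂(stdGaussian (Eucl d)) = weight y := by
  have h1 := charFun_stdGaussian (E := Eucl d) y
  rw [charFun_apply] at h1
  have hi : Integrable (fun ξ : Eucl d => Complex.exp ((inner ℝ ξ y : ℝ) * Complex.I))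
      (stdGaussian (Eucl d)) :=
    Integrable.of_bound (Continuous.aestronglyMeasurable (by fun_prop)) 1
      (.of_forall fun ξ => (Complex.norm_exp_ofReal_mul_I _).le)
  have h2 := integral_re hi
  rw [h1] at h2
  have h3 : ∀ ξ : Eucl d, RCLike.re (Complex.exp ((inner ℝ ξ y : ℝ) * Complex.I)) =
      Real.cos (inner ℝ y ξ) := fun ξ => by
    rw [real_inner_comm]; exact Complex.exp_ofReal_mul_I_re _
  simp only [h3] at h2
  have hic : Integrable (fun ξ : Eucl d => Real.cos (inner ℝ y ξ)) (stdGaussian (Eucl d)) :=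
    Integrable.of_bound (Continuous.aestronglyMeasurable (by fun_prop)) 1
      (.of_forall fun ξ => Real.abs_cos_le_one _)
  rw [integral_sub (integrable_const _) hic, h2, weight]
  have h4 : Complex.exp (-(‖y‖ : ℂ) ^ 2 / 2) = ((Real.exp (-‖y‖ ^ 2 / 2) : ℝ) : ℂ) := by
    push_cast; rfl
  simp only [integral_const, probReal_univ, one_smul]
  have h5 := congrArg Complex.re h4
  rw [Complex.ofReal_re] at h5
  exact congrArg (fun r : ℝ => 1 - r) h5

/-- Fubini; the bound by (1 + |ξ|²)(1 ∧ |y|²) makes it valid for infinite Lévy measures as well. -/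
theorem charFun_weighted {d : ℕ} {κ : Measure (Eucl d)} [SFinite κ]
    (h : Integrable (fun y : Eucl d => min 1 (‖y‖ ^ 2)) κ) (η : Eucl d) :
    Integrable (fun ξ => ∫ y, Complex.exp ((inner ℝ y η : ℝ) * Complex.I) *
      ((1 - Real.cos (inner ℝ y ξ) : ℝ) : ℂ) ∂κ) (stdGaussian (Eucl d)) ∧
    charFun (weighted κ) η = ∫ ξ, ∫ y, Complex.exp ((inner ℝ y η : ℝ) * Complex.I) *
      ((1 - Real.cos (inner ℝ y ξ) : ℝ) : ℂ) ∂κ ∂(stdGaussian (Eucl d)) := by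
  have hprod : Integrable (fun p : Eucl d × Eucl d =>
      Complex.exp ((inner ℝ p.2 η : ℝ) * Complex.I) *
      ((1 - Real.cos (inner ℝ p.2 p.1) : ℝ) : ℂ)) ((stdGaussian (Eucl d)).prod κ) := by
    refine ((integrable_one_add_sq_stdGaussian.const_mul 2).mul_prod h).mono'
      (Continuous.aestronglyMeasurable (by fun_prop)) (.of_forall fun p => ?_)
    rw [norm_mul, Complex.norm_exp_ofReal_mul_I, one_mul, Complex.norm_real, Real.norm_of_nonneg
      (by linarith [Real.cos_le_one (inner ℝ p.2 p.1)])]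
    exact one_sub_cos_le p.2 p.1
  refine ⟨hprod.integral_prod_left, ?_⟩
  rw [integral_integral_swap hprod, charFun_apply, integral_weighted]
  refine integral_congr_ae (.of_forall fun y => ?_)
  simp only
  rw [integral_const_mul, integral_complex_ofReal, integral_one_sub_cos_stdGaussian,
    Complex.real_smul, mul_comm]

/-- The symmetric second difference `g(η) - (g(η + ξ) + g(η - ξ)) / 2`. -/
def secondDiff {d : ℕ} (g : Eucl d → ℂ) (η ξ : Eucl d) : ℂ := g η - (g (η + ξ) + g (η - ξ)) / 2

theorem secondDiff_exp {d : ℕ} (y η ξ : Eucl d) :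
    secondDiff (fun ξ => Complex.exp ((inner ℝ y ξ : ℝ) * Complex.I)) η ξ =
      Complex.exp ((inner ℝ y η : ℝ) * Complex.I) * ((1 - Real.cos (inner ℝ y ξ) : ℝ) : ℂ) := by
  simp only [secondDiff, inner_add_right, inner_sub_right, Complex.ofReal_sub, Complex.ofReal_one,
    Complex.ofReal_add, Complex.ofReal_cos, Complex.cos, add_mul, sub_mul, Complex.exp_add,
    Complex.exp_sub, neg_mul, Complex.exp_neg]
  ring

theorem secondDiff_integral {d : ℕ} {κ : Measure (Eucl d)} {k : Eucl d → Eucl d → ℂ}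
    (hk : ∀ ξ, Integrable (k ξ) κ) (η ξ : Eucl d) :
    secondDiff (fun ξ => ∫ y, k ξ y ∂κ) η ξ = ∫ y, secondDiff (fun ξ => k ξ y) η ξ ∂κ := by
  have h1 : Integrable (fun y => (k (η + ξ) y + k (η - ξ) y) / 2) κ :=
    ((hk (η + ξ)).add (hk (η - ξ))).div_const 2
  simp only [secondDiff]
  rw [integral_sub (hk η) h1, integral_div, integral_add (hk _) (hk _)]

theorem secondDiff_charFun {d : ℕ} (μ : Measure (Eucl d)) [IsFiniteMeasure μ] (η ξ : Eucl d) :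
    secondDiff (charFun μ) η ξ = ∫ y, Complex.exp ((inner ℝ y η : ℝ) * Complex.I) *
      ((1 - Real.cos (inner ℝ y ξ) : ℝ) : ℂ) ∂μ := by
  have hi : ∀ ξ : Eucl d, Integrable (fun y => Complex.exp ((inner ℝ y ξ : ℝ) * Complex.I)) μ :=
    fun ξ => Integrable.of_bound (Continuous.aestronglyMeasurable (by fun_prop)) 1
      (.of_forall fun y => (Complex.norm_exp_ofReal_mul_I _).le)
  have := secondDiff_integral hi η ξ
  simp only [secondDiff_exp] at this
  rw [← this]
  rfl

section Triplet

variable {d : ℕ} (τ : LevyTriplet d)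

theorem LevyTriplet.secondDiff_quad (η ξ : Eucl d) :
    τ.quad η - (τ.quad (η + ξ) + τ.quad (η - ξ)) / 2 = -τ.quad ξ := by
  simp only [LevyTriplet.quad, PiLp.add_apply, PiLp.sub_apply, ← Finset.sum_add_distrib,
    ← Finset.sum_sub_distrib, Finset.sum_div, ← Finset.sum_neg_distrib]
  refine Finset.sum_congr rfl fun i _ => Finset.sum_congr rfl fun j _ => ?_
  ring

/-- A second difference removes constants and linear terms, hence the drift and the truncation; what
remains is the quadratic form and the integral of 1 - cos. -/
theorem LevyTriplet.secondDiff_exponent (η ξ : Eucl d) :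
    secondDiff τ.exponent η ξ = ((1 / 2 * τ.quad ξ : ℝ) : ℂ) +
      ∫ y, Complex.exp ((inner ℝ y η : ℝ) * Complex.I) *
        ((1 - Real.cos (inner ℝ y ξ) : ℝ) : ℂ) ∂τ.ν := by
  have h1 := secondDiff_integral τ.integrable_levyKernel η ξ
  have h2 : ∀ y : Eucl d, secondDiff (fun ξ => levyKernel ξ y) η ξ =
      Complex.exp ((inner ℝ y η : ℝ) * Complex.I) * ((1 - Real.cos (inner ℝ y ξ) : ℝ) : ℂ) := by
    intro y
    rw [← secondDiff_exp]
    simp only [secondDiff, levyKernel, inner_add_right, inner_sub_right, Complex.ofReal_add,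
      Complex.ofReal_sub, mul_comm Complex.I]
    ring
  simp only [h2] at h1
  rw [← h1]
  have h3 : τ.quad ξ = -(τ.quad η - (τ.quad (η + ξ) + τ.quad (η - ξ)) / 2) := by
    rw [τ.secondDiff_quad]; ring
  rw [h3]
  simp only [secondDiff, τ.exponent_eq, inner_add_right, inner_sub_right]
  push_cast
  ring

/-- The limit of the measures `t⁻¹ (1 - exp(-|y|²/2)) P(Y_t ∈ dy)` as `t ↓ 0`. -/
def LevyTriplet.limitMeasure : Measure (Eucl d) :=
  weighted τ.ν + ENNReal.ofReal (∫ ξ, 1 / 2 * τ.quad ξ ∂(stdGaussian (Eucl d))) • Measure.dirac 0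

instance LevyTriplet.isFiniteMeasure_limitMeasure : IsFiniteMeasure τ.limitMeasure := by
  have := isFiniteMeasure_weighted τ.integrable_min
  have h2 : IsFiniteMeasure (ENNReal.ofReal (∫ ξ, 1 / 2 * τ.quad ξ ∂(stdGaussian (Eucl d))) •
    (Measure.dirac 0 : Measure (Eucl d))) := Measure.smul_finite _ ENNReal.ofReal_ne_top
  unfold LevyTriplet.limitMeasure
  infer_instance

theorem LevyTriplet.integral_limitMeasure {G : Type*} [NormedAddCommGroup G] [NormedSpace ℝ G]
    [CompleteSpace G] {g : Eucl d → G} {C : ℝ} (hg : Continuous g) (hC : ∀ y, ‖g y‖ ≤ C) :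
    ∫ y, g y ∂τ.limitMeasure = ∫ y, weight y • g y ∂τ.ν +
      (∫ ξ, 1 / 2 * τ.quad ξ ∂(stdGaussian (Eucl d))) • g 0 := by
  have h1 := isFiniteMeasure_weighted τ.integrable_min
  rw [LevyTriplet.limitMeasure, integral_add_measure, integral_weighted, integral_smul_measure,
    integral_dirac, ENNReal.toReal_ofReal]
  · exact integral_nonneg fun ξ => mul_nonneg (by norm_num) (τ.quad_nonneg ξ)
  · exact Integrable.of_bound hg.aestronglyMeasurable C (.of_forall hC)
  · exact (integrable_dirac (by simp)).smul_measure ENNReal.ofReal_ne_top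

/-- The Gaussian part of the second difference does not depend on η, so after averaging over ξ it is
the characteristic function of an atom at 0. -/
theorem LevyTriplet.charFun_limitMeasure (η : Eucl d) :
    charFun τ.limitMeasure η = ∫ ξ, secondDiff τ.exponent η ξ ∂(stdGaussian (Eucl d)) := by
  have := τ.sFinite
  obtain ⟨h1, h2⟩ := charFun_weighted τ.integrable_min η
  have hq : Integrable (fun ξ => 1 / 2 * τ.quad ξ) (stdGaussian (Eucl d)) := by
    obtain ⟨C, hC0, hC⟩ := τ.quad_le
    refine (integrable_one_add_sq_stdGaussian.const_mul C).mono'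
      (τ.continuous_quad.const_mul _ |>.aestronglyMeasurable) (.of_forall fun ξ => ?_)
    rw [Real.norm_of_nonneg (mul_nonneg (by norm_num) (τ.quad_nonneg ξ))]
    linarith [hC ξ, τ.quad_nonneg ξ]
  simp only [τ.secondDiff_exponent]
  have hq' : Integrable (fun ξ => ((1 / 2 * τ.quad ξ : ℝ) : ℂ)) (stdGaussian (Eucl d)) := hq.ofReal
  rw [integral_add hq' h1, ← h2, integral_complex_ofReal, charFun_apply,
    τ.integral_limitMeasure (C := 1) (by fun_prop)
      (fun y => (Complex.norm_exp_ofReal_mul_I _).le), charFun_apply, integral_weighted]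
  simp [add_comm]

/-- The measure `t⁻¹ (1 - exp(-|y|²/2)) μ(dy)`. -/
def rescaled (t : ℝ) (μ : Measure (Eucl d)) : Measure (Eucl d) :=
  ENNReal.ofReal t⁻¹ • weighted μ

theorem integrable_min_of_isFiniteMeasure (μ : Measure (Eucl d)) [IsFiniteMeasure μ] :
    Integrable (fun y : Eucl d => min 1 (‖y‖ ^ 2)) μ :=
  Integrable.of_bound (Continuous.aestronglyMeasurable (by fun_prop)) 1 (.of_forall fun y => by
    rw [Real.norm_of_nonneg (by positivity)]; exact min_le_left _ _)

instance isFiniteMeasure_rescaled (t : ℝ) (μ : Measure (Eucl d)) [IsFiniteMeasure μ] :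
    IsFiniteMeasure (rescaled t μ) := by
  have := isFiniteMeasure_weighted (integrable_min_of_isFiniteMeasure μ)
  exact Measure.smul_finite _ ENNReal.ofReal_ne_top

theorem integral_rescaled {t : ℝ} (ht : 0 < t) (μ : Measure (Eucl d)) {G : Type*}
    [NormedAddCommGroup G] [NormedSpace ℝ G] (g : Eucl d → G) :
    ∫ y, g y ∂(rescaled t μ) = t⁻¹ • ∫ y, weight y • g y ∂μ := by
  rw [rescaled, integral_smul_measure, integral_weighted, ENNReal.toReal_ofReal (by positivity)]

theorem LevyTriplet.tendsto_charFun_rescaled {t : ℕ → ℝ} (ht : ∀ n, 0 < t n)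
    (ht0 : Tendsto t atTop (𝓝 0)) {μ : ℕ → Measure (Eucl d)} [∀ n, IsProbabilityMeasure (μ n)]
    (hμ : ∀ n ξ, charFun (μ n) ξ = Complex.exp (t n * τ.exponent ξ)) (η : Eucl d) :
    Tendsto (fun n => charFun (rescaled (t n) (μ n)) η) atTop
      (𝓝 (charFun τ.limitMeasure η)) := by
  -- Subtracting 1 does not change second differences, but it makes the quotient converge to the
  -- exponent.
  set g : ℕ → Eucl d → ℂ := fun n ξ => (((t n)⁻¹ : ℝ) : ℂ) * (charFun (μ n) ξ - 1) with hg
  have hchar : ∀ n, charFun (rescaled (t n) (μ n)) η =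
      ∫ ξ, secondDiff (g n) η ξ ∂(stdGaussian (Eucl d)) := by
    intro n
    have h1 := (charFun_weighted (integrable_min_of_isFiniteMeasure (μ n)) η).2
    simp only [← secondDiff_charFun] at h1
    have h2 : ∀ ξ, secondDiff (g n) η ξ = (((t n)⁻¹ : ℝ) : ℂ) * secondDiff (charFun (μ n)) η ξ := by
      intro ξ
      simp only [secondDiff, hg]; ring
    simp only [h2]
    rw [integral_const_mul, ← h1, charFun_apply, integral_rescaled (ht n), charFun_apply,
      integral_weighted, Complex.real_smul]
  simp only [hchar]
  rw [τ.charFun_limitMeasure]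
  obtain ⟨C, hC0, hC⟩ := τ.norm_exponent_le
  have hgC : ∀ n ξ, ‖g n ξ‖ ≤ C * (1 + ‖ξ‖ ^ 2) := by
    intro n ξ
    simp only [hg, hμ]
    refine (norm_exp_sub_one_div_le (ht n) ?_).trans (hC ξ)
    rw [← hμ]
    exact norm_charFun_le_one ξ
  have hglim : ∀ ξ, Tendsto (fun n => g n ξ) atTop (𝓝 (τ.exponent ξ)) := by
    intro ξ
    simp only [hg, hμ]
    exact tendsto_exp_sub_one_div _ ht ht0
  refine tendsto_integral_of_dominated_convergence
    (fun ξ => 3 * C * (1 + ‖η‖ ^ 2) * (1 + ‖ξ‖ ^ 2)) (fun n => ?_)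
    (integrable_one_add_sq_stdGaussian.const_mul _) (fun n => .of_forall fun ξ => ?_)
    (.of_forall fun ξ => ?_)
  · have : Continuous (g n) := by
      have := continuous_charFun (μ := μ n)
      fun_prop
    unfold secondDiff
    exact Continuous.aestronglyMeasurable (by fun_prop)
  · have h1 := hgC n η
    have h2 := hgC n (η + ξ)
    have h3 := hgC n (η - ξ)
    have h4 : ‖η + ξ‖ ^ 2 + ‖η - ξ‖ ^ 2 = 2 * (‖η‖ ^ 2 + ‖ξ‖ ^ 2) := by
      have := parallelogram_law_with_norm ℝ η ξ
      nlinarith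
    have h5 : ‖(g n (η + ξ) + g n (η - ξ)) / 2‖ ≤ (‖g n (η + ξ)‖ + ‖g n (η - ξ)‖) / 2 := by
      rw [norm_div, Complex.norm_ofNat]
      gcongr
      exact norm_add_le _ _
    have h6 := norm_sub_le (g n η) ((g n (η + ξ) + g n (η - ξ)) / 2)
    have h7 : ‖secondDiff (g n) η ξ‖ ≤ C * (2 + 2 * ‖η‖ ^ 2 + ‖ξ‖ ^ 2) := by
      have h8 : C * (2 + 2 * ‖η‖ ^ 2 + ‖ξ‖ ^ 2) = C * (1 + ‖η‖ ^ 2) +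
          (C * (1 + ‖η + ξ‖ ^ 2) + C * (1 + ‖η - ξ‖ ^ 2)) / 2 := by
        linear_combination (-C / 2) * h4
      rw [h8]
      exact h6.trans (by linarith)
    refine h7.trans ?_
    have h9 : 2 + 2 * ‖η‖ ^ 2 + ‖ξ‖ ^ 2 ≤ 3 * (1 + ‖η‖ ^ 2) * (1 + ‖ξ‖ ^ 2) := by
      nlinarith [sq_nonneg ‖η‖, sq_nonneg ‖ξ‖, mul_nonneg (sq_nonneg ‖η‖) (sq_nonneg ‖ξ‖)]
    calc C * (2 + 2 * ‖η‖ ^ 2 + ‖ξ‖ ^ 2) ≤ C * (3 * (1 + ‖η‖ ^ 2) * (1 + ‖ξ‖ ^ 2)) := by gcongr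
      _ = _ := by ring
  · exact (hglim η).sub (((hglim (η + ξ)).add (hglim (η - ξ))).div_const 2)

/-- The condition `h0` discards the atom of the limit measure at 0, so only ν remains. -/
theorem LevyTriplet.tendsto_integral_rescaled {t : ℕ → ℝ} (ht : ∀ n, 0 < t n)
    (ht0 : Tendsto t atTop (𝓝 0)) {μ : ℕ → Measure (Eucl d)} [∀ n, IsProbabilityMeasure (μ n)]
    (hμ : ∀ n ξ, charFun (μ n) ξ = Complex.exp (t n * τ.exponent ξ))
    {q : ℕ → Eucl d → ℝ} {q₀ : Eucl d → ℝ} {C : ℝ} (hq : ∀ n, Continuous (q n))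
    (hq₀ : Continuous q₀) (hC : ∀ n z, ‖q n z‖ ≤ C) (hC₀ : ∀ z, ‖q₀ z‖ ≤ C)
    (hlim : ∀ z, Tendsto (fun p : ℕ × Eucl d => q p.1 p.2) (atTop ×ˢ 𝓝 z) (𝓝 (q₀ z)))
    (h0 : q₀ 0 = 0) :
    Tendsto (fun n => (t n)⁻¹ * ∫ y, weight y * q n y ∂(μ n)) atTop
      (𝓝 (∫ y, weight y * q₀ y ∂τ.ν)) := by
  have := tendsto_integral_of_tendsto_charFun (τ.tendsto_charFun_rescaled ht ht0 hμ)
    hq hq₀ hC hC₀ hlim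
  rw [τ.integral_limitMeasure hq₀ hC₀, h0, smul_zero, add_zero] at this
  simp only [integral_rescaled (ht _)] at this
  exact this

theorem LevyTriplet.exists_bound_integral_weight {t : ℕ → ℝ} (ht : ∀ n, 0 < t n)
    (ht0 : Tendsto t atTop (𝓝 0)) {μ : ℕ → Measure (Eucl d)} [∀ n, IsProbabilityMeasure (μ n)]
    (hμ : ∀ n ξ, charFun (μ n) ξ = Complex.exp (t n * τ.exponent ξ)) :
    ∃ C : ℝ, 0 ≤ C ∧ ∀ n, (t n)⁻¹ * ∫ y, weight y ∂(μ n) ≤ C := by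
  have := tendsto_integral_of_tendsto_charFun (τ.tendsto_charFun_rescaled ht ht0 hμ)
    (f := fun _ _ => 1) (f₀ := fun _ => 1) (C := 1) (fun _ => continuous_const) continuous_const
    (by simp) (by simp) (fun _ => tendsto_const_nhds)
  simp only [integral_rescaled (ht _)] at this
  obtain ⟨C, hC⟩ := this.bddAbove_range
  refine ⟨|C|, abs_nonneg C, fun n => (le_trans ?_ (hC ⟨n, rfl⟩)).trans (le_abs_self C)⟩
  simp

end Triplet

/-! ### Taylor expansion of `C_b²` functions -/

section Taylor

variable {d : ℕ} {f : Eucl d → ℝ}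

theorem MemCb.exists_bound (hf : MemCb 2 f) :
    ∃ C : ℝ, 0 ≤ C ∧ (∀ x, ‖f x‖ ≤ C) ∧ (∀ x, ‖fderiv ℝ f x‖ ≤ C) ∧
      ∀ x, ‖fderiv ℝ (fderiv ℝ f) x‖ ≤ C := by
  obtain ⟨C0, h0⟩ := hf.2 0 (by norm_num)
  obtain ⟨C1, h1⟩ := hf.2 1 (by norm_num)
  obtain ⟨C2, h2⟩ := hf.2 2 le_rfl
  refine ⟨max C0 (max C1 C2), ?_, fun x => ?_, fun x => ?_, fun x => ?_⟩
  · exact ((norm_nonneg _).trans (h0 0)).trans (le_max_left _ _)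
  · rw [← norm_iteratedFDeriv_zero (𝕜 := ℝ)]
    exact (h0 x).trans (le_max_left _ _)
  · rw [← norm_iteratedFDeriv_one (𝕜 := ℝ)]
    exact (h1 x).trans ((le_max_left _ _).trans (le_max_right _ _))
  · rw [← norm_iteratedFDeriv_one (𝕜 := ℝ), norm_iteratedFDeriv_fderiv]
    exact (h2 x).trans ((le_max_right _ _).trans (le_max_right _ _))

theorem MemCb.contDiff_two (hf : MemCb 2 f) : ContDiff ℝ 2 f := by exact_mod_cast hf.1

theorem MemCb.differentiable (hf : MemCb 2 f) : Differentiable ℝ f :=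
  hf.contDiff_two.differentiable (by norm_num)

theorem MemCb.contDiff_fderiv (hf : MemCb 2 f) : ContDiff ℝ 1 (fderiv ℝ f) :=
  hf.contDiff_two.fderiv_right (by norm_num)

theorem MemCb.differentiable_fderiv (hf : MemCb 2 f) : Differentiable ℝ (fderiv ℝ f) :=
  hf.contDiff_fderiv.differentiable (by norm_num)

theorem MemCb.continuous_fderiv (hf : MemCb 2 f) : Continuous (fderiv ℝ f) :=
  hf.contDiff_fderiv.continuous

theorem MemCb.continuous_fderiv_fderiv (hf : MemCb 2 f) : Continuous (fderiv ℝ (fderiv ℝ f)) :=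
  hf.contDiff_fderiv.continuous_fderiv (by norm_num)

theorem abs_add_sub_sub_fderiv_le (hf : MemCb 2 f) {C : ℝ}
    (hC : ∀ x, ‖fderiv ℝ (fderiv ℝ f) x‖ ≤ C) (x y : Eucl d) :
    |f (x + y) - f x - fderiv ℝ f x y| ≤ C * ‖y‖ ^ 2 := by
  have hlip : ∀ z, ‖fderiv ℝ f z - fderiv ℝ f x‖ ≤ C * ‖z - x‖ := fun z =>
    convex_univ.norm_image_sub_le_of_norm_fderiv_le (fun z _ => hf.differentiable_fderiv z)
      (fun z _ => hC z) (Set.mem_univ x) (Set.mem_univ z)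
  have hC0 : 0 ≤ C := le_trans (norm_nonneg (fderiv ℝ (fderiv ℝ f) 0)) (hC 0)
  have h := (convex_closedBall x ‖y‖).norm_image_sub_le_of_norm_hasFDerivWithin_le' (𝕜 := ℝ)
    (f := f) (f' := fderiv ℝ f) (φ := fderiv ℝ f x) (C := C * ‖y‖) (x := x) (y := x + y)
    (fun z _ => (hf.differentiable z).hasFDerivAt.hasFDerivWithinAt)
    (fun z hz => (hlip z).trans (by
      gcongr
      exact mem_closedBall_iff_norm.1 hz)) (by simp) (by simp)
  simpa [sq, mul_assoc] using h

/-- The Hessian is continuous but perhaps not uniformly so; the expansion is therefore uniform only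
for x near x₀, which suffices for convergent base points. -/
theorem exists_abs_sub_taylor_le (hf : MemCb 2 f) (x₀ : Eucl d) {ε : ℝ} (hε : 0 < ε) :
    ∃ δ > 0, ∀ x y, ‖x - x₀‖ < δ → ‖y‖ < δ →
      |f (x + y) - f x - fderiv ℝ f x y - 1 / 2 * fderiv ℝ (fderiv ℝ f) x y y| ≤ ε * ‖y‖ ^ 2 := by
  obtain ⟨δ, hδ, hcont⟩ := (Metric.continuousAt_iff (f := fderiv ℝ (fderiv ℝ f)) (a := x₀)).1
    hf.continuous_fderiv_fderiv.continuousAt (ε / 2) (by positivity)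
  have hcont : ∀ z, ‖z - x₀‖ < δ →
      ‖fderiv ℝ (fderiv ℝ f) z - fderiv ℝ (fderiv ℝ f) x₀‖ < ε / 2 := fun z hz =>
    (dist_eq_norm (fderiv ℝ (fderiv ℝ f) z) (fderiv ℝ (fderiv ℝ f) x₀)).symm.trans_lt
      (hcont (by rwa [dist_eq_norm]))
  -- Half of `δ` for `x` and half for `y` keep the whole ball of radius |y| around `x` within `δ` of
  -- `x₀`.
  refine ⟨δ / 2, by positivity, fun x y hx hy => ?_⟩
  have hx' := hcont x (by linarith)
  have hH : ∀ z ∈ Metric.closedBall x ‖y‖,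
      ‖fderiv ℝ (fderiv ℝ f) z - fderiv ℝ (fderiv ℝ f) x‖ ≤ ε := by
    intro z hz
    rw [mem_closedBall_iff_norm] at hz
    have h1 := hcont z (by linarith [norm_sub_le_norm_sub_add_norm_sub z x x₀])
    have h2 := norm_sub_le_norm_sub_add_norm_sub (fderiv ℝ (fderiv ℝ f) z)
      (fderiv ℝ (fderiv ℝ f) x₀) (fderiv ℝ (fderiv ℝ f) x)
    rw [norm_sub_rev (fderiv ℝ (fderiv ℝ f) x₀)] at h2
    linarith
  set B := fderiv ℝ (fderiv ℝ f) x with hB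
  have hgrad : ∀ z ∈ Metric.closedBall x ‖y‖,
      ‖fderiv ℝ f z - fderiv ℝ f x - B (z - x)‖ ≤ ε * ‖z - x‖ := fun z hz =>
    (convex_closedBall x ‖y‖).norm_image_sub_le_of_norm_hasFDerivWithin_le' (𝕜 := ℝ)
      (fun z _ => (hf.differentiable_fderiv z).hasFDerivAt.hasFDerivWithinAt) hH (by simp) hz
  have hderiv : ∀ s : ℝ, HasDerivAt
      (fun s : ℝ => f (x + s • y) - s * fderiv ℝ f x y - 1 / 2 * s ^ 2 * B y y)
      (fderiv ℝ f (x + s • y) y - fderiv ℝ f x y - s * B y y) s := by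
    intro s
    have h1 : HasDerivAt (fun s : ℝ => x + s • y) y s := by
      simpa using ((hasDerivAt_id s).smul_const y).const_add x
    have h2 := (hf.differentiable (x + s • y)).hasFDerivAt.comp_hasDerivAt s h1
    have h3 : HasDerivAt (fun s : ℝ => s * fderiv ℝ f x y) (fderiv ℝ f x y) s := by
      simpa using (hasDerivAt_id s).mul_const (fderiv ℝ f x y)
    have h4 : HasDerivAt (fun s : ℝ => 1 / 2 * s ^ 2 * B y y) (s * B y y) s := by
      exact (((hasDerivAt_pow 2 s).const_mul (1 / 2 : ℝ)).mul_const (B y y)).congr_deriv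
        (by push_cast; ring)
    exact (h2.sub h3).sub h4
  have hbound : ∀ s ∈ Set.Ico (0 : ℝ) 1,
      ‖fderiv ℝ f (x + s • y) y - fderiv ℝ f x y - s * B y y‖ ≤ ε * ‖y‖ ^ 2 := by
    intro s hs
    have hsy : ‖s • y‖ ≤ ‖y‖ := by
      rw [norm_smul, Real.norm_of_nonneg hs.1]
      exact mul_le_of_le_one_left (norm_nonneg _) hs.2.le
    have h1 := hgrad (x + s • y) (by simpa using hsy)
    rw [add_sub_cancel_left] at h1
    have h2 : fderiv ℝ f (x + s • y) y - fderiv ℝ f x y - s * B y y =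
        (fderiv ℝ f (x + s • y) - fderiv ℝ f x - B (s • y)) y := by simp
    rw [h2]
    refine (ContinuousLinearMap.le_opNorm _ _).trans ?_
    calc _ ≤ (ε * ‖s • y‖) * ‖y‖ := by gcongr
      _ ≤ (ε * ‖y‖) * ‖y‖ := by gcongr
      _ = ε * ‖y‖ ^ 2 := by ring
  have := norm_image_sub_le_of_norm_deriv_le_segment_01'
    (fun s _ => (hderiv s).hasDerivWithinAt) hbound
  rw [Real.norm_eq_abs] at this
  refine le_trans (le_of_eq ?_) this
  congr 1
  simp
  ring

/-! ### The trigonometric second-order approximation -/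

/-- The vector `(sin y_i)_i`. -/
def sinVec (y : Eucl d) : Eucl d := WithLp.toLp 2 fun i => Real.sin (y i)

theorem sinVec_apply (y : Eucl d) (i : Fin d) : sinVec y i = Real.sin (y i) := rfl

theorem continuous_sinVec : Continuous (sinVec : Eucl d → Eucl d) := by
  unfold sinVec
  fun_prop

theorem norm_le_of_abs_apply_le {v : Eucl d} {a : ℝ} (ha : 0 ≤ a) (h : ∀ i, |v i| ≤ a) :
    ‖v‖ ≤ √d * a := by
  refine abs_le_of_sq_le_sq' ?_ (by positivity) |>.2
  rw [EuclideanSpace.norm_sq_eq, mul_pow, Real.sq_sqrt (by positivity)]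
  calc ∑ i, ‖v i‖ ^ 2 ≤ ∑ _i : Fin d, a ^ 2 := by
        gcongr with i
        exact h i
    _ = d * a ^ 2 := by simp

theorem abs_apply_le_norm (y : Eucl d) (i : Fin d) : |y i| ≤ ‖y‖ := PiLp.norm_apply_le y i

theorem norm_sinVec_le_one (y : Eucl d) : ‖sinVec y‖ ≤ √d := by
  simpa using norm_le_of_abs_apply_le (v := sinVec y) zero_le_one fun i => Real.abs_sin_le_one _

theorem norm_sinVec_le (y : Eucl d) : ‖sinVec y‖ ≤ √d * ‖y‖ :=
  norm_le_of_abs_apply_le (norm_nonneg y) fun i =>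
    Real.abs_sin_le_abs.trans (abs_apply_le_norm y i)

theorem abs_sin_sub_self_le (u : ℝ) : |Real.sin u - u| ≤ 2 * |u| ^ 3 := by
  rcases le_or_gt |u| 1 with h | h
  · have h1 := Real.sin_bound h
    have h2 : |Real.sin u - u| ≤ |Real.sin u - (u - u ^ 3 / 6)| + |u ^ 3 / 6| := by
      have := abs_sub (Real.sin u - (u - u ^ 3 / 6)) (u ^ 3 / 6)
      rwa [show Real.sin u - (u - u ^ 3 / 6) - u ^ 3 / 6 = Real.sin u - u by ring] at this
    have h3 : |u ^ 3 / 6| = |u| ^ 3 / 6 := by rw [abs_div, abs_pow]; norm_num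
    have h4 : |u| ^ 5 ≤ |u| ^ 3 := pow_le_pow_of_le_one (abs_nonneg u) h (by norm_num)
    have h5 : 0 ≤ |u| ^ 3 := by positivity
    rw [h3] at h2
    linarith
  · have h1 := abs_sub (Real.sin u) u
    have h2 := Real.abs_sin_le_abs (x := u)
    have h3 : |u| ≤ |u| ^ 3 := le_self_pow₀ h.le (by norm_num)
    linarith

theorem norm_sinVec_sub_le (y : Eucl d) : ‖sinVec y - y‖ ≤ 2 * √d * ‖y‖ ^ 3 := by
  have := norm_le_of_abs_apply_le (v := sinVec y - y) (a := 2 * ‖y‖ ^ 3) (by positivity)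
    fun i => (abs_sin_sub_self_le (y i)).trans (by gcongr; exact abs_apply_le_norm y i)
  linarith

/-- The remainder of the trigonometric second-order approximation of `f (x + y) - f x`. -/
def remainder (f : Eucl d → ℝ) (x y : Eucl d) : ℝ :=
  f (x + y) - f x - fderiv ℝ f x (sinVec y) -
    1 / 2 * fderiv ℝ (fderiv ℝ f) x (sinVec y) (sinVec y)

theorem remainder_zero (x : Eucl d) : remainder f x 0 = 0 := by
  have : sinVec (0 : Eucl d) = 0 := by ext i; simp [sinVec]
  simp [remainder, this]

theorem continuous_remainder (hf : MemCb 2 f) :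
    Continuous fun p : Eucl d × Eucl d => remainder f p.1 p.2 := by
  have h0 := hf.contDiff_two.continuous
  have h1 := hf.continuous_fderiv
  have h2 := hf.continuous_fderiv_fderiv
  have h3 := continuous_sinVec (d := d)
  unfold remainder
  fun_prop

/-- For |y| ≤ 1 this is Taylor's bound together with sin y - y = O(|y|³); for |y| > 1 every term is
bounded because the sine is. -/
theorem exists_abs_remainder_le (hf : MemCb 2 f) :
    ∃ A : ℝ, 0 ≤ A ∧ ∀ x y, |remainder f x y| ≤ A * weight y := by
  obtain ⟨C, hC0, hf0, hf1, hf2⟩ := hf.exists_bound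
  set K := √(d : ℝ)
  have hK : 0 ≤ K := Real.sqrt_nonneg _
  have key : ∀ x y, |remainder f x y| ≤ (2 * C + 2 * C * K + C * K ^ 2) * min 1 (‖y‖ ^ 2) := by
    intro x y
    have hB : ∀ a : ℝ, 0 ≤ a → ‖sinVec y‖ ≤ a →
        |1 / 2 * fderiv ℝ (fderiv ℝ f) x (sinVec y) (sinVec y)| ≤ 1 / 2 * (C * a * a) := by
      intro a ha h
      rw [abs_mul, abs_of_pos (by norm_num : (0 : ℝ) < 1 / 2)]
      gcongr
      exact (fderiv ℝ (fderiv ℝ f) x).le_of_opNorm₂_le_of_le (hf2 x) h h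
    rcases le_or_gt ‖y‖ 1 with h | h
    · rw [min_eq_right (pow_le_one₀ (norm_nonneg _) h)]
      have h1 := abs_add_sub_sub_fderiv_le hf hf2 x y
      have h2 : |fderiv ℝ f x (sinVec y - y)| ≤ C * (2 * K * ‖y‖ ^ 3) :=
        (fderiv ℝ f x).le_of_opNorm_le_of_le (hf1 x) (norm_sinVec_sub_le y)
      have h3 := hB (K * ‖y‖) (by positivity) (norm_sinVec_le y)
      have h4 : ‖y‖ ^ 3 ≤ ‖y‖ ^ 2 := pow_le_pow_of_le_one (norm_nonneg _) h (by norm_num)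
      have h5 : C * (2 * K * ‖y‖ ^ 3) ≤ C * (2 * K * ‖y‖ ^ 2) := by gcongr
      have h6 : remainder f x y = (f (x + y) - f x - fderiv ℝ f x y) -
          fderiv ℝ f x (sinVec y - y) -
          1 / 2 * fderiv ℝ (fderiv ℝ f) x (sinVec y) (sinVec y) := by
        rw [remainder, map_sub]; ring
      rw [h6]
      refine (abs_sub _ _).trans ((add_le_add_left (abs_sub _ _) _).trans ?_)
      have h7 : 0 ≤ C * ‖y‖ ^ 2 := by positivity
      have h8 : 0 ≤ C * K ^ 2 * ‖y‖ ^ 2 := by positivity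
      linarith
    · rw [min_eq_left (one_le_pow₀ h.le), remainder]
      have h2 : |fderiv ℝ f x (sinVec y)| ≤ C * K :=
        (fderiv ℝ f x).le_of_opNorm_le_of_le (hf1 x) (norm_sinVec_le_one y)
      have h3 := hB K hK (norm_sinVec_le_one y)
      have h4 : |f (x + y) - f x| ≤ C + C := (abs_sub _ _).trans (add_le_add (hf0 _) (hf0 _))
      refine (abs_sub _ _).trans ((add_le_add_left (abs_sub _ _) _).trans ?_)
      have h7 : 0 ≤ C * K := by positivity
      have h8 : 0 ≤ C * K ^ 2 := by positivity
      linarith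
  refine ⟨3 * (2 * C + 2 * C * K + C * K ^ 2), by positivity, fun x y => (key x y).trans ?_⟩
  have := min_le_weight y
  calc _ ≤ (2 * C + 2 * C * K + C * K ^ 2) * (3 * weight y) := by gcongr
    _ = _ := by ring

theorem eventually_abs_remainder_le (hf : MemCb 2 f) (x₀ : Eucl d) {ε : ℝ} (hε : 0 < ε) :
    ∀ᶠ p in 𝓝 (x₀, (0 : Eucl d)), |remainder f p.1 p.2| ≤ ε * weight p.2 := by
  obtain ⟨C, hC0, hf0, hf1, hf2⟩ := hf.exists_bound
  set K := √(d : ℝ)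
  have hK : 0 ≤ K := Real.sqrt_nonneg _
  obtain ⟨δ, hδ, htay⟩ := exists_abs_sub_taylor_le hf x₀ (ε := ε / 6) (by positivity)
  set A := 2 * C * K + C * K * (1 + K) with hA
  have hA0 : 0 ≤ A := by positivity
  -- `A` bounds the cubic cost of replacing y by sin y. Taylor and this cost contribute ε/6 each,
  -- and the factor 3 in `min_le_weight` turns ε/3 into ε.
  set δ' := min (min δ 1) (ε / 6 / (A + 1)) with hδ'
  have hδ'0 : 0 < δ' := by positivity
  filter_upwards [Metric.ball_mem_nhds (x₀, (0 : Eucl d)) hδ'0] with p hp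
  obtain ⟨x, y⟩ := p
  rw [Metric.mem_ball, Prod.dist_eq, max_lt_iff, dist_eq_norm, dist_zero_right] at hp
  obtain ⟨hx, hy⟩ := hp
  simp only at hx hy ⊢
  have hy1 : ‖y‖ ≤ 1 := hy.le.trans ((min_le_left _ _).trans (min_le_right _ _))
  have hyA : ‖y‖ * A ≤ ε / 6 := by
    have h1 : ‖y‖ ≤ ε / 6 / (A + 1) := hy.le.trans (min_le_right _ _)
    rw [le_div_iff₀ (by positivity)] at h1
    nlinarith [norm_nonneg y]
  have hδδ : δ' ≤ δ := (min_le_left _ _).trans (min_le_left _ _)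
  have h1 := htay x y (hx.trans_le hδδ) (hy.trans_le hδδ)
  have hs := norm_sinVec_sub_le y
  have h2 : |fderiv ℝ f x (sinVec y - y)| ≤ C * (2 * K * ‖y‖ ^ 3) :=
    (fderiv ℝ f x).le_of_opNorm_le_of_le (hf1 x) hs
  set B := fderiv ℝ (fderiv ℝ f) x with hBdef
  have h3 : |B (sinVec y - y) (sinVec y)| ≤ C * (2 * K * ‖y‖ ^ 3) * (K * ‖y‖) :=
    B.le_of_opNorm₂_le_of_le (hf2 x) hs (norm_sinVec_le y)
  have h4 : |B y (sinVec y - y)| ≤ C * ‖y‖ * (2 * K * ‖y‖ ^ 3) :=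
    B.le_of_opNorm₂_le_of_le (hf2 x) le_rfl hs
  have h6 : remainder f x y = (f (x + y) - f x - fderiv ℝ f x y - 1 / 2 * B y y) -
      fderiv ℝ f x (sinVec y - y) -
      1 / 2 * (B (sinVec y - y) (sinVec y) + B y (sinVec y - y)) := by
    rw [remainder, map_sub, map_sub, map_sub, sub_apply]; ring
  have h7 : |1 / 2 * (B (sinVec y - y) (sinVec y) + B y (sinVec y - y))| ≤
      1 / 2 * (C * (2 * K * ‖y‖ ^ 3) * (K * ‖y‖) + C * ‖y‖ * (2 * K * ‖y‖ ^ 3)) := by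
    rw [abs_mul, abs_of_pos (by norm_num : (0 : ℝ) < 1 / 2)]
    gcongr
    exact (abs_add_le _ _).trans (add_le_add h3 h4)
  have h8 : |remainder f x y| ≤ ε / 6 * ‖y‖ ^ 2 + ‖y‖ ^ 3 * A := by
    rw [h6]
    refine (abs_sub _ _).trans ((add_le_add (abs_sub _ _) h7).trans ?_)
    have h9 : C * K * (1 + K) * ‖y‖ ^ 3 * ‖y‖ ≤ C * K * (1 + K) * ‖y‖ ^ 3 * 1 := by gcongr
    have h10 : 1 / 2 * (C * (2 * K * ‖y‖ ^ 3) * (K * ‖y‖) + C * ‖y‖ * (2 * K * ‖y‖ ^ 3)) =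
      C * K * (1 + K) * ‖y‖ ^ 3 * ‖y‖ := by ring
    rw [h10]
    linarith
  have h9 : ‖y‖ ^ 3 * A ≤ ε / 6 * ‖y‖ ^ 2 := by
    calc ‖y‖ ^ 3 * A = ‖y‖ ^ 2 * (‖y‖ * A) := by ring
      _ ≤ ‖y‖ ^ 2 * (ε / 6) := by gcongr
      _ = _ := by ring
  have h10 := min_le_weight y
  rw [min_eq_right (pow_le_one₀ (norm_nonneg _) hy1)] at h10
  have h11 : ε / 3 * ‖y‖ ^ 2 ≤ ε / 3 * (3 * weight y) := by gcongr
  linarith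

theorem weight_pos {y : Eucl d} (hy : y ≠ 0) : 0 < weight y := by
  have h1 := min_le_weight y
  have h2 : 0 < min 1 (‖y‖ ^ 2) := by positivity
  linarith

/-- The remainder is o(|y|²) locally uniformly in x, so the value 0/0 = 0 at y = 0 is the continuous
extension. -/
theorem continuous_remainder_div_weight (hf : MemCb 2 f) :
    Continuous fun p : Eucl d × Eucl d => remainder f p.1 p.2 / weight p.2 := by
  rw [continuous_iff_continuousAt]
  rintro ⟨x₀, y₀⟩
  rcases eq_or_ne y₀ 0 with rfl | hy
  · rw [ContinuousAt, remainder_zero, zero_div, Metric.tendsto_nhds]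
    intro ε hε
    filter_upwards [eventually_abs_remainder_le hf x₀ (half_pos hε)] with p hp
    rw [dist_zero_right, Real.norm_eq_abs, abs_div, abs_of_nonneg (weight_nonneg _)]
    exact (div_le_of_le_mul₀ (weight_nonneg _) (half_pos hε).le hp).trans_lt (half_lt_self hε)
  · exact (continuous_remainder hf).continuousAt.div
      (continuous_weight.comp continuous_snd).continuousAt (weight_pos hy).ne'

theorem weight_mul_remainder_div (x y : Eucl d) :
    weight y * (remainder f x y / weight y) = remainder f x y := by
  rcases eq_or_ne y 0 with rfl | hy
  · rw [remainder_zero, weight_zero]; simp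
  · exact mul_div_cancel₀ _ (weight_pos hy).ne'

end Taylor

/-! ### Short-time asymptotics of the Lévy semigroup on `C_b²` functions -/

section ShortTime

variable {d : ℕ}

theorem levyKernel_re (ξ y : Eucl d) : (levyKernel ξ y).re = Real.cos (inner ℝ y ξ) - 1 := by
  simp [levyKernel, Complex.exp_re]

theorem levyKernel_im (ξ y : Eucl d) :
    (levyKernel ξ y).im = Real.sin (inner ℝ y ξ) - inner ℝ (trunc y) ξ := by
  simp [levyKernel, Complex.exp_im]

variable (τ : LevyTriplet d)

theorem LevyTriplet.exponent_re (ξ : Eucl d) :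
    (τ.exponent ξ).re = -(1 / 2) * τ.quad ξ + ∫ y, (Real.cos (inner ℝ y ξ) - 1) ∂τ.ν := by
  have h : ∫ y, (Real.cos (inner ℝ y ξ) - 1) ∂τ.ν = (∫ y, levyKernel ξ y ∂τ.ν).re := by
    simp only [← levyKernel_re]
    exact integral_re (τ.integrable_levyKernel ξ)
  rw [τ.exponent_eq, h]
  simp

theorem LevyTriplet.exponent_im (ξ : Eucl d) :
    (τ.exponent ξ).im = inner ℝ τ.b ξ +
      ∫ y, (Real.sin (inner ℝ y ξ) - inner ℝ (trunc y) ξ) ∂τ.ν := by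
  have h : ∫ y, (Real.sin (inner ℝ y ξ) - inner ℝ (trunc y) ξ) ∂τ.ν =
      (∫ y, levyKernel ξ y ∂τ.ν).im := by
    simp only [← levyKernel_im]
    exact integral_im (τ.integrable_levyKernel ξ)
  rw [τ.exponent_eq, h]
  simp

theorem charFun_re_sub_one (μ : Measure (Eucl d)) [IsProbabilityMeasure μ] (ξ : Eucl d) :
    (charFun μ ξ - 1).re = ∫ y, (Real.cos (inner ℝ y ξ) - 1) ∂μ := by
  have hi : Integrable (fun y => Complex.exp ((inner ℝ y ξ : ℝ) * Complex.I)) μ :=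
    Integrable.of_bound (Continuous.aestronglyMeasurable (by fun_prop)) 1
      (.of_forall fun y => (Complex.norm_exp_ofReal_mul_I _).le)
  have h1 : charFun μ ξ - 1 = ∫ y, (Complex.exp ((inner ℝ y ξ : ℝ) * Complex.I) - 1) ∂μ := by
    rw [charFun_apply, integral_sub hi (integrable_const _)]
    simp
  rw [h1]
  refine (integral_re (hi.sub (integrable_const 1))).symm.trans (integral_congr_ae ?_)
  exact .of_forall fun y => by simp [Complex.exp_re]

theorem charFun_im_sub_one (μ : Measure (Eucl d)) [IsProbabilityMeasure μ] (ξ : Eucl d) :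
    (charFun μ ξ - 1).im = ∫ y, Real.sin (inner ℝ y ξ) ∂μ := by
  have hi : Integrable (fun y => Complex.exp ((inner ℝ y ξ : ℝ) * Complex.I)) μ :=
    Integrable.of_bound (Continuous.aestronglyMeasurable (by fun_prop)) 1
      (.of_forall fun y => (Complex.norm_exp_ofReal_mul_I _).le)
  rw [Complex.sub_im, Complex.one_im, sub_zero, charFun_apply]
  refine (integral_im hi).symm.trans (integral_congr_ae ?_)
  exact .of_forall fun y => by simp [Complex.exp_im]

theorem LevyTriplet.tendsto_integral_cos {t : ℕ → ℝ} (ht : ∀ n, 0 < t n)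
    (ht0 : Tendsto t atTop (𝓝 0)) {μ : ℕ → Measure (Eucl d)} [∀ n, IsProbabilityMeasure (μ n)]
    (hμ : ∀ n ξ, charFun (μ n) ξ = Complex.exp (t n * τ.exponent ξ)) (ξ : Eucl d) :
    Tendsto (fun n => (t n)⁻¹ * ∫ y, (Real.cos (inner ℝ y ξ) - 1) ∂(μ n)) atTop
      (𝓝 (-(1 / 2) * τ.quad ξ + ∫ y, (Real.cos (inner ℝ y ξ) - 1) ∂τ.ν)) := by
  have h := (Complex.continuous_re.tendsto _).comp (tendsto_exp_sub_one_div (τ.exponent ξ) ht ht0)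
  rw [τ.exponent_re] at h
  refine h.congr fun n => ?_
  rw [Function.comp_apply, ← hμ, Complex.re_ofReal_mul, charFun_re_sub_one]

theorem LevyTriplet.tendsto_integral_sin {t : ℕ → ℝ} (ht : ∀ n, 0 < t n)
    (ht0 : Tendsto t atTop (𝓝 0)) {μ : ℕ → Measure (Eucl d)} [∀ n, IsProbabilityMeasure (μ n)]
    (hμ : ∀ n ξ, charFun (μ n) ξ = Complex.exp (t n * τ.exponent ξ)) (i : Fin d) :
    Tendsto (fun n => (t n)⁻¹ * ∫ y, sinVec y i ∂(μ n)) atTop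
      (𝓝 (τ.b i + ∫ y, (sinVec y i - trunc y i) ∂τ.ν)) := by
  have h := (Complex.continuous_im.tendsto _).comp
    (tendsto_exp_sub_one_div (τ.exponent (EuclideanSpace.single i 1)) ht ht0)
  simp only [τ.exponent_im, EuclideanSpace.inner_single_right, one_mul] at h
  refine h.congr fun n => ?_
  rw [Function.comp_apply, ← hμ, Complex.im_ofReal_mul, charFun_im_sub_one]
  simp [sinVec_apply, EuclideanSpace.inner_single_right]

theorem LevyTriplet.quad_single_add_sub_quad_single_sub (i j : Fin d) :
    τ.quad (EuclideanSpace.single i 1 + EuclideanSpace.single j 1) -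
      τ.quad (EuclideanSpace.single i 1 - EuclideanSpace.single j 1) = 4 * τ.σ i j := by
  have hsymm : τ.σ j i = τ.σ i j := by simpa using τ.posSemidef.isHermitian.apply i j
  have h : ∀ ξ η : Eucl d, τ.quad (ξ + η) - τ.quad (ξ - η) =
      2 * ∑ k, ∑ l, (ξ k * τ.σ k l * η l + η k * τ.σ k l * ξ l) := by
    intro ξ η
    simp only [LevyTriplet.quad, PiLp.add_apply, PiLp.sub_apply, Finset.mul_sum,
      ← Finset.sum_sub_distrib]
    refine Finset.sum_congr rfl fun k _ => Finset.sum_congr rfl fun l _ => ?_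
    ring
  rw [h]
  simp only [PiLp.single_apply, Finset.sum_add_distrib]
  simp [hsymm]
  ring

theorem LevyTriplet.integrable_cos_sub_one (ξ : Eucl d) :
    Integrable (fun y => Real.cos (inner ℝ y ξ) - 1) τ.ν := by
  simp only [← levyKernel_re]
  exact (τ.integrable_levyKernel ξ).re

theorem sinVec_mul_sinVec (y : Eucl d) (i j : Fin d) : sinVec y i * sinVec y j =
    1 / 2 * ((Real.cos (inner ℝ y (EuclideanSpace.single i 1 - EuclideanSpace.single j 1)) - 1) -
      (Real.cos (inner ℝ y (EuclideanSpace.single i 1 + EuclideanSpace.single j 1)) - 1)) := by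
  simp only [inner_sub_right, inner_add_right, EuclideanSpace.inner_single_right, one_mul,
    sinVec_apply, Real.cos_sub, Real.cos_add]
  simp
  ring

theorem LevyTriplet.integrable_sinVec_mul_sinVec (i j : Fin d) :
    Integrable (fun y => sinVec y i * sinVec y j) τ.ν := by
  simp only [sinVec_mul_sinVec]
  exact ((τ.integrable_cos_sub_one _).sub (τ.integrable_cos_sub_one _)).const_mul _

theorem LevyTriplet.integrable_sinVec_sub_trunc (i : Fin d) :
    Integrable (fun y => sinVec y i - trunc y i) τ.ν := by
  have := (τ.integrable_levyKernel (EuclideanSpace.single i 1)).im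
  refine this.congr (.of_forall fun y => ?_)
  refine (levyKernel_im _ y).trans ?_
  simp [EuclideanSpace.inner_single_right, sinVec_apply]

/-- The product of sines is half a difference of cosines, so the limit comes from the real parts of
the exponent at e_i ∓ e_j; polarisation turns the quadratic forms into σ_ij. -/
theorem LevyTriplet.tendsto_integral_sin_mul_sin {t : ℕ → ℝ} (ht : ∀ n, 0 < t n)
    (ht0 : Tendsto t atTop (𝓝 0)) {μ : ℕ → Measure (Eucl d)} [∀ n, IsProbabilityMeasure (μ n)]
    (hμ : ∀ n ξ, charFun (μ n) ξ = Complex.exp (t n * τ.exponent ξ)) (i j : Fin d) :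
    Tendsto (fun n => (t n)⁻¹ * ∫ y, sinVec y i * sinVec y j ∂(μ n)) atTop
      (𝓝 (τ.σ i j + ∫ y, sinVec y i * sinVec y j ∂τ.ν)) := by
  have hi : ∀ n ξ, Integrable (fun y : Eucl d => Real.cos (inner ℝ y ξ) - 1) (μ n) := fun n ξ =>
    Integrable.of_bound (Continuous.aestronglyMeasurable (by fun_prop)) 2 (.of_forall fun y => by
      rw [Real.norm_eq_abs, abs_le]
      constructor <;> linarith [Real.neg_one_le_cos (inner ℝ y ξ), Real.cos_le_one (inner ℝ y ξ)])
  have h := ((τ.tendsto_integral_cos ht ht0 hμ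
      (EuclideanSpace.single i 1 - EuclideanSpace.single j 1)).sub
    (τ.tendsto_integral_cos ht ht0 hμ
      (EuclideanSpace.single i 1 + EuclideanSpace.single j 1))).const_mul (1 / 2)
  simp only [sinVec_mul_sinVec, integral_const_mul]
  rw [integral_sub (τ.integrable_cos_sub_one _) (τ.integrable_cos_sub_one _)]
  convert h using 2 with n
  · rw [integral_sub (hi n _) (hi n _)]
    ring
  · have := τ.quad_single_add_sub_quad_single_sub i j
    linarith

end ShortTime

/-! ### The Lévy operator as a short-time limit -/

section Generator

variable {d : ℕ} (τ : LevyTriplet d) {f : Eucl d → ℝ}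

theorem map_eq_sum_single {G : Type*} [NormedAddCommGroup G] [NormedSpace ℝ G]
    (L : Eucl d →L[ℝ] G) (v : Eucl d) :
    L v = ∑ i, v i • L (EuclideanSpace.single i 1) := by
  have h : v = ∑ i, v i • EuclideanSpace.single i (1 : ℝ) := by
    ext k
    simp [Pi.single_apply]
  conv_lhs => rw [h]
  simp

/-- The partial derivative `∂_i f(x)`. -/
def partialDeriv (f : Eucl d → ℝ) (i : Fin d) (x : Eucl d) : ℝ :=
  fderiv ℝ f x (EuclideanSpace.single i 1)

theorem continuous_partialDeriv (hf : MemCb 2 f) (i : Fin d) : Continuous (partialDeriv f i) :=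
  hf.continuous_fderiv.clm_apply continuous_const

theorem continuous_hessian_apply (hf : MemCb 2 f) (i j : Fin d) :
    Continuous fun x => hessian f x i j :=
  (hf.continuous_fderiv_fderiv.clm_apply continuous_const).clm_apply continuous_const

theorem abs_partialDeriv_le {C : ℝ} (hC : ∀ x, ‖fderiv ℝ f x‖ ≤ C) (i : Fin d) (x : Eucl d) :
    |partialDeriv f i x| ≤ C := by
  simpa [partialDeriv] using (fderiv ℝ f x).le_of_opNorm_le (hC x) (EuclideanSpace.single i 1)

theorem abs_hessian_apply_le {C : ℝ} (hC : ∀ x, ‖fderiv ℝ (fderiv ℝ f) x‖ ≤ C) (i j : Fin d)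
    (x : Eucl d) : |hessian f x i j| ≤ C := by
  simpa [hessian] using (fderiv ℝ (fderiv ℝ f) x).le_of_opNorm₂_le_of_le (hC x)
    (le_refl ‖EuclideanSpace.single i (1 : ℝ)‖) (le_refl ‖EuclideanSpace.single j (1 : ℝ)‖)

theorem fderiv_apply_eq_sum (x v : Eucl d) :
    fderiv ℝ f x v = ∑ i, partialDeriv f i x * v i := by
  rw [map_eq_sum_single]
  exact Finset.sum_congr rfl fun i _ => mul_comm _ _

theorem fderiv_fderiv_apply_eq_sum (x v w : Eucl d) :
    fderiv ℝ (fderiv ℝ f) x v w = ∑ i, ∑ j, hessian f x i j * (v i * w j) := by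
  rw [map_eq_sum_single (fderiv ℝ (fderiv ℝ f) x), sum_apply]
  refine Finset.sum_congr rfl fun i _ => ?_
  rw [smul_apply, map_eq_sum_single, Finset.smul_sum]
  refine Finset.sum_congr rfl fun j _ => ?_
  simp only [hessian, Matrix.of_apply, smul_eq_mul]
  ring

theorem inner_gradient_right (x v : Eucl d) :
    inner ℝ (gradient f x) v = ∑ i, partialDeriv f i x * v i := by
  rw [← fderiv_apply_eq_sum, gradient, InnerProductSpace.toDual_symm_apply]

theorem sub_eq_sum_add_weight_mul (x y : Eucl d) :
    f (x + y) - f x = ∑ i, partialDeriv f i x * sinVec y i +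
      1 / 2 * ∑ i, ∑ j, hessian f x i j * (sinVec y i * sinVec y j) +
      weight y * (remainder f x y / weight y) := by
  rw [weight_mul_remainder_div, remainder, fderiv_apply_eq_sum, fderiv_fderiv_apply_eq_sum]
  ring

/-- The linear functions `u` stay abstract: sin y_i for the law of Y_t, but sin y_i minus the
truncation for ν, where sin y_i alone need not be integrable. -/
theorem integral_quadratic_add {κ : Measure (Eucl d)} {u : Fin d → Eucl d → ℝ}
    {q r : Eucl d → ℝ} {w : Fin d → Fin d → Eucl d → ℝ}
    (hu : ∀ i, Integrable (u i) κ) (hw : ∀ i j, Integrable (w i j) κ) (hr : Integrable r κ)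
    (a : Fin d → ℝ) (c : Fin d → Fin d → ℝ)
    (hq : ∀ y, q y = ∑ i, a i * u i y + 1 / 2 * ∑ i, ∑ j, c i j * w i j y + r y) :
    ∫ y, q y ∂κ = ∑ i, a i * ∫ y, u i y ∂κ + 1 / 2 * ∑ i, ∑ j, c i j * ∫ y, w i j y ∂κ +
      ∫ y, r y ∂κ := by
  have h1 : Integrable (fun y => ∑ i, a i * u i y) κ :=
    integrable_finsetSum _ fun i _ => (hu i).const_mul _
  have h3 : ∀ i, Integrable (fun y => ∑ j, c i j * w i j y) κ := fun i =>
    integrable_finsetSum _ fun j _ => (hw i j).const_mul _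
  have h2 : Integrable (fun y => 1 / 2 * ∑ i, ∑ j, c i j * w i j y) κ :=
    (integrable_finsetSum _ fun i _ => h3 i).const_mul _
  have h12 : Integrable (fun y => ∑ i, a i * u i y + 1 / 2 * ∑ i, ∑ j, c i j * w i j y) κ :=
    h1.add h2
  simp only [hq]
  rw [integral_add h12 hr, integral_add h1 h2, integral_const_mul,
    integral_finsetSum _ fun i _ => (hu i).const_mul _, integral_finsetSum _ fun i _ => h3 i]
  simp only [integral_finsetSum _ fun j _ => (hw _ j).const_mul _, integral_const_mul]

theorem integrable_sinVec_apply (μ : Measure (Eucl d)) [IsFiniteMeasure μ] (i : Fin d) :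
    Integrable (fun y => sinVec y i) μ :=
  Integrable.of_bound (Continuous.aestronglyMeasurable (by unfold sinVec; fun_prop)) 1
    (.of_forall fun _ => Real.abs_sin_le_one _)

theorem integrable_sinVec_apply_mul (μ : Measure (Eucl d)) [IsFiniteMeasure μ] (i j : Fin d) :
    Integrable (fun y => sinVec y i * sinVec y j) μ :=
  Integrable.of_bound (Continuous.aestronglyMeasurable (by unfold sinVec; fun_prop)) 1
    (.of_forall fun y => by
      rw [norm_mul]
      exact mul_le_one₀ (Real.abs_sin_le_one _) (norm_nonneg _) (Real.abs_sin_le_one _))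

theorem continuous_remainder_right (hf : MemCb 2 f) (x : Eucl d) : Continuous (remainder f x) :=
  (continuous_remainder hf).comp (by fun_prop : Continuous fun y => (x, y))

theorem integrable_remainder (hf : MemCb 2 f) {κ : Measure (Eucl d)}
    (hκ : Integrable (fun y : Eucl d => min 1 (‖y‖ ^ 2)) κ) (x : Eucl d) :
    Integrable (remainder f x) κ := by
  obtain ⟨A, -, hA⟩ := exists_abs_remainder_le hf
  refine ((integrable_weight hκ).const_mul A).mono'
    (continuous_remainder_right hf x).aestronglyMeasurable (.of_forall fun y => hA x y)

theorem mul_integral_sub_eq (hf : MemCb 2 f) (μ : Measure (Eucl d)) [IsProbabilityMeasure μ]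
    (a : ℝ) (x : Eucl d) :
    a * ∫ y, (f (x + y) - f x) ∂μ = ∑ i, partialDeriv f i x * (a * ∫ y, sinVec y i ∂μ) +
      1 / 2 * ∑ i, ∑ j, hessian f x i j * (a * ∫ y, sinVec y i * sinVec y j ∂μ) +
      a * ∫ y, remainder f x y ∂μ := by
  have h := integral_quadratic_add (integrable_sinVec_apply μ) (integrable_sinVec_apply_mul μ)
    (integrable_remainder hf (integrable_min_of_isFiniteMeasure μ) x)
    (q := fun y => f (x + y) - f x) (fun i => partialDeriv f i x) (hessian f x) fun y => by
      rw [sub_eq_sum_add_weight_mul, weight_mul_remainder_div]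
  rw [h, mul_add, mul_add, Finset.mul_sum, mul_left_comm a, Finset.mul_sum]
  simp only [Finset.mul_sum, mul_left_comm a]

/-- Puts the operator into the shape of `mul_integral_sub_eq`, so that prelimit and limit can be
compared term by term. -/
theorem LevyTriplet.op_eq (hf : MemCb 2 f) (x : Eucl d) :
    τ.op f x = ∑ i, partialDeriv f i x * (τ.b i + ∫ y, (sinVec y i - trunc y i) ∂τ.ν) +
      1 / 2 * ∑ i, ∑ j, hessian f x i j * (τ.σ i j + ∫ y, sinVec y i * sinVec y j ∂τ.ν) +
      ∫ y, remainder f x y ∂τ.ν := by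
  have h1 := integral_quadratic_add τ.integrable_sinVec_sub_trunc τ.integrable_sinVec_mul_sinVec
    (integrable_remainder hf τ.integrable_min x)
    (q := fun y => f (x + y) - f x - inner ℝ (gradient f x) (trunc y))
    (fun i => partialDeriv f i x) (hessian f x) fun y => by
      rw [sub_eq_sum_add_weight_mul, weight_mul_remainder_div, inner_gradient_right]
      simp only [mul_sub, Finset.sum_sub_distrib]
      ring
  have h2 : (τ.σ * hessian f x).trace = ∑ i, ∑ j, hessian f x i j * τ.σ i j := by
    simp only [Matrix.trace, Matrix.diag_apply, Matrix.mul_apply]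
    rw [Finset.sum_comm]
    refine Finset.sum_congr rfl fun i _ => Finset.sum_congr rfl fun j _ => ?_
    have hsymm : τ.σ j i = τ.σ i j := by simpa using τ.posSemidef.isHermitian.apply i j
    rw [hsymm, mul_comm]
  rw [LevyTriplet.op, τ.restrict_compl_zero, h1, h2, real_inner_comm, inner_gradient_right]
  simp only [mul_add, Finset.sum_add_distrib]
  ring

theorem LevyTriplet.continuous_op (hf : MemCb 2 f) : Continuous (τ.op f) := by
  obtain ⟨A, -, hA⟩ := exists_abs_remainder_le hf
  have h1 := continuous_partialDeriv hf
  have h2 := continuous_hessian_apply hf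
  have h3 : Continuous fun x => ∫ y, remainder f x y ∂τ.ν :=
    continuous_of_dominated (fun x => (continuous_remainder_right hf x).aestronglyMeasurable)
      (fun x => .of_forall fun y => hA x y) ((integrable_weight τ.integrable_min).const_mul A)
      (.of_forall fun y => (continuous_remainder hf).comp
        (by fun_prop : Continuous fun x : Eucl d => (x, y)))
  rw [funext (τ.op_eq hf)]
  exact ((continuous_finsetSum _ fun i _ => (h1 i).mul_const _).add
    ((continuous_finsetSum _ fun i _ => continuous_finsetSum _ fun j _ =>
      (h2 i j).mul_const _).const_mul _)).add h3

theorem LevyTriplet.continuous_driftOp (hf : MemCb 2 f) {F : Eucl d → Eucl d}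
    (hF : Continuous F) : Continuous (τ.driftOp F f) := by
  refine Continuous.add ?_ (τ.continuous_op hf)
  simp only [inner_gradient_right]
  exact continuous_finsetSum _ fun i _ => (continuous_partialDeriv hf i).mul (by fun_prop)

theorem LevyTriplet.tendsto_op (hf : MemCb 2 f) {t : ℕ → ℝ} (ht : ∀ n, 0 < t n)
    (ht0 : Tendsto t atTop (𝓝 0)) {μ : ℕ → Measure (Eucl d)} [∀ n, IsProbabilityMeasure (μ n)]
    (hμ : ∀ n ξ, charFun (μ n) ξ = Complex.exp (t n * τ.exponent ξ))
    {x : ℕ → Eucl d} {x₀ : Eucl d} (hx : Tendsto x atTop (𝓝 x₀)) :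
    Tendsto (fun n => (t n)⁻¹ * ∫ y, (f (x n + y) - f (x n)) ∂(μ n)) atTop (𝓝 (τ.op f x₀)) := by
  obtain ⟨A, hA0, hA⟩ := exists_abs_remainder_le hf
  have hcont := continuous_remainder_div_weight hf
  have hq : ∀ x y, ‖remainder f x y / weight y‖ ≤ A := fun x y => by
    rw [Real.norm_eq_abs, abs_div, abs_of_nonneg (weight_nonneg _)]
    exact div_le_of_le_mul₀ (weight_nonneg _) hA0 (hA x y)
  have hlim : ∀ z, Tendsto (fun p : ℕ × Eucl d => remainder f (x p.1) p.2 / weight p.2)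
      (atTop ×ˢ 𝓝 z) (𝓝 (remainder f x₀ z / weight z)) := fun z => by
    have h4 : Tendsto (fun p : ℕ × Eucl d => (x p.1, p.2)) (atTop ×ˢ 𝓝 z) (𝓝 (x₀, z)) :=
      (hx.comp tendsto_fst).prodMk_nhds tendsto_snd
    have h5 : Tendsto (fun p : Eucl d × Eucl d => remainder f p.1 p.2 / weight p.2)
        (𝓝 (x₀, z)) (𝓝 (remainder f x₀ z / weight z)) := hcont.tendsto (x₀, z)
    exact Tendsto.comp (g := fun p : Eucl d × Eucl d => remainder f p.1 p.2 / weight p.2)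
      (f := fun p : ℕ × Eucl d => (x p.1, p.2)) h5 h4
  have hc : ∀ x, Continuous fun y => remainder f x y / weight y := fun x =>
    hcont.comp (by fun_prop : Continuous fun y => (x, y))
  have h3 := τ.tendsto_integral_rescaled ht ht0 hμ (C := A)
    (q := fun n y => remainder f (x n) y / weight y) (q₀ := fun y => remainder f x₀ y / weight y)
    (fun n => hc (x n)) (hc x₀) (fun n z => hq _ _) (fun z => hq _ _) hlim
    (by simp [remainder_zero])
  simp only [weight_mul_remainder_div] at h3
  have h1 : Tendsto (fun n => ∑ i, partialDeriv f i (x n) * ((t n)⁻¹ * ∫ y, sinVec y i ∂(μ n)))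
      atTop (𝓝 (∑ i, partialDeriv f i x₀ *
        (τ.b i + ∫ y, (sinVec y i - trunc y i) ∂τ.ν))) :=
    tendsto_finsetSum _ fun i _ => (((continuous_partialDeriv hf i).tendsto x₀).comp hx).mul
      (τ.tendsto_integral_sin ht ht0 hμ i)
  have h2 : Tendsto (fun n => ∑ i, ∑ j, hessian f (x n) i j *
      ((t n)⁻¹ * ∫ y, sinVec y i * sinVec y j ∂(μ n))) atTop (𝓝 (∑ i, ∑ j, hessian f x₀ i j *
        (τ.σ i j + ∫ y, sinVec y i * sinVec y j ∂τ.ν))) :=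
    tendsto_finsetSum _ fun i _ => tendsto_finsetSum _ fun j _ =>
      (((continuous_hessian_apply hf i j).tendsto x₀).comp hx).mul
        (τ.tendsto_integral_sin_mul_sin ht ht0 hμ i j)
  rw [τ.op_eq hf]
  exact ((h1.add (h2.const_mul (1 / 2))).add h3).congr fun n =>
    (mul_integral_sub_eq hf (μ n) (t n)⁻¹ (x n)).symm

/-- Uniformity in x holds because x enters only through bounded derivatives and a remainder
dominated by `weight`; the integrals multiplying them form convergent, hence bounded, sequences. -/
theorem LevyTriplet.exists_bound_integral_sub (hf : MemCb 2 f) {t : ℕ → ℝ} (ht : ∀ n, 0 < t n)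
    (ht0 : Tendsto t atTop (𝓝 0)) {μ : ℕ → Measure (Eucl d)} [∀ n, IsProbabilityMeasure (μ n)]
    (hμ : ∀ n ξ, charFun (μ n) ξ = Complex.exp (t n * τ.exponent ξ)) :
    ∃ C : ℝ, ∀ n x, |(t n)⁻¹ * ∫ y, (f (x + y) - f x) ∂(μ n)| ≤ C := by
  obtain ⟨A, hA0, hA⟩ := exists_abs_remainder_le hf
  obtain ⟨C, hC0, -, hC1, hC2⟩ := hf.exists_bound
  obtain ⟨W, hW0, hW⟩ := τ.exists_bound_integral_weight ht ht0 hμ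
  choose U hU using fun i => (τ.tendsto_integral_sin ht ht0 hμ i).abs.bddAbove_range
  choose V hV using fun i j => (τ.tendsto_integral_sin_mul_sin ht ht0 hμ i j).abs.bddAbove_range
  refine ⟨∑ i, C * U i + 1 / 2 * ∑ i, ∑ j, C * V i j + A * W, fun n x => ?_⟩
  have h1 : |∑ i, partialDeriv f i x * ((t n)⁻¹ * ∫ y, sinVec y i ∂(μ n))| ≤ ∑ i, C * U i :=
    (Finset.abs_sum_le_sum_abs _ _).trans (Finset.sum_le_sum fun i _ => by
      rw [abs_mul]
      exact mul_le_mul (abs_partialDeriv_le hC1 i x) (hU i ⟨n, rfl⟩) (abs_nonneg _) hC0)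
  have h2 : |∑ i, ∑ j, hessian f x i j * ((t n)⁻¹ * ∫ y, sinVec y i * sinVec y j ∂(μ n))| ≤
      ∑ i, ∑ j, C * V i j :=
    (Finset.abs_sum_le_sum_abs _ _).trans (Finset.sum_le_sum fun i _ =>
      (Finset.abs_sum_le_sum_abs _ _).trans (Finset.sum_le_sum fun j _ => by
        rw [abs_mul]
        exact mul_le_mul (abs_hessian_apply_le hC2 i j x) (hV i j ⟨n, rfl⟩) (abs_nonneg _) hC0))
  have h3 : |(t n)⁻¹ * ∫ y, remainder f x y ∂(μ n)| ≤ A * W := by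
    have hti : 0 ≤ (t n)⁻¹ := inv_nonneg.2 (ht n).le
    have h4 : |∫ y, remainder f x y ∂(μ n)| ≤ A * ∫ y, weight y ∂(μ n) := by
      rw [← integral_const_mul, ← Real.norm_eq_abs]
      exact norm_integral_le_of_norm_le
        ((integrable_weight (integrable_min_of_isFiniteMeasure (μ n))).const_mul A)
        (.of_forall fun y => hA x y)
    rw [abs_mul, abs_of_nonneg hti]
    calc _ ≤ (t n)⁻¹ * (A * ∫ y, weight y ∂(μ n)) := by gcongr
      _ = A * ((t n)⁻¹ * ∫ y, weight y ∂(μ n)) := by ring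
      _ ≤ A * W := by gcongr; exact hW n
  rw [mul_integral_sub_eq hf]
  refine (abs_add_le _ _).trans (add_le_add ((abs_add_le _ _).trans (add_le_add h1 ?_)) h3)
  rw [abs_mul, abs_of_pos (by norm_num : (0 : ℝ) < 1 / 2)]
  gcongr

end Generator

/-! ### The generator of the scheme -/

section DriftQuotient

variable {d : ℕ} {f : Eucl d → ℝ} {F : Eucl d → Eucl d}

/-- The difference quotient of `f` along one drift step. -/
def driftQuot (h : ℝ≥0) (F : Eucl d → Eucl d) (f : Eucl d → ℝ) (v : Eucl d) : ℝ :=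
  (h : ℝ)⁻¹ * (f (driftStep h F v) - f v)

theorem inner_gradient_left (x v : Eucl d) : inner ℝ (gradient f x) v = fderiv ℝ f x v := by
  rw [gradient, InnerProductSpace.toDual_symm_apply]

theorem continuous_driftQuot (hF : Continuous F) (hf : Continuous f) (h : ℝ≥0) :
    Continuous (driftQuot h F f) :=
  ((hf.comp (continuous_driftStep hF h)).sub hf).const_mul _

theorem abs_driftQuot_sub_le (hf : MemCb 2 f) {C : ℝ}
    (hC : ∀ x, ‖fderiv ℝ (fderiv ℝ f) x‖ ≤ C) {h : ℝ≥0} (hh : 0 < h) (v : Eucl d) :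
    |driftQuot h F f v - fderiv ℝ f v (tamed h F v)| ≤ C * (h * ‖tamed h F v‖ ^ 2) := by
  have h1 := abs_add_sub_sub_fderiv_le hf hC v ((h : ℝ) • tamed h F v)
  have hh' : (0 : ℝ) < h := hh
  have h2 : driftQuot h F f v - fderiv ℝ f v (tamed h F v) = (h : ℝ)⁻¹ *
      (f (v + (h : ℝ) • tamed h F v) - f v - fderiv ℝ f v ((h : ℝ) • tamed h F v)) := by
    rw [driftQuot, driftStep, map_smul, smul_eq_mul]
    field_simp
  rw [h2, abs_mul, abs_of_pos (inv_pos.2 hh'), inv_mul_le_iff₀ hh']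
  refine h1.trans (le_of_eq ?_)
  rw [norm_smul, Real.norm_of_nonneg hh'.le]
  ring

/-- The tamed field is F times a factor in (0,1], so its first-order term inherits the bound on ⟨∇f,
F⟩; taming bounds the second-order term. -/
theorem exists_bound_driftQuot (hf : MemCb 2 f)
    (hb : ∃ C : ℝ, ∀ x, |inner ℝ (gradient f x) (F x)| ≤ C) :
    ∃ C : ℝ, ∀ h : ℝ≥0, 0 < h → ∀ v, ‖driftQuot h F f v‖ ≤ C := by
  obtain ⟨C, hC⟩ := hb
  obtain ⟨C₂, hC0, -, -, hC2⟩ := hf.exists_bound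
  refine ⟨C₂ + C, fun h hh v => ?_⟩
  have h1 := abs_driftQuot_sub_le (F := F) hf hC2 hh v
  have h2 : (h : ℝ) * ‖tamed h F v‖ ^ 2 ≤ 1 := by
    rw [← Real.sq_sqrt h.coe_nonneg, ← mul_pow]
    exact pow_le_one₀ (by positivity) (sqrt_mul_norm_tamed_le h F v)
  have h3 : |fderiv ℝ f v (tamed h F v)| ≤ C := by
    rw [tamed, map_smul, smul_eq_mul, abs_mul, abs_of_nonneg (by positivity),
      ← inner_gradient_left]
    refine (mul_le_of_le_one_left (abs_nonneg _) (inv_le_one_of_one_le₀ ?_)).trans (hC v)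
    have : 0 ≤ √(h : ℝ) * ‖F v‖ := by positivity
    linarith
  have h4 : C₂ * (h * ‖tamed h F v‖ ^ 2) ≤ C₂ * 1 := by gcongr
  have h5 := abs_add_le (driftQuot h F f v - fderiv ℝ f v (tamed h F v))
    (fderiv ℝ f v (tamed h F v))
  rw [sub_add_cancel] at h5
  rw [Real.norm_eq_abs]
  linarith

theorem tendsto_driftQuot (hf : MemCb 2 f) (hF : Continuous F) {α : Type*} {l : Filter α}
    {h : α → ℝ≥0} (hpos : ∀ a, 0 < h a) (h0 : Tendsto h l (𝓝 0)) {v : α → Eucl d} {z : Eucl d}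
    (hv : Tendsto v l (𝓝 z)) :
    Tendsto (fun a => driftQuot (h a) F f (v a)) l (𝓝 (inner ℝ (gradient f z) (F z))) := by
  obtain ⟨C, hC0, -, -, hC⟩ := hf.exists_bound
  have h0' : Tendsto (fun a => (h a : ℝ)) l (𝓝 0) := NNReal.tendsto_coe.2 h0
  have hFv : Tendsto (fun a => F (v a)) l (𝓝 (F z)) := (hF.tendsto z).comp hv
  have hsq : Tendsto (fun a => √(h a : ℝ)) l (𝓝 0) := by
    simpa [Function.comp_def] using (Real.continuous_sqrt.tendsto 0).comp h0'
  have h1 : Tendsto (fun a => F (v a) - tamed (h a) F (v a)) l (𝓝 0) :=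
    squeeze_zero_norm (fun a => norm_sub_tamed_le _ _ _) (by simpa using hsq.mul (hFv.norm.pow 2))
  have h2 : Tendsto (fun a => tamed (h a) F (v a)) l (𝓝 (F z)) := by
    simpa using hFv.sub h1
  have h3 : Tendsto (fun a => driftQuot (h a) F f (v a) -
      fderiv ℝ f (v a) (tamed (h a) F (v a))) l (𝓝 0) :=
    squeeze_zero_norm (fun a => abs_driftQuot_sub_le hf hC (hpos a) (v a))
      (by simpa using (h0'.mul (h2.norm.pow 2)).const_mul C)
  have h4 : Tendsto (fun a => fderiv ℝ f (v a) (tamed (h a) F (v a))) l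
      (𝓝 (fderiv ℝ f z (F z))) := by
    have hc : Continuous fun p : Eucl d × Eucl d => fderiv ℝ f p.1 p.2 :=
      (hf.continuous_fderiv.comp continuous_fst).clm_apply continuous_snd
    exact (hc.tendsto (z, F z)).comp (hv.prodMk_nhds h2)
  rw [inner_gradient_left]
  simpa using h3.add h4

end DriftQuotient

/-! ### Difference quotients of a full step -/

section StepQuotient

variable {d : ℕ} {Ω : Type*} [MeasurableSpace Ω] {P : Measure Ω} [IsProbabilityMeasure P]
  {Y : ℝ≥0 → Ω → Eucl d} {F : Eucl d → Eucl d} {τ : LevyTriplet d} {f : Eucl d →ᵇ ℝ}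

/-- The difference quotient of `f` along one step of the scheme. -/
def stepQuot (hY : IsLevyProcess P Y) (hF : Continuous F) (f : Eucl d →ᵇ ℝ) (h : ℝ≥0) :
    Eucl d →ᵇ ℝ :=
  (h : ℝ)⁻¹ • (stepOp hY hF h f - f)

/-- Splits at the intermediate point x + Y_h: the drift acts from there, the noise acts from x. -/
theorem stepQuot_apply (hY : IsLevyProcess P Y) (hF : Continuous F) (f : Eucl d →ᵇ ℝ)
    (h : ℝ≥0) (x : Eucl d) :
    stepQuot hY hF f h x = ∫ ω, driftQuot h F f (x + Y h ω) ∂P +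
      (h : ℝ)⁻¹ * ∫ y, (f (x + y) - f x) ∂(P.map (Y h)) := by
  have hm : AEStronglyMeasurable (fun ω => x + Y h ω) P :=
    ((hY.measurable h).const_add x).aestronglyMeasurable
  have hi : ∀ g : Eucl d → Eucl d, Continuous g → Integrable (fun ω => f (g (x + Y h ω))) P :=
    fun g hg => Integrable.of_bound ((f.continuous.comp hg).comp_aestronglyMeasurable hm) ‖f‖
      (.of_forall fun ω => f.norm_coe_le_norm _)
  have h1 := hi _ (continuous_driftStep hF h)
  have h2 := hi _ continuous_id
  simp only [id_eq] at h2
  rw [integral_map (hY.measurable h).aemeasurable (Continuous.aestronglyMeasurable (by fun_prop)),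
    integral_sub h2 (integrable_const _)]
  simp only [driftQuot, integral_const_mul]
  rw [integral_sub h1 h2]
  simp [stepQuot, stepOp_apply]
  ring

theorem tendsto_stepQuot (hY : IsLevyProcess P Y) (hτ : HasLevyTriplet P Y τ) (hF : Continuous F)
    (hf : MemCb 2 f) (hb : ∃ C : ℝ, ∀ x, |inner ℝ (gradient f x) (F x)| ≤ C)
    {h : ℕ → ℝ≥0} (hpos : ∀ n, 0 < h n) (h0 : Tendsto h atTop (𝓝 0)) {x : ℕ → Eucl d}
    {x₀ : Eucl d} (hx : Tendsto x atTop (𝓝 x₀)) :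
    Tendsto (fun n => stepQuot hY hF f (h n) (x n)) atTop (𝓝 (τ.driftOp F f x₀)) := by
  have hprob : ∀ n, IsProbabilityMeasure (P.map (Y (h n))) := fun n =>
    Measure.isProbabilityMeasure_map (hY.measurable (h n)).aemeasurable
  obtain ⟨C, hC⟩ := exists_bound_driftQuot hf hb
  have hW : ∀ n, AEStronglyMeasurable (fun ω => x n + Y (h n) ω) P := fun n =>
    ((hY.measurable (h n)).const_add (x n)).aestronglyMeasurable
  have h1 : TendstoInMeasure P (fun n ω => x n + Y (h n) ω) atTop fun _ => x₀ := by
    refine tendstoInMeasure_of_sub_ae hW ((hY.stoch_continuous 0).comp h0) ?_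
    filter_upwards [hY.start_zero] with ω hω
    rw [hω]
    refine (tendsto_sub_nhds_zero_iff.2 hx).congr fun n => ?_
    simp only [Function.comp_apply]
    abel
  have h2 := tendsto_integral_of_tendstoInMeasure hW h1 (g := fun n => driftQuot (h n) F f)
    (g₀ := fun z => inner ℝ (gradient f z) (F z))
    (fun n => continuous_driftQuot hF f.continuous (h n)) (fun n z => hC _ (hpos n) z)
    (fun z => tendsto_driftQuot hf hF (fun p : ℕ × Eucl d => hpos p.1) (h0.comp tendsto_fst)
      tendsto_snd)
  simp only [integral_const, probReal_univ, one_smul] at h2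
  have h3 := τ.tendsto_op hf (t := fun n => (h n : ℝ)) hpos (NNReal.tendsto_coe.2 h0)
    (μ := fun n => P.map (Y (h n))) (fun n ξ => hτ (h n) ξ) hx
  refine (h2.add h3).congr fun n => ?_
  rw [stepQuot_apply]

theorem exists_bound_stepQuot (hY : IsLevyProcess P Y) (hτ : HasLevyTriplet P Y τ)
    (hF : Continuous F) (hf : MemCb 2 f) (hb : ∃ C : ℝ, ∀ x, |inner ℝ (gradient f x) (F x)| ≤ C)
    {h : ℕ → ℝ≥0} (hpos : ∀ n, 0 < h n) (h0 : Tendsto h atTop (𝓝 0)) :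
    ∃ C : ℝ, ∀ n x, ‖stepQuot hY hF f (h n) x‖ ≤ C := by
  have hprob : ∀ n, IsProbabilityMeasure (P.map (Y (h n))) := fun n =>
    Measure.isProbabilityMeasure_map (hY.measurable (h n)).aemeasurable
  obtain ⟨C₁, hC₁⟩ := exists_bound_driftQuot hf hb
  obtain ⟨C₂, hC₂⟩ := τ.exists_bound_integral_sub hf (t := fun n => (h n : ℝ)) hpos
    (NNReal.tendsto_coe.2 h0) (μ := fun n => P.map (Y (h n))) (fun n ξ => hτ (h n) ξ)
  refine ⟨C₁ + C₂, fun n x => ?_⟩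
  rw [stepQuot_apply]
  refine (norm_add_le _ _).trans (add_le_add ?_ (hC₂ n x))
  refine (norm_integral_le_of_norm_le_const (.of_forall fun ω => hC₁ _ (hpos n) _)).trans ?_
  simp

theorem tendsto_stepQuot_prod (hY : IsLevyProcess P Y) (hτ : HasLevyTriplet P Y τ)
    (hF : Continuous F) (hf : MemCb 2 f) (hb : ∃ C : ℝ, ∀ x, |inner ℝ (gradient f x) (F x)| ≤ C)
    {h : ℕ → ℝ≥0} (hpos : ∀ n, 0 < h n) (h0 : Tendsto h atTop (𝓝 0)) (z : Eucl d) :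
    Tendsto (fun p : ℕ × Eucl d => stepQuot hY hF f (h p.1) p.2) (atTop ×ˢ 𝓝 z)
      (𝓝 (τ.driftOp F f z)) :=
  tendsto_of_seq_tendsto fun _ hu => tendsto_stepQuot hY hτ hF hf hb (fun _ => hpos _)
    (h0.comp (tendsto_fst.comp hu)) (tendsto_snd.comp hu)

/-- Boundedness is inherited from the uniform bound on the step quotients that converge to it. -/
theorem exists_driftOp_eq (hY : IsLevyProcess P Y) (hτ : HasLevyTriplet P Y τ)
    (hF : Continuous F) (hf : MemCb 2 f)
    (hb : ∃ C : ℝ, ∀ x, |inner ℝ (gradient f x) (F x)| ≤ C) :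
    ∃ g : Eucl d →ᵇ ℝ, ∀ x, g x = τ.driftOp F f x := by
  set h : ℕ → ℝ≥0 := fun n => 1 / ((n : ℝ≥0) + 1)
  have hpos : ∀ n, 0 < h n := fun n => by positivity
  have h0 : Tendsto h atTop (𝓝 0) := tendsto_one_div_add_atTop_nhds_zero_nat
  obtain ⟨C, hC⟩ := exists_bound_stepQuot hY hτ hF hf hb hpos h0
  refine ⟨BoundedContinuousFunction.ofNormedAddCommGroup (τ.driftOp F f)
    (τ.continuous_driftOp hf hF) C fun x => ?_,
    fun x => rfl⟩
  exact le_of_tendsto (tendsto_stepQuot hY hτ hF hf hb hpos h0 (tendsto_const_nhds (x := x))).norm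
    (.of_forall fun n => hC n x)

end StepQuotient

/-! ### Dynkin's formula and the generator -/

/-- An average over steps becomes an integral of a step function over [0,1], to which dominated
convergence applies. -/
theorem integral_floor_mul (a : ℕ → ℝ) (m : ℕ) :
    ((m + 1 : ℕ) : ℝ)⁻¹ * ∑ k ∈ Finset.range (m + 1), a k =
      ∫ u in (0 : ℝ)..1, a ⌊u * (m + 1 : ℕ)⌋₊ := by
  set N : ℝ := ((m + 1 : ℕ) : ℝ) with hN
  have hN0 : 0 < N := by positivity
  have hpt : ∀ k : ℕ, ∀ u ∈ Set.Ico ((k : ℝ) / N) ((k + 1 : ℕ) / N), a ⌊u * N⌋₊ = a k := by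
    intro k u hu
    congr 1
    rw [Set.mem_Ico, div_le_iff₀ hN0, lt_div_iff₀ hN0] at hu
    rw [Nat.floor_eq_iff ((Nat.cast_nonneg k).trans hu.1)]
    exact ⟨hu.1, by exact_mod_cast hu.2⟩
  have hle : ∀ k : ℕ, (k : ℝ) / N ≤ (k + 1 : ℕ) / N := fun k => by gcongr; simp
  have hioo : ∀ k : ℕ, Set.EqOn (fun _ => a k) (fun u => a ⌊u * N⌋₊)
      (Set.Ioo ((k : ℝ) / N) ((k + 1 : ℕ) / N)) := fun k u hu =>
    (hpt k u ⟨hu.1.le, hu.2⟩).symm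
  have hint : ∀ k < m + 1, IntervalIntegrable (fun u => a ⌊u * N⌋₊) volume
      ((k : ℝ) / N) ((k + 1 : ℕ) / N) := by
    intro k _
    rw [intervalIntegrable_iff_integrableOn_Ioo_of_le (hle k)]
    exact (integrableOn_const (by simp)).congr_fun (hioo k) measurableSet_Ioo
  have h := intervalIntegral.sum_integral_adjacent_intervals hint
  rw [Nat.cast_zero, zero_div, div_self hN0.ne'] at h
  rw [← h, Finset.mul_sum]
  refine Finset.sum_congr rfl fun k _ => ?_
  have h2 : ∫ u in ((k : ℝ) / N)..((k + 1 : ℕ) / N), a ⌊u * N⌋₊ =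
      ∫ _u in ((k : ℝ) / N)..((k + 1 : ℕ) / N), a k := by
    rw [intervalIntegral.integral_of_le (hle k), intervalIntegral.integral_of_le (hle k),
      integral_Ioc_eq_integral_Ioo, integral_Ioc_eq_integral_Ioo]
    exact setIntegral_congr_fun measurableSet_Ioo fun u hu => (hioo k hu).symm
  rw [h2, intervalIntegral.integral_const, smul_eq_mul]
  push_cast
  field_simp
  ring

section Dynkin

variable {d : ℕ} {Ω : Type*} [MeasurableSpace Ω] {P : Measure Ω} [IsProbabilityMeasure P]
  {Y : ℝ≥0 → Ω → Eucl d} {τ : LevyTriplet d} {ω₀ : ℝ≥0} {F : Eucl d → Eucl d}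
  {X : Eucl d → ℝ≥0 → Ω → Eucl d} {f g : Eucl d →ᵇ ℝ}

/-- Discrete Dynkin formula: each step changes the expectation of f by h times that of the step
quotient, and the sum telescopes. -/
theorem integral_scheme_sub (hY : IsLevyProcess P Y) (hF : Continuous F) {h : ℝ≥0} (hh : 0 < h)
    {V : Ω → Eucl d} (hV : AEStronglyMeasurable[pastSigma Y 0] V P) (m : ℕ) (f : Eucl d →ᵇ ℝ) :
    ∫ ω, f (scheme h F (fun t => Y (0 + t) ω - Y 0 ω) (V ω) m) ∂P - ∫ ω, f (V ω) ∂P =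
      h * ∑ k ∈ Finset.range m,
        ∫ ω, stepQuot hY hF f h (scheme h F (fun t => Y (0 + t) ω - Y 0 ω) (V ω) k) ∂P := by
  have hh' : (h : ℝ) ≠ 0 := by positivity
  set U : ℕ → Ω → Eucl d := fun k ω => scheme h F (fun t => Y (0 + t) ω - Y 0 ω) (V ω) k
  have hint : ∀ (g : Eucl d →ᵇ ℝ) k, Integrable (fun ω => g (U k ω)) P := fun g k =>
    Integrable.of_bound (g.continuous.comp_aestronglyMeasurable
      ((aestronglyMeasurable_scheme hF h 0 hV k).mono (hY.pastSigma_le _))) ‖g‖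
      (.of_forall fun ω => g.norm_coe_le_norm _)
  have hstep : ∀ k, h * ∫ ω, stepQuot hY hF f h (U k ω) ∂P =
      ∫ ω, f (U (k + 1) ω) ∂P - ∫ ω, f (U k ω) ∂P := by
    intro k
    rw [hY.integral_scheme hF h 0 hV k f, ← integral_sub (hint _ k) (hint _ k),
      ← integral_const_mul]
    refine integral_congr_ae (.of_forall fun ω => ?_)
    simp [stepQuot, hh', U]
  rw [Finset.mul_sum]
  exact ((Finset.sum_congr rfl fun k _ => hstep k).trans
    (Finset.sum_range_sub (fun k => ∫ ω, f (U k ω) ∂P) m)).symm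

theorem norm_transOp_apply_le (hY : IsLevyProcess P Y) (hF : LipschitzWith ω₀ F)
    (hX : ∀ x, IsStrongSolution P Y F x (X x)) (t : ℝ≥0) (g : Eucl d →ᵇ ℝ) (x : Eucl d) :
    ‖transOp hY hF hX t g x‖ ≤ ‖g‖ :=
  (BoundedContinuousFunction.norm_coe_le_norm _ x).trans (norm_averageOp_le _ _ _ _ _)

theorem mixedTendsto_const (g : Eucl d →ᵇ ℝ) : MixedTendsto (fun _ => g) g :=
  mixedTendsto_of_tendsto_prod (fun _ => le_rfl) fun z => (g.continuous.tendsto z).comp tendsto_snd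

theorem continuous_transOp_apply (hY : IsLevyProcess P Y) (hF : LipschitzWith ω₀ F)
    (hX : ∀ x, IsStrongSolution P Y F x (X x)) (g : Eucl d →ᵇ ℝ) (x : Eucl d) :
    Continuous fun t => transOp hY hF hX t g x :=
  continuous_iff_seqContinuous.2 fun t t₀ ht =>
    tendsto_transOp hY hF hX t t₀ (fun _ => x) x (fun _ => g) g ht tendsto_const_nhds
      (mixedTendsto_const g)

/-- The limit of the discrete Dynkin formula, with time rescaled to [0,1] so that the domain of
integration is independent of t. -/
theorem transOp_sub_eq_integral (hY : IsLevyProcess P Y) (hτ : HasLevyTriplet P Y τ)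
    (hF : LipschitzWith ω₀ F) (hX : ∀ x, IsStrongSolution P Y F x (X x)) (hf : MemCb 2 f)
    (hb : ∃ C : ℝ, ∀ x, |inner ℝ (gradient f x) (F x)| ≤ C)
    (hg : ∀ x, g x = τ.driftOp F f x) {t : ℝ≥0} (ht : 0 < t) (x : Eucl d) :
    transOp hY hF hX t f x - f x =
      t * ∫ u in (0 : ℝ)..1, transOp hY hF hX (u.toNNReal * t) g x := by
  set ε : ℕ → ℝ≥0 := fun n => t / ↑(n + 1) with hε
  have hpos : ∀ n, 0 < ε n := fun n => by positivity
  have hε0 : Tendsto ε atTop (𝓝 0) := by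
    have h1 := (tendsto_one_div_add_atTop_nhds_zero_nat (𝕜 := ℝ≥0)).const_mul t
    rw [mul_zero] at h1
    refine h1.congr fun n => ?_
    simp [hε, div_eq_mul_inv]
  obtain ⟨C, hC⟩ := exists_bound_stepQuot hY hτ hF.continuous hf hb hpos hε0
  set U : ℕ → ℕ → Ω → Eucl d := fun n k ω =>
    scheme (ε n) F (fun t => Y (0 + t) ω - Y 0 ω) (X x 0 ω) k with hU
  have hUm : ∀ n k, AEStronglyMeasurable (U n k) P := fun n k =>
    (aestronglyMeasurable_scheme hF.continuous (ε n) 0 ((hX x).adapted 0) k).mono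
      (hY.pastSigma_le _)
  set a : ℕ → ℕ → ℝ := fun n k => ∫ ω, stepQuot hY hF.continuous f (ε n) (U n k ω) ∂P with ha
  have ha_le : ∀ n k, ‖a n k‖ ≤ C := fun n k => by
    refine (norm_integral_le_of_norm_le_const (.of_forall fun ω => hC n _)).trans ?_
    simp
  have hleft : Tendsto (fun n => t * ∫ u in (0 : ℝ)..1, a n ⌊u * (n + 1 : ℕ)⌋₊) atTop
      (𝓝 (transOp hY hF hX t f x - f x)) := by
    have h1 := tendsto_integral_iterate_stepOp hY hF (hX x) 0 ht f
    rw [zero_add] at h1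
    have h0 : ∫ ω, f (X x 0 ω) ∂P = f x :=
      congrArg (fun g : Eucl d →ᵇ ℝ => g x) (transOp_zero hY hF hX f)
    refine (h1.sub_const (f x)).congr fun n => ?_
    rw [← hY.integral_scheme_eq_iterate hF.continuous (ε n) 0 ((hX x).adapted 0) (n + 1) f, ← h0,
      integral_scheme_sub hY hF.continuous (hpos n) ((hX x).adapted 0) (n + 1) f,
      ← integral_floor_mul, ← mul_assoc]
    congr 1
  refine tendsto_nhds_unique hleft (Tendsto.const_mul _ ?_)
  refine intervalIntegral.tendsto_integral_filter_of_dominated_convergence (fun _ => C)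
    (.of_forall fun n => ?_) (.of_forall fun n => .of_forall fun u _ => ha_le n _)
    intervalIntegrable_const ?_
  · have h1 : Measurable fun u : ℝ => ⌊u * (n + 1 : ℕ)⌋₊ := by fun_prop
    exact ((measurable_of_countable (a n)).comp h1).aestronglyMeasurable
  · refine .of_forall fun u hu => ?_
    rw [Set.uIoc_of_le zero_le_one] at hu
    set k : ℕ → ℕ := fun n => ⌊u * (n + 1 : ℕ)⌋₊ with hk
    have hkn : ∀ n, k n ≤ n + 1 := fun n => Nat.floor_le_of_le
      (mul_le_of_le_one_left (Nat.cast_nonneg _) hu.2)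
    have hkt : Tendsto (fun n => 0 + k n * ε n) atTop (𝓝 (u.toNNReal * t)) := by
      rw [← NNReal.tendsto_coe]
      have h1 : Tendsto (fun n : ℕ => ((n + 1 : ℕ) : ℝ)) atTop atTop :=
        tendsto_natCast_atTop_atTop.comp (tendsto_add_atTop_nat 1)
      have h2 := ((tendsto_nat_floor_mul_div_atTop hu.1.le).comp h1).mul_const (t : ℝ)
      rw [NNReal.coe_mul, Real.coe_toNNReal u hu.1.le]
      refine h2.congr fun n => ?_
      simp only [Function.comp_apply, hk, hε, zero_add, NNReal.coe_mul, NNReal.coe_div,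
        NNReal.coe_natCast]
      ring
    -- The scheme after `k n` steps is almost surely close to X at time `k n * ε n`, and this
    -- converges in probability to X at time ut.
    have h1 : TendstoInMeasure P (fun n => U n (k n)) atTop (X x (u.toNNReal * t)) := by
      refine tendstoInMeasure_of_sub_ae (fun n => hUm n _)
        (tendstoInMeasure_flow hY hF hX hkt (tendsto_const_nhds (x := x))) ?_
      filter_upwards [(hX x).ae_tendsto_scheme hF 0 ht hkn] with ω hω
      have h2 := hω.neg
      rw [neg_zero] at h2
      refine h2.congr fun n => ?_
      simp only [hU, hε]
      abel
    refine tendsto_integral_of_tendstoInMeasure (fun n => hUm n _) h1 (C := C)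
      (fun n => BoundedContinuousFunction.continuous _) (fun n z => hC n z) fun z => ?_
    rw [hg]
    exact tendsto_stepQuot_prod hY hτ hF.continuous hf hb hpos hε0 z

/-- By Dynkin's formula the quotient is an average of T_{uh} g over u in [0,1]: contractivity bounds
it by ‖g‖, and joint continuity of the semigroup gives the limit along moving points. -/
theorem mixedTendstoZero_diffQuot_transOp (hY : IsLevyProcess P Y) (hτ : HasLevyTriplet P Y τ)
    (hF : LipschitzWith ω₀ F) (hX : ∀ x, IsStrongSolution P Y F x (X x)) (hf : MemCb 2 f)
    (hb : ∃ C : ℝ, ∀ x, |inner ℝ (gradient f x) (F x)| ≤ C)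
    (hg : ∀ x, g x = τ.driftOp F f x) :
    MixedTendstoZero (diffQuot (transOp hY hF hX) f) g := by
  intro h hpos h0
  have heq : ∀ n x, diffQuot (transOp hY hF hX) f (h n) x =
      ∫ u in (0 : ℝ)..1, transOp hY hF hX (u.toNNReal * h n) g x := fun n x => by
    have h1 := transOp_sub_eq_integral hY hτ hF hX hf hb hg (hpos n) x
    have h2 : (h n : ℝ) ≠ 0 := (NNReal.coe_pos.2 (hpos n)).ne'
    rw [diffQuot, BoundedContinuousFunction.smul_apply, BoundedContinuousFunction.sub_apply, h1,
      smul_eq_mul, inv_mul_cancel_left₀ h2]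
  refine mixedTendsto_of_tendsto_prod (C := ‖g‖) (fun n => ?_) fun z => ?_
  · refine (BoundedContinuousFunction.norm_le (norm_nonneg g)).2 fun x => ?_
    rw [heq]
    refine (intervalIntegral.norm_integral_le_of_norm_le_const fun u _ =>
      norm_transOp_apply_le hY hF hX _ g x).trans ?_
    simp
  · refine tendsto_of_seq_tendsto fun v hv => ?_
    simp only [heq]
    have hz : transOp hY hF hX 0 g z = g z := by rw [transOp_zero]
    have hconst : ∫ _u in (0 : ℝ)..1, g z = g z := by simp
    rw [← hconst]
    refine intervalIntegral.tendsto_integral_filter_of_dominated_convergence (fun _ => ‖g‖)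
      (.of_forall fun n => ?_)
      (.of_forall fun n => .of_forall fun u _ => norm_transOp_apply_le hY hF hX _ g _)
      intervalIntegrable_const (.of_forall fun u _ => ?_)
    · exact ((continuous_transOp_apply hY hF hX g _).comp
        (continuous_real_toNNReal.mul_const (h (v n).1))).aestronglyMeasurable
    · rw [← hz]
      refine tendsto_transOp hY hF hX _ 0 _ z (fun _ => g) g ?_ (tendsto_snd.comp hv)
        (mixedTendsto_const g)
      simpa using (h0.comp (tendsto_fst.comp hv)).const_mul u.toNNReal

end Dynkin

end LevyDrift
end

theorem mainTheorem9 {d : ℕ} {Ω : Type*} [MeasurableSpace Ω] (P : Measure Ω)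
    [IsProbabilityMeasure P]
    (τ : LevyDrift.LevyTriplet d)
    (Y : ℝ≥0 → Ω → LevyDrift.Eucl d)
    (hY : LevyDrift.IsLevyProcess P Y) (hτ : LevyDrift.HasLevyTriplet P Y τ)
    (ω₀ : ℝ≥0) (F : LevyDrift.Eucl d → LevyDrift.Eucl d) (hF : LipschitzWith ω₀ F)
    (X : LevyDrift.Eucl d → ℝ≥0 → Ω → LevyDrift.Eucl d)
    (hX : ∀ x, LevyDrift.IsStrongSolution P Y F x (X x)) :
    ∃ T : ℝ≥0 → ((LevyDrift.Eucl d →ᵇ ℝ) →ₗ[ℝ] (LevyDrift.Eucl d →ᵇ ℝ)),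
      (∀ t f x, T t f x = ∫ ω, f (X x t ω) ∂P) ∧
      LevyDrift.IsStronglyContinuousFellerSemigroup T ∧
      ∀ f : LevyDrift.Eucl d →ᵇ ℝ, LevyDrift.MemCb 2 f →
        (∃ C : ℝ, ∀ x, |inner ℝ (gradient f x) (F x)| ≤ C) →
        f ∈ LevyDrift.generatorDomain T ∧
          ∀ x, LevyDrift.generator T f x = τ.driftOp F f x := by
  refine ⟨LevyDrift.transOp hY hF hX, LevyDrift.transOp_apply hY hF hX,
    LevyDrift.isStronglyContinuousFellerSemigroup_transOp hY hF hX, fun f hf hb => ?_⟩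
  obtain ⟨g, hg⟩ := LevyDrift.exists_driftOp_eq hY hτ hF.continuous hf hb
  have h := LevyDrift.mixedTendstoZero_diffQuot_transOp hY hτ hF hX hf hb hg
  refine ⟨⟨g, h⟩, fun x => ?_⟩
  rw [LevyDrift.generator_eq h, hg]
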